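/- Let $n\ge 1$, $a<1$, $\varepsilon\ge 0$; write $z=(x,y)\in\mathbb R^n\times\mathbb R$, $\Sigma=\{y=0\}$, $B_r=\{|z|<r\}$. Put $\rho_\varepsilon^a(y)=(\varepsilon^2+y^2)^{a/2}\min\{\varepsilon^{-a},1\}$ if $a\ge0$ and $(\varepsilon^2+y^2)^{a/2}\max\{\varepsilon^{-a},1\}$ if $a\le 0$, for $\varepsilon>0$, and $\rho_0^a(y)=|y|^a$; let $\chi_\varepsilon^a(y)=\int_0^y\rho_\varepsilon^{-a}(s)\,ds$ and $\omega_\varepsilon^a=\rho_\varepsilon^a(1-a)^2(\chi_\varepsilon^a)^2$. For a weight $q$, $H^1(\Omega,q\,dz)$ is the closure of $C^\infty(\overline\Omega)$ for the norm $(\int_\Omega q u^2+\int_\Omega q|\nabla u|^2)^{1/2}$. Let $A$ be a symmetric, continuous, uniformly elliptic $(n+1)\times(n+1)$ matrix field on $B_1$ with $A(x,y)=JA(x,-y)J$, $J=\mathrm{diag}(1,\dots,1,-1)$, and $A(x,0)e_y=\mu(x,0)e_y$, written as $$A=\mu\begin{pmatrix}\tilde B & T\\ T & 1\end{pmatrix},\qquad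 \tilde A=\mu\tilde B .$$ Let $v=v_\varepsilon^a(x,y)=(1-a)\int_0^y\rho_\varepsilon^{-a}(s)\mu(x,s)^{-1}ds$, assumed to have a locally integrable weak gradient $\nabla v=(\nabla_xv,\partial_yv)$ in $B_1\setminus\Sigma$, and set $$\bar f=\frac fv,\quad \bar F=\frac Fv,\quad b^M=M\frac{\nabla_xv}{v},\quad \bar T=\frac{(1-a)\,T}{\rho_\varepsilon^a v},\quad t=\mu\, T\cdot b^{\mathbb I}.$$ An energy solution in $\Omega$ of $-\mathrm{div}(pA\nabla w)=pf+\mathrm{div}(pF_1)+\mathrm{div}(pF_2w)+pVw+p\,b\cdot\nabla w$ in $H^1(\Omega,q\,dz)$ is a $w\in H^1(\Omega,q\,dz)$ such that, for all $\phi\in C_c^\infty(\Omega)\cap H^1(\Omega,q\,dz)$, $$\int_\Omega pA\nabla w\cdot\nabla\phi=\int_\Omega pf\phi-\int_\Omega pF_1\cdot\nabla\phi-\int_\Omega p\,wF_2\cdot\nabla\phi+\int_\Omega pVw\phi+\int_\Omega p\,(b\cdot\nabla w)\phi ,$$ all integrals being absolutely convergent. **(i)** Let $u\in H^1(B_1,\rho_\varepsilon^a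 dz)$ be an odd-in-$y$ energy solution of $-\mathrm{div}(\rho_\varepsilon^aA\nabla u)=\rho_\varepsilon^af+\mathrm{div}(\rho_\varepsilon^aF)$ in $B_1$. Let $\bar d=n+3+(-a)^+$ and assume that, with respect to $\omega_\varepsilon^a dz$ on $B_1$, $\bar f-\bar F\cdot\nabla v/v\in L^{p}$ for some $p\ge \frac{2\bar d}{\bar d+2}$, $\bar F\in L^{p}$ for some $p\ge2$, $(b^{\tilde A}+\bar T,\,t)\in L^{p}$ for some $p\ge\bar d$, and $(b^{\tilde A}+\bar T)\cdot b^{\mathbb I}+t\,\partial_yv/v\in L^{p}$ for some $p\ge\bar d/2$. Then for every $0<r<1$ the function $w=u/v$ belongs to $H^1(B_r,\omega_\varepsilon^adz)$, is even in $y$, and is an energy solution in $B_r$ of $$\begin{aligned}-\mathrm{div}(\rho_\varepsilon^av^2A\nabla w)={}&\rho_\varepsilon^av^2\Big(\bar f-\frac{\bar F\cdot\nabla v}{v}\Big)+\mathrm{div}(\rho_\varepsilon^av^2\bar F)\\&+\mathrm{div}_x(\rho_\varepsilon^av^2b^{\tilde A}w)-\rho_\varepsilon^av^2\big(b^{\tilde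 A}\cdot b^{\mathbb I}w+b^{\tilde A}\cdot\nabla_xw\big)\\&+\mathrm{div}_x(\rho_\varepsilon^av^2\bar Tw)-\rho_\varepsilon^av^2\big(\bar T\cdot b^{\mathbb I}w+\bar T\cdot\nabla_xw\big)\\&+\partial_y(\rho_\varepsilon^av^2\,t\,w)-\rho_\varepsilon^av^2\Big(t\,\frac{\partial_yv}{v}w+t\,\partial_yw\Big).\end{aligned}$$ **(ii)** (Case $\varepsilon=0$, $A=\mathbb I$, $F=0$.) Let $u\in H^1(B_1,|y|^adz)$ be an odd-in-$y$ energy solution of $-\mathrm{div}(|y|^a\nabla u)=|y|^af$ in $B_1$, with $f/(y|y|^{-a})\in L^p(B_1,|y|^{2-a}dz)$ for some $p\ge\frac{2\bar d}{\bar d+2}$. Then for every $0<r<1$ the function $w=u/(y|y|^{-a})$ belongs to $H^1(B_r,|y|^{2-a}dz)$, is even in $y$, and is an energy solution of $-\mathrm{div}(|y|^{2-a}\nabla w)=|y|^{2-a}\,f/(y|y|^{-a})$ in $B_r$. -/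

import Mathlib

open MeasureTheory Filter Topology Set
open scoped ENNReal ContDiff Matrix

noncomputable section

namespace OddRatio

/-- The space `ℝⁿ⁺¹` of points `z = (x, y)`; the last coordinate is `y`. -/
abbrev Space (n : ℕ) := EuclideanSpace ℝ (Fin (n + 1))

/-- The coordinate `y` of `z = (x, y)`. -/
def yc {n : ℕ} (z : Space n) : ℝ := z (Fin.last n)

/-- The part `x ∈ ℝⁿ` of `z = (x, y)`; also used for `∇ₓ` as a part of `∇`. -/
def xPart {n : ℕ} (z : Space n) : Fin n → ℝ := fun i => z i.castSucc

/-- The point `(x, s)` for `z = (x, y)`. -/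
def withY {n : ℕ} (z : Space n) (s : ℝ) : Space n :=
  WithLp.toLp 2 (Function.update z.ofLp (Fin.last n) s)

/-- The reflection `(x, y) ↦ (x, -y)`. -/
def reflect {n : ℕ} (z : Space n) : Space n := withY z (-(yc z))

/-- The vector of `ℝⁿ⁺¹` with `x`-part `b` and `y`-component `t`. -/
def mkVec {n : ℕ} (b : Fin n → ℝ) (t : ℝ) : Space n :=
  WithLp.toLp 2 (Fin.snoc (α := fun _ => ℝ) b t)

/-- The characteristic manifold `Σ = {y = 0}`. -/
def charSet (n : ℕ) : Set (Space n) := {z | yc z = 0}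

/-- The open ball `B_r` centred at the origin. -/
abbrev B (n : ℕ) (r : ℝ) : Set (Space n) := Metric.ball (0 : Space n) r

/-! ### Weighted Sobolev spaces and energy solutions -/

/-- The measure `p dz` on `Ω`. -/
def wMeasure {n : ℕ} (p : Space n → ℝ) (Ω : Set (Space n)) : Measure (Space n) :=
  (volume.restrict Ω).withDensity (fun z => ENNReal.ofReal (p z))

/-- `φ ∈ C^∞(closure Ω)`: `φ` is smooth in `Ω` and all its derivatives extend continuously
to the closure of `Ω`. -/
def SmoothUpTo {n : ℕ} (Ω : Set (Space n)) (φ : Space n → ℝ) : Prop :=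
  ContDiffOn ℝ ∞ φ Ω ∧
    ∀ k : ℕ, ∃ G : Space n → (Space n [×k]→L[ℝ] ℝ),
      ContinuousOn G (closure Ω) ∧ EqOn G (iteratedFDeriv ℝ k φ) Ω

/-- `u ∈ H¹(Ω, p dz)` with gradient `g`: the pair `(u, g)` is the limit of `(φ, ∇φ)`,
`φ ∈ C^∞(closure Ω)`, in the norm `(∫_Ω p u² + ∫_Ω p |∇u|²)^{1/2}`. -/
def MemH1 {n : ℕ} (p : Space n → ℝ) (Ω : Set (Space n)) (u : Space n → ℝ)
    (g : Space n → Space n) : Prop :=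
  MemLp u 2 (wMeasure p Ω) ∧ MemLp g 2 (wMeasure p Ω) ∧
    ∃ φ : ℕ → Space n → ℝ, (∀ k, SmoothUpTo Ω (φ k)) ∧
      Tendsto (fun k => eLpNorm (fun z => φ k z - u z) 2 (wMeasure p Ω)) atTop (𝓝 0) ∧
      Tendsto (fun k => eLpNorm (fun z => gradient (φ k) z - g z) 2 (wMeasure p Ω)) atTop (𝓝 0)

/-- `φ ∈ C_c^∞(Ω)`. -/
def IsTest {n : ℕ} (Ω : Set (Space n)) (φ : Space n → ℝ) : Prop :=
  ContDiff ℝ ∞ φ ∧ HasCompactSupport φ ∧ tsupport φ ⊆ Ω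

/-- `w ∈ H¹(Ω, q dz)` is an energy solution in `Ω` of
`-div(p A∇w) = p f + div(p F₁) + div(p F₂ w) + p V w + p b·∇w`,
tested with all `φ ∈ C_c^∞(Ω) ∩ H¹(Ω, q dz)`; every integral is required to converge absolutely.
(The weights `p` and `q` will be equal or comparable.) -/
def IsEnergySolution {n : ℕ} (p q : Space n → ℝ)
    (A : Space n → Matrix (Fin (n + 1)) (Fin (n + 1)) ℝ)
    (f : Space n → ℝ) (F₁ F₂ : Space n → Space n) (V : Space n → ℝ) (b : Space n → Space n)
    (Ω : Set (Space n)) (w : Space n → ℝ) : Prop :=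
  ∃ g : Space n → Space n, MemH1 q Ω w g ∧
    ∀ φ : Space n → ℝ, IsTest Ω φ → MemH1 q Ω φ (gradient φ) →
      IntegrableOn (fun z => p z * ((A z *ᵥ (g z).ofLp) ⬝ᵥ (gradient φ z).ofLp)) Ω ∧
      IntegrableOn (fun z => p z * f z * φ z) Ω ∧
      IntegrableOn (fun z => p z * inner ℝ (F₁ z) (gradient φ z)) Ω ∧
      IntegrableOn (fun z => p z * w z * inner ℝ (F₂ z) (gradient φ z)) Ω ∧
      IntegrableOn (fun z => p z * V z * w z * φ z) Ω ∧
      IntegrableOn (fun z => p z * inner ℝ (b z) (g z) * φ z) Ω ∧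
      ∫ z in Ω, p z * ((A z *ᵥ (g z).ofLp) ⬝ᵥ (gradient φ z).ofLp) =
        (∫ z in Ω, p z * f z * φ z)
          - (∫ z in Ω, p z * inner ℝ (F₁ z) (gradient φ z))
          - (∫ z in Ω, p z * w z * inner ℝ (F₂ z) (gradient φ z))
          + (∫ z in Ω, p z * V z * w z * φ z)
          + (∫ z in Ω, p z * inner ℝ (b z) (g z) * φ z)

/-- `u` is odd in `y` on `Ω` (almost everywhere). -/
def OddInY {n : ℕ} (Ω : Set (Space n)) (u : Space n → ℝ) : Prop :=
  ∀ᵐ z ∂(volume.restrict Ω), u (reflect z) = -u z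

/-- `w` is even in `y` on `Ω` (almost everywhere). -/
def EvenInY {n : ℕ} (Ω : Set (Space n)) (w : Space n → ℝ) : Prop :=
  ∀ᵐ z ∂(volume.restrict Ω), w (reflect z) = w z

/-- `Dv` is the weak (distributional) gradient of `v` in `Ω`. -/
def IsWeakGradient {n : ℕ} (Ω : Set (Space n)) (v : Space n → ℝ)
    (Dv : Space n → Space n) : Prop :=
  LocallyIntegrableOn v Ω ∧ LocallyIntegrableOn Dv Ω ∧
    ∀ φ : Space n → ℝ, IsTest Ω φ →
      ∫ z in Ω, v z • gradient φ z = -∫ z in Ω, φ z • Dv z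

/-! ### The weights, the matrix and the characteristic odd function -/

/-- The weight `ρ_ε^a`; for `ε = 0` it is `|y|^a`. -/
def rho (ε a y : ℝ) : ℝ :=
  if ε = 0 then |y| ^ a
  else if 0 ≤ a then (ε ^ 2 + y ^ 2) ^ (a / 2) * min (ε ^ (-a)) 1
  else (ε ^ 2 + y ^ 2) ^ (a / 2) * max (ε ^ (-a)) 1

/-- `χ_ε^a(y) = ∫_0^y ρ_ε^{-a}(s) ds`. -/
def chi (ε a y : ℝ) : ℝ := ∫ s in (0 : ℝ)..y, rho ε (-a) s

/-- `ω_ε^a(y) = ρ_ε^a(y) (1-a)² χ_ε^a(y)²`. -/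
def omega (ε a y : ℝ) : ℝ := rho ε a y * (1 - a) ^ 2 * chi ε a y ^ 2

/-- The matrix `J = diag(1, …, 1, -1)`. -/
def matJ (n : ℕ) : Matrix (Fin (n + 1)) (Fin (n + 1)) ℝ :=
  Matrix.diagonal (fun i => if i = Fin.last n then -1 else 1)

/-- `μ(x, y)`, the lower right entry of `A`. -/
def mu {n : ℕ} (A : Space n → Matrix (Fin (n + 1)) (Fin (n + 1)) ℝ) (z : Space n) : ℝ :=
  A z (Fin.last n) (Fin.last n)

/-- Standing assumptions on the matrix `A` in `B_1`. The bounds `1/C ≤ μ ≤ C` are the case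
`ξ = e_y` of the ellipticity condition. -/
structure MatrixAssumption {n : ℕ}
    (A : Space n → Matrix (Fin (n + 1)) (Fin (n + 1)) ℝ) : Prop where
  symm : ∀ z ∈ B n 1, (A z).IsSymm
  reflection : ∀ z ∈ B n 1, A z = matJ n * A (reflect z) * matJ n
  cont : ContinuousOn A (B n 1)
  elliptic : ∃ l₁ l₂ : ℝ, 0 < l₁ ∧ l₁ ≤ l₂ ∧ ∀ z ∈ B n 1, ∀ ξ : Fin (n + 1) → ℝ,
    l₁ * (ξ ⬝ᵥ ξ) ≤ (A z *ᵥ ξ) ⬝ᵥ ξ ∧ (A z *ᵥ ξ) ⬝ᵥ ξ ≤ l₂ * (ξ ⬝ᵥ ξ)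
  invariant : ∀ z ∈ B n 1 ∩ charSet n,
    A z *ᵥ Pi.single (Fin.last n) 1 = mu A z • (Pi.single (Fin.last n) 1 : Fin (n + 1) → ℝ)

/-- `Ã = μ B̃`, the upper left `n × n` block of `A`. -/
def tildeA {n : ℕ} (A : Space n → Matrix (Fin (n + 1)) (Fin (n + 1)) ℝ) (z : Space n) :
    Matrix (Fin n) (Fin n) ℝ :=
  (A z).submatrix Fin.castSucc Fin.castSucc

/-- The field `T` in `A = μ (B̃, T; T, 1)`. -/
def fieldT {n : ℕ} (A : Space n → Matrix (Fin (n + 1)) (Fin (n + 1)) ℝ) (z : Space n) :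
    Fin n → ℝ :=
  fun i => A z i.castSucc (Fin.last n) / mu A z

/-- The characteristic odd function
`v_ε^a(x, y) = (1-a) ∫_0^y ρ_ε^{-a}(s) μ(x, s)⁻¹ ds`. -/
def vChar {n : ℕ} (ε a : ℝ) (A : Space n → Matrix (Fin (n + 1)) (Fin (n + 1)) ℝ)
    (z : Space n) : ℝ :=
  (1 - a) * ∫ s in (0 : ℝ)..yc z, rho ε (-a) s * (mu A (withY z s))⁻¹

/-! ### The auxiliary equation

In this section `v = v_ε^a` and `Dv` stands for its weak gradient. -/

/-- `b^M = M ∇ₓv / v` for a field `M` of `n × n` matrices. -/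
def bField {n : ℕ} (ε a : ℝ) (A : Space n → Matrix (Fin (n + 1)) (Fin (n + 1)) ℝ)
    (Dv : Space n → Space n) (M : Space n → Matrix (Fin n) (Fin n) ℝ) (z : Space n) :
    Fin n → ℝ :=
  (vChar ε a A z)⁻¹ • (M z *ᵥ xPart (Dv z))

/-- `T̄ = (1-a) T / (ρ v)`. -/
def barT {n : ℕ} (ε a : ℝ) (A : Space n → Matrix (Fin (n + 1)) (Fin (n + 1)) ℝ)
    (z : Space n) : Fin n → ℝ :=
  ((1 - a) / (rho ε a (yc z) * vChar ε a A z)) • fieldT A z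

/-- The field `G = (b^Ã + T̄, μ T·b^𝕀)`. -/
def fieldG {n : ℕ} (ε a : ℝ) (A : Space n → Matrix (Fin (n + 1)) (Fin (n + 1)) ℝ)
    (Dv : Space n → Space n) (z : Space n) : Space n :=
  mkVec (bField ε a A Dv (tildeA A) z + barT ε a A z)
    (mu A z * (fieldT A z ⬝ᵥ bField ε a A Dv (fun _ => 1) z))

/-- The forcing term `f̄ - F̄·∇v / v` with `f̄ = f / v`, `F̄ = F / v`. -/
def auxForcing {n : ℕ} (ε a : ℝ) (A : Space n → Matrix (Fin (n + 1)) (Fin (n + 1)) ℝ)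
    (f : Space n → ℝ) (F Dv : Space n → Space n) (z : Space n) : ℝ :=
  f z / vChar ε a A z -
    inner ℝ ((vChar ε a A z)⁻¹ • F z) (Dv z) / vChar ε a A z

/-- The field `F̄ = F / v`. -/
def auxField {n : ℕ} (ε a : ℝ) (A : Space n → Matrix (Fin (n + 1)) (Fin (n + 1)) ℝ)
    (F : Space n → Space n) (z : Space n) : Space n :=
  (vChar ε a A z)⁻¹ • F z

/-- The zero order coefficient `-G·∇v / v = -((b^Ã + T̄)·b^𝕀 + μ (T·b^𝕀) ∂_y v / v)`. -/
def auxPotential {n : ℕ} (ε a : ℝ) (A : Space n → Matrix (Fin (n + 1)) (Fin (n + 1)) ℝ)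
    (Dv : Space n → Space n) (z : Space n) : ℝ :=
  -(inner ℝ (fieldG ε a A Dv z) (Dv z) / vChar ε a A z)

/-- The effective dimension `n + 3 + (-a)⁺`. -/
def effDim (n : ℕ) (a : ℝ) : ℝ := n + 3 + max (-a) 0

/-- Integrability of the coefficients `f, F₁, F₂, V, b` of the auxiliary equation with respect to
`q dz` on `B_1`, where `d = n + 3 + (-a)⁺`: exponents at least `2d/(d+2)`, `2`, `d`, `d/2`, `d`. -/
structure AuxIntegrability {n : ℕ} (a : ℝ) (q f : Space n → ℝ) (F₁ F₂ : Space n → Space n)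
    (V : Space n → ℝ) (b : Space n → Space n) : Prop where
  forcing : ∃ p : ℝ≥0∞, ENNReal.ofReal (2 * effDim n a / (effDim n a + 2)) ≤ p ∧
    MemLp f p (wMeasure q (B n 1))
  field : ∃ p : ℝ≥0∞, 2 ≤ p ∧ MemLp F₁ p (wMeasure q (B n 1))
  fieldw : ∃ p : ℝ≥0∞, ENNReal.ofReal (effDim n a) ≤ p ∧ MemLp F₂ p (wMeasure q (B n 1))
  potential : ∃ p : ℝ≥0∞, ENNReal.ofReal (effDim n a / 2) ≤ p ∧ MemLp V p (wMeasure q (B n 1))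
  drift : ∃ p : ℝ≥0∞, ENNReal.ofReal (effDim n a) ≤ p ∧ MemLp b p (wMeasure q (B n 1))

end OddRatio

end

/-! Everything is governed by one exponent b (`wExp`), equal to a when ε = 0 and to 0 when ε > 0, so
that b < 1. In B_1 the weight ρ is comparable to |y|^b, |v| to |y|^(1-b), and both ω and ρv² to
|y|^(2-b). Dividing by v therefore carries the ρ-weighted L² norm of u into the ω-weighted L² norm
of w = u/v, and all norms reduce to Lebesgue norms with a power of |y|.

The function v is an approximate solution: ρA∇v = ρvG + (1-a)e_y with G = (b^Ã + T̄, t), and the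
last vector is constant (`mulVec_gradient_vChar`). Ellipticity then gives |∇v| ≤ C|v|(|G| + 1/|y|)
(`exists_norm_gradient_vChar_le`). Since ∇w = v⁻¹(∇u - w∇v), the bound on ∇w reduces to two facts in
L²(|y|^b dz). That u/y belongs to it is Hardy's inequality, which holds because u is odd and b < 1
(`hardy`, `memLp_div_yc_of_odd`). That u|G| belongs to it on B_r is a weighted Sobolev estimate
(`exists_eLpNorm_mul_le`), a Hölder interpolation between the L^d bound on G, Sobolev's inequality
and Hardy's; this is where the effective dimension d enters.

Membership in H¹ also asks for smooth approximations. Because u/y is square integrable, u is on B_r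
a limit of test functions Φ_k vanishing near Σ (`exists_test_approx`). Each Φ_k/v is in turn a limit
of smooth functions Φ_k/V_m, where V_m are mollifications of v (`exists_quotient_approx`); a
diagonal choice finishes the argument (`memH1_quotient`).

For the equation, the equation of u is tested with Φv, Φ supported off Σ (`weakForm_mul`). By
`flux_identity` the integrand is that of the equation of w plus (1-a)(u∂_yΦ + Φ∂_yu), a pure
y-derivative with zero integral (`integral_mul_yc_gradient_add`). General test functions are reached
by cutoffs η_j with |∇η_j| ≤ C/|y|; the limit is legitimate because the flux of w divided by |y| is
integrable (`integral_eq_zero_of_cutoff`). Evenness holds because v is odd, μ being even in y. The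
model case is the specialization v = y|y|^(-a), G = 0. -/

namespace OddRatio

variable {n : ℕ}

/-! ### Coordinates -/

/-- The unit vector in the `y` direction. -/
noncomputable def ey (n : ℕ) : Space n := EuclideanSpace.single (Fin.last n) 1

/-- The coordinate `y` as a continuous linear functional. -/
noncomputable def ycL (n : ℕ) : Space n →L[ℝ] ℝ := EuclideanSpace.proj (Fin.last n)

lemma ycL_apply (z : Space n) : ycL n z = yc z := rfl

lemma continuous_yc : Continuous (yc : Space n → ℝ) := (ycL n).continuous

lemma measurable_yc : Measurable (yc : Space n → ℝ) := continuous_yc.measurable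

lemma contDiff_yc {m : WithTop ℕ∞} : ContDiff ℝ m (yc : Space n → ℝ) := (ycL n).contDiff

lemma yc_ey : yc (ey n) = 1 := by simp [yc, ey]

lemma norm_ey : ‖ey n‖ = 1 := by simp [ey]

lemma yc_add (z w : Space n) : yc (z + w) = yc z + yc w := rfl

lemma yc_smul (c : ℝ) (z : Space n) : yc (c • z) = c * yc z := rfl

lemma inner_ey (z : Space n) : inner ℝ z (ey n) = yc z := by
  simp [ey, yc, EuclideanSpace.inner_single_right]

lemma abs_yc_le (z : Space n) : |yc z| ≤ ‖z‖ :=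
  by simpa [yc] using PiLp.norm_apply_le z (Fin.last n)

lemma abs_yc_lt {r : ℝ} {z : Space n} (hz : z ∈ B n r) : |yc z| < r :=
  (abs_yc_le z).trans_lt (by simpa using hz)

lemma withY_eq (z : Space n) (s : ℝ) : withY z s = z + (s - yc z) • ey n := by
  ext i
  by_cases hi : i = Fin.last n
  · subst hi; simp [withY, ey, yc]
  · simp [withY, ey, hi]

lemma yc_withY (z : Space n) (s : ℝ) : yc (withY z s) = s := by simp [withY, yc]

lemma withY_withY (z : Space n) (s t : ℝ) : withY (withY z s) t = withY z t := by
  ext i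
  by_cases hi : i = Fin.last n
  · subst hi; simp [withY]
  · simp [withY]

lemma withY_add_ey (z : Space n) (s t : ℝ) : withY (z + t • ey n) s = withY z s := by
  rw [withY_eq, withY_eq, yc_add, yc_smul, yc_ey, add_assoc, ← add_smul]
  congr 2; ring

lemma withY_self (z : Space n) : withY z (yc z) = z := by simp [withY_eq]

lemma norm_withY_sq (z : Space n) (s : ℝ) : ‖withY z s‖ ^ 2 = ‖z‖ ^ 2 - yc z ^ 2 + s ^ 2 := by
  rw [EuclideanSpace.norm_sq_eq, EuclideanSpace.norm_sq_eq, Fin.sum_univ_castSucc,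
    Fin.sum_univ_castSucc]
  simp [withY, yc]

lemma norm_withY_le {z : Space n} {s : ℝ} (hs : |s| ≤ |yc z|) : ‖withY z s‖ ≤ ‖z‖ := by
  have h := norm_withY_sq z s
  have h2 : s ^ 2 ≤ yc z ^ 2 := sq_le_sq.2 hs
  exact le_of_sq_le_sq (by linarith) (norm_nonneg _)

lemma withY_mem {r : ℝ} {z : Space n} {s : ℝ} (hz : z ∈ B n r) (hs : |s| ≤ |yc z|) :
    withY z s ∈ B n r := by
  simp only [Metric.mem_ball, dist_zero_right] at hz ⊢
  exact (norm_withY_le hs).trans_lt hz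

lemma continuous_withY : Continuous (fun p : Space n × ℝ => withY p.1 p.2) := by
  simp only [withY_eq]
  exact continuous_fst.add (((continuous_snd.sub (continuous_yc.comp continuous_fst))).smul
    continuous_const)

lemma reflect_reflect (z : Space n) : reflect (reflect z) = z := by
  simp [reflect, yc_withY, withY_withY, withY_self]

lemma yc_reflect (z : Space n) : yc (reflect z) = -yc z := yc_withY _ _

lemma norm_reflect (z : Space n) : ‖reflect z‖ = ‖z‖ :=
  le_antisymm (norm_withY_le (by simp)) (by
    conv_lhs => rw [← reflect_reflect z]
    exact norm_withY_le (by simp))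

lemma reflect_mem_iff {r : ℝ} {z : Space n} : reflect z ∈ B n r ↔ z ∈ B n r := by
  simp [norm_reflect]

lemma isClosed_charSet : IsClosed (charSet n) := isClosed_eq continuous_yc continuous_const

lemma volume_charSet : volume (charSet n) = 0 := by
  have h : charSet n = (LinearMap.ker (ycL n).toLinearMap : Set (Space n)) := by
    ext z; simp [charSet, ycL_apply]
  rw [h]
  refine Measure.addHaar_submodule _ _ fun htop => ?_
  have : ey n ∈ LinearMap.ker (ycL n).toLinearMap := htop ▸ Submodule.mem_top
  simp [ycL_apply, yc_ey] at this

lemma ae_yc_ne (Ω : Set (Space n)) : ∀ᵐ z ∂(volume.restrict Ω), yc z ≠ 0 :=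
  ae_restrict_of_ae (measure_eq_zero_iff_ae_notMem.1 volume_charSet)

lemma ae_restrict_ball {r : ℝ} : ∀ᵐ z ∂(volume.restrict (B n r)), z ∈ B n r ∧ yc z ≠ 0 :=
  (ae_restrict_mem Metric.isOpen_ball.measurableSet).and (ae_yc_ne _)

lemma isOpen_ball_diff {r : ℝ} : IsOpen (B n r \ charSet n) :=
  Metric.isOpen_ball.sdiff isClosed_charSet

lemma restrict_ball_diff {r : ℝ} :
    (volume : Measure (Space n)).restrict (B n r \ charSet n) = volume.restrict (B n r) :=
  Measure.restrict_congr_set (sdiff_null_ae_eq_self volume_charSet)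

/-! ### Weighted norms -/

lemma lintegral_wMeasure {p : Space n → ℝ} (hp : Measurable p) (Ω : Set (Space n))
    (f : Space n → ℝ≥0∞) :
    ∫⁻ z, f z ∂(wMeasure p Ω) = ∫⁻ z in Ω, ENNReal.ofReal (p z) * f z := by
  rw [wMeasure, lintegral_withDensity_eq_lintegral_mul_non_measurable _ hp.ennreal_ofReal
    (ae_of_all _ fun _ => ENNReal.ofReal_lt_top)]
  rfl

lemma eLpNorm_two_sq {α E : Type*} [MeasurableSpace α] [NormedAddCommGroup E] (μ : Measure α)
    (f : α → E) : eLpNorm f 2 μ ^ 2 = ∫⁻ z, ‖f z‖ₑ ^ 2 ∂μ := by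
  rw [eLpNorm_eq_lintegral_rpow_enorm_toReal (by norm_num) (by norm_num)]
  simp only [ENNReal.toReal_ofNat, ENNReal.rpow_ofNat]
  rw [← ENNReal.rpow_natCast, ← ENNReal.rpow_mul]
  norm_num

/-- The weight moves into the integrand as its square root, so that estimates can be made in
Lebesgue L². Negative values of p are harmless: `ENNReal.ofReal` and the square root both truncate
them to zero. -/
lemma eLpNorm_wMeasure {E : Type*} [NormedAddCommGroup E] [NormedSpace ℝ E] {p : Space n → ℝ}
    (hp : Measurable p) (Ω : Set (Space n)) (f : Space n → E) :
    eLpNorm f 2 (wMeasure p Ω) = eLpNorm (fun z => √(p z) • f z) 2 (volume.restrict Ω) := by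
  have h : eLpNorm f 2 (wMeasure p Ω) ^ 2 =
      eLpNorm (fun z => √(p z) • f z) 2 (volume.restrict Ω) ^ 2 := by
    rw [eLpNorm_two_sq, eLpNorm_two_sq, lintegral_wMeasure hp]
    refine lintegral_congr fun z => ?_
    rw [enorm_smul, mul_pow, Real.enorm_of_nonneg (Real.sqrt_nonneg _),
      ← ENNReal.ofReal_pow (Real.sqrt_nonneg _)]
    congr 1
    rcases le_total 0 (p z) with h0 | h0
    · rw [Real.sq_sqrt h0]
    · rw [Real.sqrt_eq_zero_of_nonpos h0, ENNReal.ofReal_of_nonpos h0]; simp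
  exact (ENNReal.pow_right_strictMono two_ne_zero).injective h

lemma wMeasure_absolutelyContinuous (p : Space n → ℝ) (Ω : Set (Space n)) :
    wMeasure p Ω ≪ volume.restrict Ω := withDensity_absolutelyContinuous _ _

lemma absolutelyContinuous_wMeasure {p : Space n → ℝ} (hp : Measurable p) {Ω : Set (Space n)}
    (h : ∀ᵐ z ∂(volume.restrict Ω), 0 < p z) : volume.restrict Ω ≪ wMeasure p Ω := by
  refine withDensity_absolutelyContinuous' hp.ennreal_ofReal.aemeasurable ?_
  filter_upwards [h] with z hz
  simpa using hz

lemma measurable_pow_yc (β : ℝ) : Measurable (fun z : Space n => |yc z| ^ β) :=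
  (continuous_abs.measurable.comp measurable_yc).pow_const _

lemma sqrt_rpow_abs (c y β : ℝ) (hc : 0 ≤ c) : √(c * |y| ^ β) = √c * |y| ^ (β / 2) := by
  rw [Real.sqrt_mul hc, Real.sqrt_eq_rpow (|y| ^ β), ← Real.rpow_mul (abs_nonneg y)]
  ring_nf

/-- `p` is comparable on `Ω` to the power `|y|^β`. -/
def Comparable (p : Space n → ℝ) (Ω : Set (Space n)) (β : ℝ) : Prop :=
  ∃ c C : ℝ, 0 < c ∧ 0 < C ∧ ∀ z ∈ Ω, yc z ≠ 0 → c * |yc z| ^ β ≤ p z ∧ p z ≤ C * |yc z| ^ β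

lemma Comparable.mono {p : Space n → ℝ} {Ω Ω' : Set (Space n)} {β : ℝ} (h : Comparable p Ω β)
    (hs : Ω' ⊆ Ω) : Comparable p Ω' β := by
  obtain ⟨c, C, hc, hC, h⟩ := h
  exact ⟨c, C, hc, hC, fun z hz => h z (hs hz)⟩

lemma Comparable.pos {p : Space n → ℝ} {Ω : Set (Space n)} {β : ℝ} (h : Comparable p Ω β)
    {z : Space n} (hz : z ∈ Ω) (hy : yc z ≠ 0) : 0 < p z := by
  obtain ⟨c, C, hc, hC, h⟩ := h
  exact (mul_pos hc (Real.rpow_pos_of_pos (abs_pos.2 hy) _)).trans_le (h z hz hy).1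

lemma Comparable.ae_pos {p : Space n → ℝ} {r β : ℝ} (h : Comparable p (B n r) β) :
    ∀ᵐ z ∂(volume.restrict (B n r)), 0 < p z := by
  filter_upwards [ae_restrict_ball] with z hz using h.pos hz.1 hz.2

lemma Comparable.exists_eLpNorm_le {E : Type*} [NormedAddCommGroup E] [NormedSpace ℝ E]
    {p : Space n → ℝ} {r β : ℝ} (hp : Measurable p) (h : Comparable p (B n r) β) :
    ∃ C : ℝ, 0 < C ∧ ∀ f : Space n → E, eLpNorm f 2 (wMeasure p (B n r)) ≤
      ENNReal.ofReal C * eLpNorm (fun z => |yc z| ^ (β / 2) • f z) 2 (volume.restrict (B n r)) := by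
  obtain ⟨c, C, hc, hC, h⟩ := h
  refine ⟨√C, Real.sqrt_pos.2 hC, fun f => ?_⟩
  rw [eLpNorm_wMeasure hp]
  refine eLpNorm_le_mul_eLpNorm_of_ae_le_mul ?_ _
  filter_upwards [ae_restrict_ball] with z hz
  rw [norm_smul, norm_smul, ← mul_assoc, Real.norm_of_nonneg (Real.sqrt_nonneg _),
    Real.norm_of_nonneg (by positivity), ← sqrt_rpow_abs _ _ _ hC.le]
  gcongr
  exact (h z hz.1 hz.2).2

lemma Comparable.exists_le_eLpNorm {E : Type*} [NormedAddCommGroup E] [NormedSpace ℝ E]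
    {p : Space n → ℝ} {r β : ℝ} (hp : Measurable p) (h : Comparable p (B n r) β) :
    ∃ C : ℝ, 0 < C ∧ ∀ f : Space n → E,
      eLpNorm (fun z => |yc z| ^ (β / 2) • f z) 2 (volume.restrict (B n r)) ≤
      ENNReal.ofReal C * eLpNorm f 2 (wMeasure p (B n r)) := by
  obtain ⟨c, C, hc, hC, h⟩ := h
  refine ⟨(√c)⁻¹, inv_pos.2 (Real.sqrt_pos.2 hc), fun f => ?_⟩
  rw [eLpNorm_wMeasure hp]
  refine eLpNorm_le_mul_eLpNorm_of_ae_le_mul ?_ _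
  filter_upwards [ae_restrict_ball] with z hz
  have hsc := Real.sqrt_pos.2 hc
  rw [norm_smul, norm_smul, ← mul_assoc, Real.norm_of_nonneg (Real.sqrt_nonneg _),
    Real.norm_of_nonneg (by positivity)]
  gcongr
  rw [le_inv_mul_iff₀ hsc, ← sqrt_rpow_abs _ _ _ hc.le]
  gcongr
  exact (h z hz.1 hz.2).1

/-- Comparability costs only constants, and Σ, where p is not controlled, is a null set. From here
on the weights ρ and ω are replaced by powers of |y|. -/
lemma Comparable.memLp_iff {E : Type*} [NormedAddCommGroup E] [NormedSpace ℝ E]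
    {p : Space n → ℝ} {r β : ℝ} (hp : Measurable p) (h : Comparable p (B n r) β)
    {f : Space n → E} : MemLp f 2 (wMeasure p (B n r)) ↔
      MemLp (fun z => |yc z| ^ (β / 2) • f z) 2 (volume.restrict (B n r)) := by
  have hpow : ∀ᵐ z ∂(volume.restrict (B n r)), 0 < |yc z| ^ (β / 2) := by
    filter_upwards [ae_restrict_ball] with z hz
    exact Real.rpow_pos_of_pos (abs_pos.2 hz.2) _
  constructor
  · intro hf
    obtain ⟨C, -, hC⟩ := h.exists_le_eLpNorm (E := E) hp
    refine ⟨(measurable_pow_yc _).aestronglyMeasurable.smul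
      (hf.1.mono_ac (absolutelyContinuous_wMeasure hp h.ae_pos)), (hC f).trans_lt ?_⟩
    exact ENNReal.mul_lt_top ENNReal.ofReal_lt_top hf.2
  · intro hf
    obtain ⟨C, -, hC⟩ := h.exists_eLpNorm_le (E := E) hp
    refine ⟨AEStronglyMeasurable.mono_ac (wMeasure_absolutelyContinuous p _) ?_,
      (hC f).trans_lt (ENNReal.mul_lt_top ENNReal.ofReal_lt_top hf.2)⟩
    refine ((measurable_pow_yc (β / 2)).inv.aestronglyMeasurable.smul hf.1).congr ?_
    filter_upwards [hpow] with z hz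
    simp [smul_smul, inv_mul_cancel₀ hz.ne']

lemma Comparable.tendsto_iff {E : Type*} [NormedAddCommGroup E] [NormedSpace ℝ E]
    {p : Space n → ℝ} {r β : ℝ} (hp : Measurable p) (h : Comparable p (B n r) β)
    {f : ℕ → Space n → E} : Tendsto (fun k => eLpNorm (f k) 2 (wMeasure p (B n r))) atTop (𝓝 0) ↔
      Tendsto (fun k => eLpNorm (fun z => |yc z| ^ (β / 2) • f k z) 2 (volume.restrict (B n r)))
        atTop (𝓝 0) := by
  have aux : ∀ {g h : ℕ → ℝ≥0∞} (C : ℝ), Tendsto g atTop (𝓝 0) →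
      (∀ k, h k ≤ ENNReal.ofReal C * g k) → Tendsto h atTop (𝓝 0) := by
    intro g h C hg hh
    refine tendsto_of_tendsto_of_tendsto_of_le_of_le tendsto_const_nhds ?_ (fun _ => zero_le) hh
    simpa using ENNReal.Tendsto.const_mul hg (Or.inr ENNReal.ofReal_ne_top)
  obtain ⟨C, -, hC⟩ := h.exists_le_eLpNorm (E := E) hp
  obtain ⟨C', -, hC'⟩ := h.exists_eLpNorm_le (E := E) hp
  exact ⟨fun h => aux C h fun k => hC _, fun h => aux C' h fun k => hC' _⟩

/-! ### Gradients -/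

lemma norm_gradient {f : Space n → ℝ} (z : Space n) : ‖gradient f z‖ = ‖fderiv ℝ f z‖ := by
  simp [gradient]

lemma gradient_mul {f g : Space n → ℝ} {z : Space n} (hf : DifferentiableAt ℝ f z)
    (hg : DifferentiableAt ℝ g z) :
    gradient (fun z => f z * g z) z = f z • gradient g z + g z • gradient f z := by
  simp only [gradient, fderiv_fun_mul hf hg, map_add, map_smul]

lemma gradient_comp {h : ℝ → ℝ} {f : Space n → ℝ} {z : Space n}
    (hh : DifferentiableAt ℝ h (f z)) (hf : DifferentiableAt ℝ f z) :
    gradient (fun z => h (f z)) z = deriv h (f z) • gradient f z := by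
  have := (hh.hasDerivAt.comp_hasFDerivAt z hf.hasFDerivAt).fderiv
  simp only [gradient]
  rw [show (fun z => h (f z)) = h ∘ f from rfl, this, map_smul]

lemma gradient_yc (z : Space n) : gradient (yc : Space n → ℝ) z = ey n := by
  have h : fderiv ℝ (yc : Space n → ℝ) z = ycL n := (ycL n).fderiv
  rw [gradient, h]
  apply (InnerProductSpace.toDual ℝ (Space n)).injective
  rw [LinearIsometryEquiv.apply_symm_apply]
  ext w
  rw [InnerProductSpace.toDual_apply_apply, real_inner_comm, inner_ey, ycL_apply]

lemma continuous_gradient {f : Space n → ℝ} (hf : ContDiff ℝ ∞ f) : Continuous (gradient f) :=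
  (LinearIsometryEquiv.continuous _).comp (hf.continuous_fderiv (by simp))

lemma continuousOn_gradient {f : Space n → ℝ} {Ω : Set (Space n)} (hΩ : IsOpen Ω)
    (hf : ContDiffOn ℝ ∞ f Ω) : ContinuousOn (gradient f) Ω :=
  (LinearIsometryEquiv.continuous _).comp_continuousOn
    (hf.continuousOn_fderiv_of_isOpen hΩ (by simp))

lemma tsupport_gradient_subset (f : Space n → ℝ) : tsupport (gradient f) ⊆ tsupport f := by
  refine closure_minimal (fun z hz => ?_) (isClosed_tsupport f)
  by_contra h
  apply hz
  have : f =ᶠ[𝓝 z] fun _ => 0 := notMem_tsupport_iff_eventuallyEq.1 h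
  rw [this.gradient_eq, gradient_fun_const]

lemma gradient_eq_zero_of_notMem {f : Space n → ℝ} {z : Space n} (h : z ∉ tsupport f) :
    gradient f z = 0 :=
  image_eq_zero_of_notMem_tsupport (fun h' => h (tsupport_gradient_subset f h'))

lemma yc_gradient {f : Space n → ℝ} (z : Space n) : yc (gradient f z) = fderiv ℝ f z (ey n) := by
  rw [← inner_ey, inner_gradient_left]

/-! ### Test functions -/

lemma IsTest.mono {Ω Ω' : Set (Space n)} {φ : Space n → ℝ} (h : IsTest Ω φ) (hs : Ω ⊆ Ω') :
    IsTest Ω' φ := ⟨h.1, h.2.1, h.2.2.trans hs⟩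

lemma contDiff_mul_of_tsupport_subset {Ω : Set (Space n)} (hΩ : IsOpen Ω) {φ f : Space n → ℝ}
    (hφ : ContDiff ℝ ∞ φ) (hs : tsupport φ ⊆ Ω) (hf : ContDiffOn ℝ ∞ f Ω) :
    ContDiff ℝ ∞ (fun z => φ z * f z) := by
  rw [contDiff_iff_contDiffAt]
  intro z
  by_cases hz : z ∈ tsupport φ
  · exact hφ.contDiffAt.mul (hf.contDiffAt (hΩ.mem_nhds (hs hz)))
  · refine (contDiffAt_const (c := (0 : ℝ))).congr_of_eventuallyEq ?_
    filter_upwards [notMem_tsupport_iff_eventuallyEq.1 hz] with w hw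
    simp [hw]

lemma IsTest.mul_contDiffOn {Ω : Set (Space n)} (hΩ : IsOpen Ω) {φ f : Space n → ℝ}
    (hφ : IsTest Ω φ) (hf : ContDiffOn ℝ ∞ f Ω) : IsTest Ω (fun z => φ z * f z) := by
  refine ⟨contDiff_mul_of_tsupport_subset hΩ hφ.1 hφ.2.2 hf, hφ.2.1.mul_right, ?_⟩
  exact (tsupport_mul_subset_left).trans hφ.2.2

lemma ContDiff.smoothUpTo {Ω : Set (Space n)} {φ : Space n → ℝ} (h : ContDiff ℝ ∞ φ) :
    SmoothUpTo Ω φ :=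
  ⟨h.contDiffOn, fun k => ⟨iteratedFDeriv ℝ k φ,
    (h.continuous_iteratedFDeriv (by exact_mod_cast le_top)).continuousOn, fun _ _ => rfl⟩⟩

lemma IsTest.exists_bound {Ω : Set (Space n)} {φ : Space n → ℝ} (h : IsTest Ω φ) :
    ∃ C : ℝ, 0 < C ∧ ∀ z, |φ z| ≤ C ∧ ‖gradient φ z‖ ≤ C := by
  obtain ⟨C, hC⟩ := h.2.1.exists_bound_of_continuous h.1.continuous
  have hs : HasCompactSupport (gradient φ) :=
    h.2.1.mono' ((subset_tsupport _).trans (tsupport_gradient_subset φ))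
  obtain ⟨C', hC'⟩ := hs.exists_bound_of_continuous (continuous_gradient h.1)
  exact ⟨max 1 (max C C'), by positivity, fun z => ⟨(hC z).trans (by simp), (hC' z).trans (by simp)⟩⟩

/-! ### Mollification -/

/-- The Riesz isomorphism as a linear equivalence over `ℝ`. -/
noncomputable def dualEquiv (n : ℕ) : (Space n →L[ℝ] ℝ) ≃L[ℝ] Space n where
  toFun := (InnerProductSpace.toDual ℝ (Space n)).symm
  invFun := InnerProductSpace.toDual ℝ (Space n)
  map_add' := map_add _
  map_smul' c f := by simp
  left_inv := (InnerProductSpace.toDual ℝ (Space n)).apply_symm_apply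
  right_inv := (InnerProductSpace.toDual ℝ (Space n)).symm_apply_apply
  continuous_toFun := (InnerProductSpace.toDual ℝ (Space n)).symm.continuous
  continuous_invFun := (InnerProductSpace.toDual ℝ (Space n)).continuous

lemma dualEquiv_apply (f : Space n →L[ℝ] ℝ) :
    dualEquiv n f = (InnerProductSpace.toDual ℝ (Space n)).symm f := rfl

/-- Continuity of translations in L², read off from the continuity of composition with a
continuously varying family of measure preserving maps. -/
lemma tendsto_eLpNorm_translate {E : Type*} [NormedAddCommGroup E] {D : Space n → E}
    (hD : MemLp D 2 volume) :
    Tendsto (fun t : Space n => eLpNorm (fun z => D (z - t) - D z) 2 volume) (𝓝 0) (𝓝 0) := by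
  have : Fact ((1 : ℝ≥0∞) ≤ 2) := ⟨by norm_num⟩
  let F : C(Space n × Space n, Space n) := ⟨fun p => p.2 - p.1, by fun_prop⟩
  have hmp : ∀ t : Space n, MeasurePreserving (F.curry t) volume volume :=
    fun t => measurePreserving_sub_right volume t
  have hc := Filter.Tendsto.compMeasurePreservingLp (p := 2) (f := fun _ : Space n => hD.toLp D)
    (g := fun t => F.curry t) (tendsto_const_nhds (x := hD.toLp D) (f := 𝓝 (0 : Space n)))
    (F.curry.continuous.tendsto 0) hmp (hmp 0) (by norm_num)
  have h0 : Lp.compMeasurePreserving (F.curry 0) (hmp 0) (hD.toLp D) = hD.toLp D := by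
    rw [Lp.toLp_compMeasurePreserving hD (hmp 0)]
    congr 1
    ext z; simp [F]
  rw [h0, tendsto_iff_edist_tendsto_0] at hc
  refine hc.congr fun t => ?_
  rw [Lp.toLp_compMeasurePreserving hD (hmp t), Lp.edist_toLp_toLp]
  rfl

/-- Cauchy–Schwarz for the measure f dμ, from f g = f^(1/2) · (f^(1/2) g). It serves with f a
mollifier and with f a power of the dilation parameter in Hardy's inequality. -/
lemma sq_lintegral_mul_le {α : Type*} [MeasurableSpace α] {μ : Measure α} {f g : α → ℝ≥0∞}
    (hf : AEMeasurable f μ) (hg : AEMeasurable g μ) :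
    (∫⁻ x, f x * g x ∂μ) ^ 2 ≤ (∫⁻ x, f x ∂μ) * ∫⁻ x, f x * g x ^ 2 ∂μ := by
  have h := ENNReal.lintegral_mul_le_Lp_mul_Lq μ (Real.HolderConjugate.two_two)
    (hf.pow_const (1 / 2 : ℝ)) ((hf.pow_const (1 / 2 : ℝ)).mul hg)
  have e1 : ∀ x, f x ^ (1 / 2 : ℝ) * (f x ^ (1 / 2 : ℝ) * g x) = f x * g x := fun x => by
    rw [← mul_assoc, ← ENNReal.rpow_add_of_nonneg _ _ (by norm_num) (by norm_num)]
    norm_num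
  have e2 : ∀ x, (f x ^ (1 / 2 : ℝ)) ^ (2 : ℝ) = f x := fun x => by
    rw [← ENNReal.rpow_mul]; norm_num
  have e3 : ∀ x, (f x ^ (1 / 2 : ℝ) * g x) ^ (2 : ℝ) = f x * g x ^ 2 := fun x => by
    rw [ENNReal.mul_rpow_of_nonneg _ _ (by norm_num), e2]; norm_num
  simp only [Pi.mul_apply, e1, e2, e3] at h
  calc (∫⁻ x, f x * g x ∂μ) ^ 2
      ≤ ((∫⁻ x, f x ∂μ) ^ (1 / 2 : ℝ) * (∫⁻ x, f x * g x ^ 2 ∂μ) ^ (1 / 2 : ℝ)) ^ 2 := by gcongr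
    _ = _ := by
      rw [mul_pow, ← ENNReal.rpow_natCast, ← ENNReal.rpow_natCast, ← ENNReal.rpow_mul,
        ← ENNReal.rpow_mul]
      norm_num

/-- The mollification of an `L²` function converges to it in `L²`. -/
lemma tendsto_eLpNorm_convolution_sub {D : Space n → Space n} (hD : MemLp D 2 volume)
    {φ : ℕ → ContDiffBump (0 : Space n)} (hφ : Tendsto (fun m => (φ m).rOut) atTop (𝓝 0)) :
    Tendsto (fun m => eLpNorm (fun z => (∫ t, (φ m).normed volume t • D (z - t)) - D z) 2 volume)
      atTop (𝓝 0) := by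
  have hloc : LocallyIntegrable D volume := hD.locallyIntegrable (by norm_num)
  -- The mollification error at z is an average of translation errors. Cauchy–Schwarz against the
  -- probability density ψ and Tonelli bound its L² norm by the largest translation error over the
  -- support of ψ.
  have key : ∀ m (δ : ℝ≥0∞), (∀ t ∈ Metric.ball (0 : Space n) (φ m).rOut,
      eLpNorm (fun z => D (z - t) - D z) 2 volume ≤ δ) →
      eLpNorm (fun z => (∫ t, (φ m).normed volume t • D (z - t)) - D z) 2 volume ≤ δ := by
    intro m δ hδ
    set ψ := (φ m).normed volume with hψ
    have hψ0 : ∀ t, 0 ≤ ψ t := (φ m).nonneg_normed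
    have hψc : Continuous ψ := (φ m).continuous_normed
    have hψi : Integrable ψ volume := (φ m).integrable_normed
    have hψ1 : ∫⁻ t, ‖ψ t‖ₑ = 1 := by
      have := (φ m).integral_normed (μ := volume)
      rw [← ofReal_integral_norm_eq_lintegral_enorm hψi]
      simp_rw [Real.norm_of_nonneg (hψ0 _)]
      rw [this]; simp
    refine (ENNReal.pow_right_strictMono two_ne_zero).le_iff_le.1 ?_
    have hjointm : AEStronglyMeasurable (fun p : Space n × Space n => D (p.1 - p.2) - D p.1)
        (volume.prod volume) := by
      refine AEStronglyMeasurable.sub ?_ ?_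
      · exact hD.1.comp_quasiMeasurePreserving (quasiMeasurePreserving_sub volume volume)
      · exact hD.1.comp_fst
    have hjoint := hjointm.enorm
    have hpt : ∀ᵐ z, ‖(∫ t, ψ t • D (z - t)) - D z‖ₑ ^ 2 ≤
        ∫⁻ t, ‖ψ t‖ₑ * ‖D (z - t) - D z‖ₑ ^ 2 := by
      filter_upwards [hjointm.prodMk_left] with z hz
      have hi : Integrable (fun t => ψ t • D (z - t)) volume :=
        ((φ m).hasCompactSupport_normed.convolutionExists_left (ContinuousLinearMap.lsmul ℝ ℝ)
          hψc hloc z)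
      have e : (∫ t, ψ t • D (z - t)) - D z = ∫ t, ψ t • (D (z - t) - D z) := by
        simp_rw [smul_sub]
        rw [integral_sub hi (hψi.smul_const _), integral_smul_const, (φ m).integral_normed, one_smul]
      rw [e]
      calc ‖∫ t, ψ t • (D (z - t) - D z)‖ₑ ^ 2
          ≤ (∫⁻ t, ‖ψ t‖ₑ * ‖D (z - t) - D z‖ₑ) ^ 2 := by
            gcongr
            refine (enorm_integral_le_lintegral_enorm _).trans (le_of_eq ?_)
            exact lintegral_congr fun t => enorm_smul _ _
        _ ≤ (∫⁻ t, ‖ψ t‖ₑ) * ∫⁻ t, ‖ψ t‖ₑ * ‖D (z - t) - D z‖ₑ ^ 2 :=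
            sq_lintegral_mul_le hψc.enorm.aemeasurable hz.enorm
        _ = _ := by rw [hψ1, one_mul]
    rw [eLpNorm_two_sq]
    calc ∫⁻ z, ‖(∫ t, ψ t • D (z - t)) - D z‖ₑ ^ 2
        ≤ ∫⁻ z, ∫⁻ t, ‖ψ t‖ₑ * ‖D (z - t) - D z‖ₑ ^ 2 := lintegral_mono_ae hpt
      _ = ∫⁻ t, ∫⁻ z, ‖ψ t‖ₑ * ‖D (z - t) - D z‖ₑ ^ 2 := by
          rw [lintegral_lintegral_swap]
          exact ((hψc.comp continuous_snd).enorm.aemeasurable).mul (hjoint.pow_const _)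
      _ ≤ ∫⁻ t, ‖ψ t‖ₑ * δ ^ 2 := by
          refine lintegral_mono fun t => ?_
          rw [lintegral_const_mul' _ _ enorm_ne_top, ← eLpNorm_two_sq]
          by_cases ht : t ∈ Metric.ball (0 : Space n) (φ m).rOut
          · gcongr; exact hδ t ht
          · have : ψ t = 0 := by
              rw [← Function.notMem_support, hψ, (φ m).support_normed_eq]; exact ht
            simp [this]
      _ = δ ^ 2 := by
          rw [lintegral_mul_const _ hψc.enorm.measurable, hψ1, one_mul]
  rw [ENNReal.tendsto_nhds_zero]
  intro δ hδ
  have h1 := ENNReal.tendsto_nhds_zero.1 (tendsto_eLpNorm_translate hD) δ hδ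
  obtain ⟨r, hr, hball⟩ := Metric.eventually_nhds_iff_ball.1 h1
  filter_upwards [hφ.eventually (gt_mem_nhds hr)] with m hm
  exact key m δ fun t ht => hball t (Metric.ball_subset_ball hm.le ht)

/-- A continuous function with weak gradient in `L²_loc` is approximated on a compact set,
uniformly and with the gradients in `L²`, by smooth functions. -/
lemma exists_smooth_approx {O : Set (Space n)} (hO : IsOpen O) {v : Space n → ℝ}
    {Dv : Space n → Space n} (hv : ContinuousOn v O)
    (hw : ∀ φ : Space n → ℝ, IsTest O φ → ∫ z in O, v z • gradient φ z = -∫ z in O, φ z • Dv z)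
    (hD : ∀ K ⊆ O, IsCompact K → MemLp Dv 2 (volume.restrict K))
    {K : Set (Space n)} (hK : IsCompact K) (hKO : K ⊆ O) :
    ∃ V : ℕ → Space n → ℝ, (∀ m, ContDiff ℝ ∞ (V m)) ∧ TendstoUniformlyOn V v atTop K ∧
      Tendsto (fun m => eLpNorm (fun z => gradient (V m) z - Dv z) 2 (volume.restrict K))
        atTop (𝓝 0) := by
  obtain ⟨δ, hδ, hδO⟩ := hK.exists_cthickening_subset_open hO hKO
  set K' := Metric.cthickening δ K with hK'
  have hK'c : IsCompact K' := hK.cthickening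
  have hK'm : MeasurableSet K' := hK'c.isClosed.measurableSet
  -- Truncation to a compact neighbourhood of K makes v integrable and Dv globally square
  -- integrable. Mollification at radius at most δ does not notice it at points of K.
  set v1 := K'.indicator v with hv1
  set D1 := K'.indicator Dv with hD1
  have hv1i : Integrable v1 volume :=
    ((hv.mono hδO).integrableOn_compact hK'c).integrable_indicator hK'm
  have hD1m : MemLp D1 2 volume := (memLp_indicator_iff_restrict hK'm).2 (hD K' hδO hK'c)
  let φ : ℕ → ContDiffBump (0 : Space n) := fun m =>
    ⟨δ / (m + 1) / 2, δ / (m + 1), by positivity, half_lt_self (by positivity)⟩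
  have hr : Tendsto (fun m => (φ m).rOut) atTop (𝓝 0) := by
    simpa [φ, Function.comp_def] using
      (tendsto_const_div_atTop_nhds_zero_nat δ).comp (tendsto_add_atTop_nat 1)
  have hrδ : ∀ m, (φ m).rOut ≤ δ := fun m => div_le_self hδ.le (by simp)
  have hballK : ∀ m, ∀ z ∈ K, Metric.closedBall z (φ m).rOut ⊆ K' := fun m z hz =>
    (Metric.closedBall_subset_cthickening hz _).trans (Metric.cthickening_mono (hrδ m) K)
  let V : ℕ → Space n → ℝ := fun m =>
    convolution ((φ m).normed volume) v1 (ContinuousLinearMap.lsmul ℝ ℝ) volume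
  -- The derivative is put on the kernel. For z in K the function s ↦ ψ(z - s) is supported in K',
  -- hence an admissible test function; the sign from differentiating z - s cancels the sign in the
  -- definition of the weak gradient.
  have hgrad : ∀ m, ∀ z ∈ K, gradient (V m) z = ∫ t, (φ m).normed volume t • D1 (z - t) := by
    intro m z hz
    set ψ := (φ m).normed volume with hψ
    have hψs : ContDiff ℝ ∞ ψ := (φ m).contDiff_normed
    have hψc : HasCompactSupport ψ := (φ m).hasCompactSupport_normed
    have h1 := (hψc.hasFDerivAt_convolution_left (ContinuousLinearMap.lsmul ℝ ℝ)
      (hψs.of_le (by simp)) hv1i.locallyIntegrable z).fderiv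
    have h2 : gradient (V m) z = ∫ s, v1 s • gradient ψ (z - s) := by
      rw [gradient, h1, convolution_def, ← integral_sub_left_eq_self _ volume z,
        ← dualEquiv_apply, ← ContinuousLinearEquiv.integral_comp_comm]
      refine integral_congr_ae (ae_of_all _ fun s => ?_)
      simp only [sub_sub_cancel, gradient]
      rw [← dualEquiv_apply, ← map_smul]
      congr 1
      ext w
      simp [ContinuousLinearMap.precompL_apply, mul_comm]
    let χ : Space n → ℝ := fun s => ψ (z - s)
    have hχs : ContDiff ℝ ∞ χ := hψs.comp (contDiff_const.sub contDiff_id)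
    have hχsupp : tsupport χ ⊆ K' := by
      refine Subset.trans (closure_minimal (fun s hs => ?_) Metric.isClosed_closedBall) (hballK m z hz)
      have hs' : z - s ∈ Function.support ψ := hs
      rw [hψ, (φ m).support_normed_eq] at hs'
      have : ‖z - s‖ < (φ m).rOut := by simpa using hs'
      rw [Metric.mem_closedBall, dist_comm, dist_eq_norm]
      exact this.le
    have hχt : IsTest O χ :=
      ⟨hχs, HasCompactSupport.of_support_subset_isCompact hK'c ((subset_tsupport _).trans hχsupp),
        hχsupp.trans hδO⟩
    have hχg : ∀ s, gradient χ s = -gradient ψ (z - s) := by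
      intro s
      have h4 : HasFDerivAt χ (-fderiv ℝ ψ (z - s)) s := by
        have h5 := ((hψs.differentiable (by simp)).differentiableAt (x := z - s)).hasFDerivAt.comp s
          ((hasFDerivAt_id s).const_sub z)
        have h6 : -fderiv ℝ ψ (z - s) =
            (fderiv ℝ ψ (z - s)).comp (-ContinuousLinearMap.id ℝ (Space n)) := by ext w; simp
        rw [h6]
        exact h5
      simp only [gradient, h4.fderiv, map_neg]
    have h3 := hw χ hχt
    have e1 : ∫ s in O, v s • gradient χ s = -∫ s, v1 s • gradient ψ (z - s) := by
      rw [← integral_neg, ← integral_indicator hO.measurableSet]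
      refine integral_congr_ae (ae_of_all _ fun s => ?_)
      by_cases hs : s ∈ K'
      · simp [indicator_of_mem (hδO hs), hv1, indicator_of_mem hs, hχg]
      · have h0 : gradient χ s = 0 := gradient_eq_zero_of_notMem fun h => hs (hχsupp h)
        simp only [hv1, indicator_of_notMem hs, zero_smul, neg_zero]
        by_cases hsO : s ∈ O <;> simp [hsO, h0]
    have e2 : ∫ s in O, χ s • Dv s = ∫ t, ψ t • D1 (z - t) := by
      rw [← integral_sub_left_eq_self (fun t => ψ t • D1 (z - t)) volume z,
        ← integral_indicator hO.measurableSet]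
      refine integral_congr_ae (ae_of_all _ fun s => ?_)
      simp only [sub_sub_cancel]
      by_cases hs : s ∈ K'
      · simp [indicator_of_mem (hδO hs), hD1, indicator_of_mem hs, χ]
      · have h0 : χ s = 0 := image_eq_zero_of_notMem_tsupport fun h => hs (hχsupp h)
        simp only [hD1, indicator_of_notMem hs, smul_zero]
        by_cases hsO : s ∈ O <;> simp [hsO, h0]
    rw [h2, ← e2]
    rw [e1] at h3
    exact neg_injective h3
  refine ⟨V, fun m => ?_, ?_, ?_⟩
  · exact (φ m).hasCompactSupport_normed.contDiff_convolution_left _ (φ m).contDiff_normed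
      hv1i.locallyIntegrable
  · rw [Metric.tendstoUniformlyOn_iff]
    intro ε hε
    have huc := hK'c.uniformContinuousOn_of_continuous (hv.mono hδO)
    rw [Metric.uniformContinuousOn_iff] at huc
    obtain ⟨η, hη, huc⟩ := huc (ε / 2) (half_pos hε)
    filter_upwards [hr.eventually (gt_mem_nhds hη)] with m hm z hz
    rw [dist_comm]
    have hzK : z ∈ K' := hballK m z hz (Metric.mem_closedBall_self (φ m).rOut_pos.le)
    have hvz : v z = v1 z := by rw [hv1, indicator_of_mem hzK]
    rw [hvz]
    refine lt_of_le_of_lt ((φ m).dist_normed_convolution_le hv1i.aestronglyMeasurable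
      (ε := ε / 2) fun x hx => ?_) (half_lt_self hε)
    have hxK : x ∈ K' := hballK m z hz (Metric.ball_subset_closedBall hx)
    rw [hv1, indicator_of_mem hzK, indicator_of_mem hxK]
    exact (huc x hxK z hzK ((Metric.mem_ball.1 hx).trans hm)).le
  · have h := tendsto_eLpNorm_convolution_sub hD1m hr
    refine tendsto_of_tendsto_of_tendsto_of_le_of_le tendsto_const_nhds h (fun _ => zero_le)
      fun m => ?_
    refine le_trans (le_of_eq ?_) (eLpNorm_mono_measure _ (Measure.restrict_le_self (s := K)))
    refine eLpNorm_congr_ae ?_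
    filter_upwards [ae_restrict_mem hK.isClosed.measurableSet] with z hz
    have hzK : z ∈ K' := hballK m z hz (Metric.mem_closedBall_self (φ m).rOut_pos.le)
    rw [hgrad m z hz, hD1, indicator_of_mem hzK]

/-! ### Hardy's inequality -/

/-- The dilation `(x, y) ↦ (x, θ y)`. -/
def dilate (θ : ℝ) (z : Space n) : Space n := withY z (θ * yc z)

lemma dilate_eq (θ : ℝ) (z : Space n) : dilate θ z = z + (θ - 1) • yc z • ey n := by
  rw [dilate, withY_eq, smul_smul]; ring_nf

lemma dilate_neg_one (z : Space n) : dilate (-1) z = reflect z := by simp [dilate, reflect]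

lemma dilate_one (z : Space n) : dilate 1 z = z := by simp [dilate, withY_self]

lemma yc_dilate (θ : ℝ) (z : Space n) : yc (dilate θ z) = θ * yc z := yc_withY _ _

lemma dilate_mem {r θ : ℝ} (hθ : |θ| ≤ 1) {z : Space n} (hz : z ∈ B n r) : dilate θ z ∈ B n r := by
  refine withY_mem hz ?_
  rw [abs_mul]
  exact mul_le_of_le_one_left (abs_nonneg _) hθ

lemma continuous_dilate : Continuous (fun p : ℝ × Space n => dilate p.1 p.2) :=
  continuous_withY.comp
    (continuous_snd.prodMk (continuous_fst.mul (continuous_yc.comp continuous_snd)))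

/-- The dilation is the transvection z + (θ - 1) y e_y, whose determinant is 1 + (θ - 1) = θ. -/
lemma map_dilate {θ : ℝ} (hθ : θ ≠ 0) :
    Measure.map (dilate θ) (volume : Measure (Space n)) = ENNReal.ofReal |θ|⁻¹ • volume := by
  let L : Space n →ₗ[ℝ] Space n :=
    LinearMap.transvection (ycL n).toLinearMap ((θ - 1) • ey n)
  have hL : (L : Space n → Space n) = dilate θ := by
    ext1 z
    rw [dilate_eq]
    simp [L, LinearMap.transvection.apply, ycL_apply, smul_smul, mul_comm]
  have hdet : LinearMap.det L = θ := by
    simp only [L]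
    rw [LinearMap.transvection.det]
    simp [ycL_apply, yc_ey]
  rw [← hL, Measure.map_linearMap_addHaar_eq_smul_addHaar volume (by rwa [hdet]), hdet, abs_inv]

lemma lintegral_comp_dilate {θ : ℝ} (hθ : θ ≠ 0) {h : Space n → ℝ≥0∞} (hh : Measurable h) :
    ∫⁻ z, h (dilate θ z) = ENNReal.ofReal |θ|⁻¹ * ∫⁻ z, h z := by
  have hm : Measurable (dilate θ : Space n → Space n) :=
    (continuous_dilate.comp (Continuous.prodMk_right θ)).measurable
  rw [← lintegral_map hh hm, map_dilate hθ, lintegral_smul_measure, smul_eq_mul]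

lemma measurePreserving_reflect : MeasurePreserving (reflect : Space n → Space n) := by
  have h : (reflect : Space n → Space n) = dilate (-1) := by ext1 z; rw [dilate_neg_one]
  refine ⟨?_, ?_⟩
  · rw [h]; exact (continuous_dilate.comp (Continuous.prodMk_right _)).measurable
  · rw [h, map_dilate (by norm_num)]; simp

lemma measurePreserving_reflect_restrict (r : ℝ) :
    MeasurePreserving (reflect : Space n → Space n) (volume.restrict (B n r))
      (volume.restrict (B n r)) := by
  have h := measurePreserving_reflect (n := n) |>.restrict_preimage
    (s := B n r) Metric.isOpen_ball.measurableSet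
  have e : (reflect : Space n → Space n) ⁻¹' (B n r) = B n r := by
    ext z; exact reflect_mem_iff
  rwa [e] at h

lemma measurable_gradient (ψ : Space n → ℝ) : Measurable (gradient ψ) :=
  (LinearIsometryEquiv.continuous _).measurable.comp (measurable_fderiv ℝ ψ)

lemma lintegral_rpow_abs_lt_top {γ : ℝ} (hγ : -1 < γ) :
    ∫⁻ θ in Ioc (-1 : ℝ) 1, ENNReal.ofReal (|θ| ^ γ) < (⊤ : ℝ≥0∞) := by
  have h0 : IntegrableOn (fun θ : ℝ => |θ| ^ γ) (Ioc 0 1) := by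
    have h := (intervalIntegral.intervalIntegrable_rpow' (a := 0) (b := 1) hγ).1
    refine h.congr_fun (fun θ hθ => ?_) measurableSet_Ioc
    simp [abs_of_pos hθ.1]
  have h1 : IntegrableOn (fun θ : ℝ => |θ| ^ γ) (Ico (-1) 0) := by
    have := (Measure.measurePreserving_neg (volume : Measure ℝ)).integrableOn_comp_preimage
      (MeasurableEquiv.neg ℝ).measurableEmbedding (f := fun θ : ℝ => |θ| ^ γ) (s := Ioc 0 1)
    have h2 := this.2 h0
    simpa [Function.comp_def] using h2
  have h2 : IntegrableOn (fun θ : ℝ => |θ| ^ γ) (Ioc (-1) 1) :=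
    (h1.union ((integrableOn_Icc_iff_integrableOn_Ioc).2 h0)).mono_set (fun θ hθ => by
      rcases lt_or_ge θ 0 with h | h
      · exact Or.inl ⟨hθ.1.le, h⟩
      · exact Or.inr ⟨h, hθ.2⟩)
  refine lt_of_eq_of_lt (lintegral_congr fun θ => ?_) h2.2
  rw [Real.enorm_of_nonneg (by positivity)]

/-- Fundamental theorem of calculus along θ ↦ (x, θy), θ from -1 to 1: a segment from the reflected
point to z which stays in the ball, with velocity y e_y. -/
lemma enorm_sub_reflect_le {ψ : Space n → ℝ} (hψ : ContDiffOn ℝ ∞ ψ (B n 1)) {z : Space n}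
    (hz : z ∈ B n 1) : ‖ψ z - ψ (reflect z)‖ₑ ≤
      ENNReal.ofReal |yc z| * ∫⁻ θ in Ioc (-1 : ℝ) 1, ‖gradient ψ (dilate θ z)‖ₑ := by
  have hmem : ∀ θ ∈ Icc (-1 : ℝ) 1, dilate θ z ∈ B n 1 := fun θ hθ => dilate_mem (abs_le.2 hθ) hz
  have hd : ∀ θ ∈ uIcc (-1 : ℝ) 1, HasDerivAt (fun θ => ψ (dilate θ z))
      (yc z * yc (gradient ψ (dilate θ z))) θ := by
    intro θ hθ
    rw [uIcc_of_le (by norm_num)] at hθ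
    have h1 : HasDerivAt (fun θ : ℝ => dilate θ z) (yc z • ey n) θ := by
      simp only [dilate_eq]
      simpa using ((((hasDerivAt_id θ).sub_const 1).smul_const (yc z • ey n)).const_add z)
    have h2 := ((hψ.contDiffAt (Metric.isOpen_ball.mem_nhds (hmem θ hθ))).differentiableAt
      (by simp)).hasFDerivAt.comp_hasDerivAt θ h1
    rwa [map_smul, smul_eq_mul, ← yc_gradient] at h2
  have hcont : ContinuousOn (fun θ : ℝ => gradient ψ (dilate θ z)) (Icc (-1) 1) :=
    (continuousOn_gradient Metric.isOpen_ball hψ).comp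
      (continuous_dilate.comp (Continuous.prodMk_left z)).continuousOn hmem
  have hint : IntervalIntegrable (fun θ => yc z * yc (gradient ψ (dilate θ z))) volume (-1) 1 := by
    refine ContinuousOn.intervalIntegrable ?_
    rw [uIcc_of_le (by norm_num)]
    exact continuousOn_const.mul (continuous_yc.comp_continuousOn hcont)
  have h := intervalIntegral.integral_eq_sub_of_hasDerivAt hd hint
  rw [dilate_one, dilate_neg_one] at h
  rw [← h, intervalIntegral.integral_of_le (by norm_num),
    ← lintegral_const_mul' _ _ ENNReal.ofReal_ne_top]
  refine (enorm_integral_le_lintegral_enorm _).trans (lintegral_mono fun θ => ?_)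
  simp only
  rw [enorm_mul, Real.enorm_eq_ofReal_abs]
  gcongr
  rw [← ofReal_norm, ← ofReal_norm]
  exact ENNReal.ofReal_le_ofReal (abs_yc_le _)

/-- The difference of ψ at z and at its reflection is an average of y∂_yψ over dilations of z.
Cauchy–Schwarz in the dilation parameter and the change of variables z ↦ (x, θy) then bound the
weighted norm. No vanishing of ψ on Σ is needed, since the trace cancels in the difference. -/
lemma hardy {b : ℝ} (hb : b < 1) : ∃ C : ℝ≥0∞, C ≠ ⊤ ∧ ∀ ψ : Space n → ℝ,
    ContDiffOn ℝ ∞ ψ (B n 1) →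
    eLpNorm (fun z => |yc z| ^ (b / 2 - 1) * (ψ z - ψ (reflect z))) 2 (volume.restrict (B n 1)) ≤
      C * eLpNorm (fun z => |yc z| ^ (b / 2) • gradient ψ z) 2 (volume.restrict (B n 1)) := by
  -- This exponent solves -γ + 1/2 + b/2 = 0, the balance between |y|^(b/2) and |θy|^(b/2) once a
  -- factor |θ|^(1/2) is set aside. The kernel |θ|^(-γ) is integrable because γ < 1, that is b < 1.
  set γ := (1 + b) / 2 with hγ
  set I := Ioc (-1 : ℝ) 1 with hI
  let k : ℝ → ℝ≥0∞ := fun θ => ENNReal.ofReal (|θ| ^ (-γ))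
  have hkm : Measurable k := ((measurable_id.abs).pow_const _).ennreal_ofReal
  refine ⟨∫⁻ θ in I, k θ, (lintegral_rpow_abs_lt_top (by rw [hγ]; linarith)).ne, fun ψ hψ => ?_⟩
  set K := ∫⁻ θ in I, k θ with hK
  let H : Space n → ℝ≥0∞ := (B n 1).indicator fun z => ‖|yc z| ^ (b / 2) • gradient ψ z‖ₑ
  have hHm : Measurable H := (((measurable_pow_yc _).smul (measurable_gradient ψ)).enorm).indicator
    Metric.isOpen_ball.measurableSet
  have hHj : Measurable fun p : Space n × ℝ => H (dilate p.2 p.1) :=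
    hHm.comp (continuous_dilate.comp continuous_swap).measurable
  have hHI : ∫⁻ z, H z ^ 2 =
      eLpNorm (fun z => |yc z| ^ (b / 2) • gradient ψ z) 2 (volume.restrict (B n 1)) ^ 2 := by
    rw [eLpNorm_two_sq, ← lintegral_indicator Metric.isOpen_ball.measurableSet]
    refine lintegral_congr fun z => ?_
    by_cases hz : z ∈ B n 1 <;> simp [H, hz]
  have hI0 : ∀ᵐ θ ∂(volume.restrict I), θ ∈ I ∧ θ ≠ 0 :=
    (ae_restrict_mem measurableSet_Ioc).and (ae_restrict_of_ae (by simp [ae_iff, measure_singleton]))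
  have hpt : ∀ᵐ z ∂(volume.restrict (B n 1)),
      ‖|yc z| ^ (b / 2 - 1) * (ψ z - ψ (reflect z))‖ₑ ^ 2 ≤
        K * ∫⁻ θ in I, k θ * (ENNReal.ofReal (|θ| ^ (1 / 2 : ℝ)) * H (dilate θ z)) ^ 2 := by
    filter_upwards [ae_restrict_ball] with z ⟨hz, hy⟩
    have hy' : 0 < |yc z| := abs_pos.2 hy
    have h1 : ‖|yc z| ^ (b / 2 - 1) * (ψ z - ψ (reflect z))‖ₑ ≤
        ∫⁻ θ in I, k θ * (ENNReal.ofReal (|θ| ^ (1 / 2 : ℝ)) * H (dilate θ z)) := by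
      rw [enorm_mul, Real.enorm_of_nonneg (by positivity)]
      refine (mul_le_mul_right (enorm_sub_reflect_le hψ hz) _).trans ?_
      rw [← mul_assoc, ← ENNReal.ofReal_mul (by positivity),
        ← lintegral_const_mul' _ _ ENNReal.ofReal_ne_top]
      refine lintegral_mono_ae ?_
      filter_upwards [hI0] with θ ⟨hθ, hθ0⟩
      have hθ' : 0 < |θ| := abs_pos.2 hθ0
      have hm : dilate θ z ∈ B n 1 := dilate_mem (abs_le.2 ⟨hθ.1.le, hθ.2⟩) hz
      simp only [H, indicator_of_mem hm, k]
      have e1 : |yc z| ^ (b / 2 - 1) * |yc z| =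
          |θ| ^ (-γ) * |θ| ^ (1 / 2 : ℝ) * |yc (dilate θ z)| ^ (b / 2) := by
        rw [yc_dilate, abs_mul, Real.mul_rpow hθ'.le hy'.le, ← mul_assoc, ← Real.rpow_add hθ',
          ← Real.rpow_add hθ', ← Real.rpow_add_one hy'.ne']
        have e2 : -γ + 1 / 2 + b / 2 = 0 := by rw [hγ]; ring
        rw [e2, Real.rpow_zero, one_mul, sub_add_cancel]
      rw [e1, enorm_smul, Real.enorm_of_nonneg (Real.rpow_nonneg (abs_nonneg _) _),
        ENNReal.ofReal_mul (by positivity), ENNReal.ofReal_mul (by positivity)]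
      exact le_of_eq (by ring)
    calc _ ≤ (∫⁻ θ in I, k θ * (ENNReal.ofReal (|θ| ^ (1 / 2 : ℝ)) * H (dilate θ z))) ^ 2 := by
          gcongr
      _ ≤ _ := by
          have hz1 : Measurable fun θ : ℝ => H (dilate θ z) :=
            hHm.comp (continuous_dilate.comp (Continuous.prodMk_left z)).measurable
          have hz2 : Measurable fun θ : ℝ =>
              ENNReal.ofReal (|θ| ^ (1 / 2 : ℝ)) * H (dilate θ z) :=
            (((measurable_id.abs).pow_const _).ennreal_ofReal).mul hz1
          exact sq_lintegral_mul_le hkm.aemeasurable hz2.aemeasurable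
  refine (ENNReal.pow_right_strictMono two_ne_zero).le_iff_le.1 ?_
  rw [eLpNorm_two_sq, mul_pow, ← hHI]
  calc _ ≤ ∫⁻ z in B n 1, K * ∫⁻ θ in I,
        k θ * (ENNReal.ofReal (|θ| ^ (1 / 2 : ℝ)) * H (dilate θ z)) ^ 2 := lintegral_mono_ae hpt
    _ ≤ ∫⁻ z, K * ∫⁻ θ in I,
        k θ * (ENNReal.ofReal (|θ| ^ (1 / 2 : ℝ)) * H (dilate θ z)) ^ 2 :=
        lintegral_mono' Measure.restrict_le_self le_rfl
    _ = K * ∫⁻ θ in I, ∫⁻ z,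
        k θ * (ENNReal.ofReal (|θ| ^ (1 / 2 : ℝ)) * H (dilate θ z)) ^ 2 := by
        have hjm : Measurable fun p : Space n × ℝ =>
            k p.2 * (ENNReal.ofReal (|p.2| ^ (1 / 2 : ℝ)) * H (dilate p.2 p.1)) ^ 2 :=
          (hkm.comp measurable_snd).mul
            ((((measurable_snd.abs).pow_const _).ennreal_ofReal.mul hHj).pow_const _)
        rw [lintegral_const_mul _ hjm.lintegral_prod_right', lintegral_lintegral_swap]
        exact hjm.aemeasurable
    -- The Jacobian |θ|⁻¹ of the dilation cancels the square of the factor |θ|^(1/2) set aside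
    -- earlier.
    _ = K * ∫⁻ θ in I, k θ * ∫⁻ z, H z ^ 2 := by
        congr 1
        refine lintegral_congr_ae ?_
        filter_upwards [hI0] with θ ⟨hθ, hθ0⟩
        have hθ' : 0 < |θ| := abs_pos.2 hθ0
        rw [lintegral_const_mul' _ _ ENNReal.ofReal_ne_top]
        congr 1
        simp_rw [mul_pow]
        rw [lintegral_const_mul' _ _ (by finiteness),
          lintegral_comp_dilate hθ0 (h := fun z => H z ^ 2) (hHm.pow_const 2), ← mul_assoc,
          ← ENNReal.ofReal_pow (by positivity), ← Real.rpow_natCast, ← Real.rpow_mul hθ'.le]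
        norm_num
        rw [← ENNReal.ofReal_mul hθ'.le, mul_inv_cancel₀ hθ'.ne']
        simp
    _ = _ := by
        rw [lintegral_mul_const _ hkm, sq, mul_assoc]

/-- A function which is odd in `y` and is a limit of smooth functions in the weighted `H¹` norm
satisfies Hardy's inequality. -/
lemma memLp_div_yc_of_odd {b : ℝ} (hb : b < 1) {u : Space n → ℝ} {g : Space n → Space n}
    {ψ : ℕ → Space n → ℝ} (hψ : ∀ k, ContDiffOn ℝ ∞ (ψ k) (B n 1))
    (hum : MemLp (fun z => |yc z| ^ (b / 2) • u z) 2 (volume.restrict (B n 1)))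
    (hgm : MemLp (fun z => |yc z| ^ (b / 2) • g z) 2 (volume.restrict (B n 1)))
    (hu : Tendsto (fun k => eLpNorm (fun z => |yc z| ^ (b / 2) • (ψ k z - u z)) 2
      (volume.restrict (B n 1))) atTop (𝓝 0))
    (hg : Tendsto (fun k => eLpNorm (fun z => |yc z| ^ (b / 2) • (gradient (ψ k) z - g z)) 2
      (volume.restrict (B n 1))) atTop (𝓝 0))
    (hodd : OddInY (B n 1) u) :
    MemLp (fun z => |yc z| ^ (b / 2 - 1) * u z) 2 (volume.restrict (B n 1)) := by
  set m := (volume : Measure (Space n)).restrict (B n 1) with hm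
  have hψm : ∀ k, AEStronglyMeasurable (ψ k) m := fun k =>
    (hψ k).continuousOn.aestronglyMeasurable Metric.isOpen_ball.measurableSet
  have hsm : AEStronglyMeasurable (fun z : Space n => |yc z| ^ (b / 2)) m :=
    (measurable_pow_yc _).aestronglyMeasurable
  have hmeas : TendstoInMeasure m (fun k z => |yc z| ^ (b / 2) • ψ k z) atTop
      (fun z => |yc z| ^ (b / 2) • u z) := by
    refine tendstoInMeasure_of_tendsto_eLpNorm (p := 2) (by norm_num)
      (fun k => hsm.smul (hψm k)) hum.1 (hu.congr fun k => ?_)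
    refine eLpNorm_congr_ae (ae_of_all _ fun z => ?_)
    simp [mul_sub]
  obtain ⟨ns, hmono, hns⟩ := hmeas.exists_seq_tendsto_ae
  have hlim : ∀ᵐ z ∂m, Tendsto (fun j => ψ (ns j) z) atTop (𝓝 (u z)) := by
    filter_upwards [hns, ae_restrict_ball] with z hz hz'
    have hpos : |yc z| ^ (b / 2) ≠ 0 := (Real.rpow_pos_of_pos (abs_pos.2 hz'.2) _).ne'
    have := hz.const_mul (|yc z| ^ (b / 2))⁻¹
    simpa [← mul_assoc, inv_mul_cancel₀ hpos] using this
  -- The reflection preserves null sets, so the subsequence also converges at almost every reflected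
  -- point. There the limit is -u, and the differences tend to 2u.
  have hlim' := (measurePreserving_reflect_restrict (n := n) 1).quasiMeasurePreserving.ae hlim
  have hum' : AEStronglyMeasurable (fun z => |yc z| ^ (b / 2 - 1) * u z) m := by
    have hu' : AEStronglyMeasurable u m := by
      refine ((measurable_pow_yc (b / 2)).inv.aestronglyMeasurable.smul hum.1).congr ?_
      filter_upwards [ae_restrict_ball] with z hz
      have hpos : |yc z| ^ (b / 2) ≠ 0 := (Real.rpow_pos_of_pos (abs_pos.2 hz.2) _).ne'
      simp [← mul_assoc, inv_mul_cancel₀ hpos]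
    exact (measurable_pow_yc _).aestronglyMeasurable.mul hu'
  refine ⟨hum', ?_⟩
  obtain ⟨C, hC, hardyC⟩ := hardy (n := n) hb
  have hpt : ∀ᵐ z ∂m, Tendsto
      (fun j => |yc z| ^ (b / 2 - 1) * (ψ (ns j) z - ψ (ns j) (reflect z))) atTop
      (𝓝 (|yc z| ^ (b / 2 - 1) * (2 * u z))) := by
    filter_upwards [hlim, hlim', hodd] with z h1 h2 h3
    rw [h3] at h2
    have := (h1.sub h2).const_mul (|yc z| ^ (b / 2 - 1))
    rwa [show u z - -u z = 2 * u z by ring] at this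
  -- Fatou's lemma: the Hardy bounds along the subsequence, uniform because the weighted gradients
  -- converge, pass to the limit 2u.
  have hfat := Lp.eLpNorm_lim_le_liminf_eLpNorm (p := 2) (μ := m) (fun j =>
    (measurable_pow_yc (b / 2 - 1)).aestronglyMeasurable.mul ((hψm (ns j)).sub
      ((hψm (ns j)).comp_quasiMeasurePreserving
        (measurePreserving_reflect_restrict 1).quasiMeasurePreserving))) _ hpt
  set M := eLpNorm (fun z => |yc z| ^ (b / 2) • g z) 2 m
  have hbound : ∀ᶠ k in atTop,
      eLpNorm (fun z => |yc z| ^ (b / 2) • gradient (ψ k) z) 2 m ≤ 1 + M := by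
    filter_upwards [ENNReal.tendsto_nhds_zero.1 hg 1 one_pos] with k hk
    have e : (fun z => |yc z| ^ (b / 2) • gradient (ψ k) z) =
        (fun z => |yc z| ^ (b / 2) • (gradient (ψ k) z - g z)) +
          fun z => |yc z| ^ (b / 2) • g z := by
      ext1 z; simp [smul_sub]
    rw [e]
    refine (eLpNorm_add_le ?_ hgm.1 (by norm_num)).trans (by gcongr)
    have : AEStronglyMeasurable (fun z => |yc z| ^ (b / 2) • gradient (ψ k) z) m :=
      hsm.smul (measurable_gradient _).aestronglyMeasurable
    exact (this.sub hgm.1).congr (ae_of_all _ fun z => by simp [smul_sub])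
  have hns_top : ∃ᶠ j in atTop, eLpNorm (fun z => |yc z| ^ (b / 2 - 1) *
      (ψ (ns j) z - ψ (ns j) (reflect z))) 2 m ≤ C * (1 + M) := by
    refine Eventually.frequently ?_
    filter_upwards [hmono.tendsto_atTop.eventually hbound] with j hj
    exact (hardyC _ (hψ _)).trans (by gcongr)
  have hlt : eLpNorm (fun z => |yc z| ^ (b / 2 - 1) * (2 * u z)) 2 m < ⊤ :=
    hfat.trans_lt ((liminf_le_of_frequently_le' hns_top).trans_lt
      (ENNReal.mul_lt_top hC.lt_top (ENNReal.add_lt_top.2 ⟨ENNReal.one_lt_top, hgm.2⟩)))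
  refine lt_of_le_of_lt (eLpNorm_mono fun z => ?_) hlt
  rw [norm_mul, norm_mul, norm_mul]
  gcongr
  have := norm_nonneg (u z)
  rw [Real.norm_two]
  linarith

/-! ### A weighted Sobolev estimate -/

lemma lintegral_rpow_mul_le {μ : Measure (Space n)} {f g h : Space n → ℝ≥0∞}
    (hf : AEMeasurable f μ) (hg : AEMeasurable g μ) (hh : AEMeasurable h μ) {p q r : ℝ}
    (hp : 0 ≤ p) (hq : 0 ≤ q) (hr : 0 ≤ r) (hs : p + q + r = 1) :
    ∫⁻ z, f z ^ p * g z ^ q * h z ^ r ∂μ ≤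
      (∫⁻ z, f z ∂μ) ^ p * (∫⁻ z, g z ∂μ) ^ q * (∫⁻ z, h z ∂μ) ^ r := by
  have := ENNReal.lintegral_prod_norm_pow_le (μ := μ) (Finset.univ : Finset (Fin 3))
    (f := ![f, g, h]) (p := ![p, q, r])
    (by intro i _; fin_cases i <;> simpa) (by simpa [Fin.sum_univ_three] using hs)
    (by intro i _; fin_cases i <;> simpa)
  simpa [Fin.prod_univ_three] using this

lemma contDiffOn_rpow_abs_yc {Ω : Set (Space n)} (β : ℝ) :
    ContDiffOn ℝ ∞ (fun z : Space n => |yc z| ^ β) (Ω \ charSet n) := by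
  intro z hz
  have hy : yc z ≠ 0 := hz.2
  have h1 : ContDiffAt ℝ ∞ (fun z : Space n => |yc z|) z :=
    (contDiffAt_abs hy).comp z contDiff_yc.contDiffAt
  exact (h1.rpow_const_of_ne (abs_ne_zero.2 hy)).contDiffWithinAt

lemma gradient_rpow_abs_yc (β : ℝ) {z : Space n} (hz : yc z ≠ 0) :
    ∃ σ : ℝ, |σ| = 1 ∧ gradient (fun z : Space n => |yc z| ^ β) z =
      (σ * β * |yc z| ^ (β - 1)) • ey n := by
  have h := (hasDerivAt_abs hz).rpow_const (p := β) (Or.inl (abs_ne_zero.2 hz))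
  have hd : DifferentiableAt ℝ (yc : Space n → ℝ) z :=
    (contDiff_yc (m := 1)).differentiable (by simp) z
  refine ⟨(SignType.sign (yc z) : ℝ), ?_, ?_⟩
  · rcases lt_or_gt_of_ne hz with h | h <;> simp [h]
  · rw [gradient_comp (h := fun t => |t| ^ β) h.differentiableAt hd, gradient_yc, h.deriv]

/-- The Dirichlet–Hardy energy `∫ |∇U|² + ∫ U² / y²`. -/
noncomputable def energy (U : Space n → ℝ) : ℝ≥0∞ :=
  (∫⁻ z, ‖gradient U z‖ₑ ^ 2) + ∫⁻ z, ‖U z * (yc z)⁻¹‖ₑ ^ 2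

lemma measurable_mul_inv_yc {U : Space n → ℝ} (hU : Continuous U) :
    Measurable fun z => U z * (yc z)⁻¹ := hU.measurable.mul measurable_yc.inv

/-- The three-factor Hölder inequality behind the weighted Sobolev estimate. -/
lemma lintegral_mul_sq_le_of_factor {U : Space n → ℝ} (hU : Continuous U) {F Γ H : Space n → ℝ≥0∞}
    (hΓ : AEMeasurable Γ (volume.restrict (B n 1))) (hH : Measurable H) {p q r s : ℝ} (hp : 0 ≤ p)
    (hq : 0 ≤ q) (hr : 0 ≤ r) (hs : p + q + r = 1) (hsq : s * q + r = 1) (hs0 : 0 ≤ s)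
    (hpt : ∀ᵐ z ∂(volume.restrict (B n 1)),
      F z = Γ z ^ p * H z ^ q * (‖U z * (yc z)⁻¹‖ₑ ^ 2) ^ r)
    {K : ℝ≥0∞} (hHK : ∫⁻ z, H z ≤ K * energy U ^ s) :
    ∫⁻ z in B n 1, F z ≤ (∫⁻ z in B n 1, Γ z) ^ p * K ^ q * energy U := by
  rw [lintegral_congr_ae hpt]
  refine (lintegral_rpow_mul_le hΓ hH.aemeasurable
    ((measurable_mul_inv_yc hU).enorm.pow_const 2).aemeasurable hp hq hr hs).trans ?_
  rw [mul_assoc, mul_assoc]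
  refine mul_le_mul' le_rfl ?_
  -- The hypothesis on H is homogeneous of degree s in the energy; the condition s q + r = 1 makes
  -- the total power of the energy equal to one.
  calc (∫⁻ z in B n 1, H z) ^ q * (∫⁻ z in B n 1, ‖U z * (yc z)⁻¹‖ₑ ^ 2) ^ r
      ≤ (K * energy U ^ s) ^ q * energy U ^ r := by
        gcongr
        · exact (lintegral_mono' Measure.restrict_le_self le_rfl).trans hHK
        · exact (lintegral_mono' Measure.restrict_le_self le_rfl).trans le_add_self
    _ = K ^ q * energy U := by
        rw [ENNReal.mul_rpow_of_nonneg _ _ hq, mul_assoc, ← ENNReal.rpow_mul,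
          ← ENNReal.rpow_add_of_nonneg _ _ (mul_nonneg hs0 hq) hr, hsq, ENNReal.rpow_one]

lemma finrank_space : Module.finrank ℝ (Space n) = n + 1 := by simp

/-- Sobolev's inequality in dimension at least three. -/
lemma exists_lintegral_rpow_le_energy (hn : 2 ≤ n) : ∃ K : ℝ≥0∞, K ≠ ⊤ ∧ ∀ U : Space n → ℝ,
    ContDiff ℝ ∞ U → HasCompactSupport U →
    ∫⁻ z, ‖U z‖ₑ ^ (2 * (n + 1) / (n - 1) : ℝ) ≤ K * energy U ^ ((n + 1) / (n - 1) : ℝ) := by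
  have hn1 : (0 : ℝ) < n - 1 := by
    have : (2 : ℝ) ≤ n := by exact_mod_cast hn
    linarith
  set p' : NNReal := Real.toNNReal (2 * (n + 1) / (n - 1))
  have hp' : (p' : ℝ) = 2 * (n + 1) / (n - 1) := Real.coe_toNNReal _ (by positivity)
  have hp'0 : 0 < (p' : ℝ) := by rw [hp']; positivity
  rw [← hp']
  set C := eLpNormLESNormFDerivOfEqInnerConst (volume : Measure (Space n)) 2 with hC
  refine ⟨(C : ℝ≥0∞) ^ (p' : ℝ), by finiteness, fun U hU hUc => ?_⟩
  have h := eLpNorm_le_eLpNorm_fderiv_of_eq_inner (volume : Measure (Space n))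
    (hU.of_le (by simp)) hUc (p := 2) (p' := p') (by norm_num) (by rw [finrank_space]; omega)
    (by
      rw [finrank_space, hp']
      push_cast
      field_simp
      ring)
  have h1 : ∫⁻ z, ‖U z‖ₑ ^ (p' : ℝ) = eLpNorm U p' volume ^ (p' : ℝ) := by
    rw [eLpNorm_eq_lintegral_rpow_enorm_toReal (by exact_mod_cast hp'0.ne') (by simp),
      ENNReal.coe_toReal, ← ENNReal.rpow_mul, one_div, inv_mul_cancel₀ hp'0.ne', ENNReal.rpow_one]
  have h2 : eLpNorm (fderiv ℝ U) 2 volume ^ 2 ≤ energy U := by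
    rw [eLpNorm_two_sq]
    refine le_trans (le_of_eq (lintegral_congr fun z => ?_)) le_self_add
    rw [← ofReal_norm, ← ofReal_norm, norm_gradient]
  calc ∫⁻ z, ‖U z‖ₑ ^ (p' : ℝ) ≤ (C * eLpNorm (fderiv ℝ U) 2 volume) ^ (p' : ℝ) := by
        rw [h1]; gcongr; exact h
    _ = C ^ (p' : ℝ) * (eLpNorm (fderiv ℝ U) 2 volume ^ 2) ^ ((n + 1) / (n - 1) : ℝ) := by
        rw [ENNReal.mul_rpow_of_nonneg _ _ hp'0.le, ← ENNReal.rpow_natCast, ← ENNReal.rpow_mul]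
        congr 2
        rw [hp']; push_cast; ring
    _ ≤ _ := by gcongr

/-- A substitute for Sobolev's inequality in dimension two. -/
lemma exists_lintegral_sq_le_energy : ∃ K : ℝ≥0∞, K ≠ ⊤ ∧ ∀ U : Space 1 → ℝ,
    IsTest (B 1 1 \ charSet 1) U →
    ∫⁻ z, ‖U z * U z * (yc z)⁻¹‖ₑ ^ 2 ≤ K * energy U ^ (2 : ℝ) := by
  set C := lintegralPowLePowLIntegralFDerivConst (volume : Measure (Space 1)) 2 with hC
  refine ⟨C * 2 ^ (2 : ℝ), by finiteness, fun U hU => ?_⟩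
  have hinv : ContDiffOn ℝ ∞ (fun z : Space 1 => (yc z)⁻¹) (B 1 1 \ charSet 1) :=
    contDiff_yc.contDiffOn.inv fun z hz => hz.2
  have hZ : IsTest (B 1 1 \ charSet 1) fun z => U z * (U z * (yc z)⁻¹) :=
    hU.mul_contDiffOn isOpen_ball_diff (hU.1.contDiffOn.mul hinv)
  -- The inequality W^{1,1} ⊂ L² in the plane is applied to U²/y. Its gradient is 2(U/y)∇U - (U/y)²
  -- e_y, which Young's inequality bounds by the energy density.
  have h := lintegral_pow_le_pow_lintegral_fderiv (volume : Measure (Space 1))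
    (hZ.1.of_le (by simp)) hZ.2.1 (p := 2) (by
      rw [finrank_space]
      norm_num
      exact Real.HolderConjugate.two_two)
  have hpt : ∀ z, ‖fderiv ℝ (fun z => U z * (U z * (yc z)⁻¹)) z‖ₑ ≤
      2 * (‖gradient U z‖ₑ ^ 2 + ‖U z * (yc z)⁻¹‖ₑ ^ 2) := by
    intro z
    rw [← ofReal_norm, ← norm_gradient]
    have hR : ‖gradient (fun z => U z * (U z * (yc z)⁻¹)) z‖ ≤
        2 * (‖gradient U z‖ ^ 2 + ‖U z * (yc z)⁻¹‖ ^ 2) := by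
      by_cases hz : z ∈ tsupport U
      · have hy : yc z ≠ 0 := (hU.2.2 hz).2
        have hUd : DifferentiableAt ℝ U z := hU.1.differentiable (by simp) z
        have hyd : DifferentiableAt ℝ (yc : Space 1 → ℝ) z :=
          (contDiff_yc (m := 1)).differentiable (by simp) z
        have hinvd : DifferentiableAt ℝ (fun z : Space 1 => (yc z)⁻¹) z := hyd.inv hy
        rw [gradient_mul hUd (hUd.fun_mul hinvd), gradient_mul hUd hinvd,
          gradient_comp (h := fun t => t⁻¹) (differentiableAt_inv hy) hyd, gradient_yc, deriv_inv]
        set q := U z * (yc z)⁻¹ with hq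
        set G := gradient U z
        have e : U z • (U z • -(yc z ^ 2)⁻¹ • ey 1 + (yc z)⁻¹ • G) + q • G =
            (-(q * q)) • ey 1 + (2 * q) • G := by
          rw [smul_add, smul_smul, smul_smul, smul_smul, ← hq, two_mul, add_smul (M := Space 1) q q,
            add_assoc]
          congr 2
          rw [hq]; field_simp
        rw [e]
        refine (norm_add_le _ _).trans ?_
        have e3 : ‖q * q‖ = ‖q‖ * ‖q‖ := norm_mul _ _
        have e4 : ‖2 * q‖ = 2 * ‖q‖ := by rw [norm_mul, Real.norm_two]
        rw [norm_smul, norm_smul, norm_ey, norm_neg, e3, e4]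
        nlinarith [sq_nonneg (‖q‖ - ‖G‖), norm_nonneg q, norm_nonneg G]
      · have : gradient (fun z => U z * (U z * (yc z)⁻¹)) z = 0 :=
          gradient_eq_zero_of_notMem fun h => hz (tsupport_mul_subset_left h)
        rw [this, norm_zero]; positivity
    refine (ENNReal.ofReal_le_ofReal hR).trans (le_of_eq ?_)
    rw [ENNReal.ofReal_mul (by norm_num), ENNReal.ofReal_add (by positivity) (by positivity),
      ENNReal.ofReal_pow (norm_nonneg _), ENNReal.ofReal_pow (norm_nonneg _), ofReal_norm,
      ofReal_norm]
    norm_num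
  have hI : ∫⁻ z, ‖fderiv ℝ (fun z => U z * (U z * (yc z)⁻¹)) z‖ₑ ≤ 2 * energy U := by
    refine (lintegral_mono hpt).trans (le_of_eq ?_)
    rw [lintegral_const_mul' _ _ (by norm_num), energy, lintegral_add_left]
    exact (continuous_gradient hU.1).enorm.measurable.pow_const 2
  calc ∫⁻ z, ‖U z * U z * (yc z)⁻¹‖ₑ ^ 2
      = ∫⁻ z, ‖U z * (U z * (yc z)⁻¹)‖ₑ ^ (2 : ℝ) := by
        refine lintegral_congr fun z => ?_
        rw [mul_assoc]; norm_num
    _ ≤ C * (2 * energy U) ^ (2 : ℝ) := by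
        refine h.trans ?_
        gcongr
    _ = _ := by rw [ENNReal.mul_rpow_of_nonneg _ _ (by norm_num), mul_assoc]

/-- Hölder's inequality with exponents fixed by homogeneity: the total power of U is two and the
powers of |y| cancel. With Γ = |y|^(d-n-1)|G|^d the factors for n ≥ 2 are Γ^(2/d), the (n-1)/d power
of the critical Sobolev integrand, and (U²/y²)^((d-n-1)/d). For n = 1 they are Γ^(2/d),
(U⁴/y²)^(2/d) and (U²/y²)^(1-4/d), which is where d ≥ 4 is needed. -/
lemma exists_lintegral_mul_sq_le_energy (hn : 1 ≤ n) {d : ℝ} (hd4 : 4 ≤ d) (hdn : n + 1 ≤ d)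
    {G : Space n → Space n} (hGm : AEStronglyMeasurable G (volume.restrict (B n 1)))
    (hG : ∫⁻ z in B n 1, ENNReal.ofReal (|yc z|) ^ (d - (n + 1)) * ‖G z‖ₑ ^ d ≠ ⊤) :
    ∃ C : ℝ≥0∞, C ≠ ⊤ ∧ ∀ U : Space n → ℝ, IsTest (B n 1 \ charSet n) U →
      ∫⁻ z in B n 1, ‖U z‖ₑ ^ 2 * ‖G z‖ₑ ^ 2 ≤ C * energy U := by
  have hd0 : 0 < d := by linarith
  let Γ : Space n → ℝ≥0∞ := fun z => ENNReal.ofReal (|yc z|) ^ (d - (n + 1)) * ‖G z‖ₑ ^ d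
  have hΓm : AEMeasurable Γ (volume.restrict (B n 1)) :=
    ((measurable_yc.abs.ennreal_ofReal.pow_const _).aemeasurable).mul (hGm.enorm.pow_const _)
  have hΓp : ∀ z, Γ z ^ (2 / d) =
      ENNReal.ofReal (|yc z|) ^ ((d - (n + 1)) * (2 / d)) * ‖G z‖ₑ ^ 2 := fun z => by
    simp only [Γ]
    rw [ENNReal.mul_rpow_of_nonneg _ _ (by positivity), ← ENNReal.rpow_mul, ← ENNReal.rpow_mul,
      mul_div_cancel₀ _ hd0.ne', ENNReal.rpow_ofNat]
  have hY : ∀ z : Space n, yc z ≠ 0 → ∀ U : Space n → ℝ, ‖U z * (yc z)⁻¹‖ₑ =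
      ‖U z‖ₑ * (ENNReal.ofReal |yc z|)⁻¹ := fun z hz U => by
    rw [enorm_mul, enorm_inv hz, Real.enorm_eq_ofReal_abs (yc z)]
  rcases hn.eq_or_lt with rfl | hn2
  · obtain ⟨K, hK, hKU⟩ := exists_lintegral_sq_le_energy
    refine ⟨(∫⁻ z in B 1 1, Γ z) ^ (2 / d) * K ^ (2 / d),
      ENNReal.mul_ne_top (ENNReal.rpow_ne_top_of_nonneg (by positivity) hG)
        (ENNReal.rpow_ne_top_of_nonneg (by positivity) hK), fun U hU => ?_⟩
    have hr : 0 ≤ 1 - 4 / d := by rw [sub_nonneg, div_le_one hd0]; exact hd4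
    refine lintegral_mul_sq_le_of_factor hU.1.continuous hΓm
      (H := fun z => ‖U z * U z * (yc z)⁻¹‖ₑ ^ 2)
      (((hU.1.continuous.mul hU.1.continuous).measurable.mul measurable_yc.inv).enorm.pow_const 2)
      (p := 2 / d) (q := 2 / d) (r := 1 - 4 / d) (s := 2) (by positivity) (by positivity) hr
      (by ring) (by ring) (by norm_num) ?_ (hKU U hU)
    filter_upwards [ae_restrict_ball] with z hz
    have hY0 : ENNReal.ofReal |yc z| ≠ 0 := by simpa using hz.2
    have h3 : ‖U z * U z * (yc z)⁻¹‖ₑ = ‖U z‖ₑ * ‖U z‖ₑ * (ENNReal.ofReal |yc z|)⁻¹ := by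
      rw [← enorm_mul, ← hY z hz.2 fun z => U z * U z]
    rw [hΓp, hY z hz.2, h3]
    set Y := ENNReal.ofReal |yc z|
    set u := ‖U z‖ₑ
    have hYt : Y ≠ ⊤ := ENNReal.ofReal_ne_top
    have hd' : 0 ≤ 4 / d := by positivity
    rw [← sq u, mul_pow, ← pow_mul, mul_pow, ENNReal.mul_rpow_of_nonneg _ _ (by positivity),
      ENNReal.mul_rpow_of_nonneg _ _ hr, ← ENNReal.rpow_natCast u, ← ENNReal.rpow_natCast u,
      ← ENNReal.rpow_natCast Y⁻¹, ← ENNReal.rpow_mul, ← ENNReal.rpow_mul, ← ENNReal.rpow_mul,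
      ← ENNReal.rpow_mul, ENNReal.inv_rpow, ENNReal.inv_rpow, ← ENNReal.rpow_neg,
      ← ENNReal.rpow_neg]
    have e : ∀ x1 x2 x3 x4 g x5 : ℝ≥0∞, x1 * g * (x2 * x3) * (x4 * x5) =
        (x2 * x4) * g * (x1 * x3 * x5) := fun _ _ _ _ _ _ => by ring
    rw [e, ← ENNReal.rpow_add_of_nonneg _ _ (by positivity) (by positivity),
      ← ENNReal.rpow_add _ _ hY0 hYt, ← ENNReal.rpow_add _ _ hY0 hYt]
    have e1 : ((2 * 2 : ℕ) : ℝ) * (2 / d) + ((2 : ℕ) : ℝ) * (1 - 4 / d) = (2 : ℕ) := by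
      push_cast; ring
    have e2 : (d - (((1 : ℕ) : ℝ) + 1)) * (2 / d) + -(((2 : ℕ) : ℝ) * (2 / d)) +
        -(((2 : ℕ) : ℝ) * (1 - 4 / d)) = 0 := by
      push_cast; field_simp; ring
    rw [e1, e2, ENNReal.rpow_zero, mul_one]
  · have hn2' : (2 : ℝ) ≤ n := by exact_mod_cast hn2
    have hn1 : (0 : ℝ) < n - 1 := by linarith
    obtain ⟨K, hK, hKU⟩ := exists_lintegral_rpow_le_energy (n := n) hn2
    have hq : 0 ≤ (n - 1) / d := by positivity
    have hr : 0 ≤ (d - (n + 1)) / d := div_nonneg (by linarith) hd0.le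
    refine ⟨(∫⁻ z in B n 1, Γ z) ^ (2 / d) * K ^ ((n - 1) / d),
      ENNReal.mul_ne_top (ENNReal.rpow_ne_top_of_nonneg (by positivity) hG)
        (ENNReal.rpow_ne_top_of_nonneg hq hK), fun U hU => ?_⟩
    refine lintegral_mul_sq_le_of_factor hU.1.continuous hΓm
      (H := fun z => ‖U z‖ₑ ^ (2 * (n + 1) / (n - 1) : ℝ))
      (hU.1.continuous.enorm.measurable.pow_const _)
      (p := 2 / d) (q := (n - 1) / d) (r := (d - (n + 1)) / d) (s := (n + 1) / (n - 1))
      (by positivity) hq hr (by field_simp; ring) (by field_simp; ring) (by positivity) ?_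
      (hKU U hU.1 hU.2.1)
    filter_upwards [ae_restrict_ball] with z hz
    have hY0 : ENNReal.ofReal |yc z| ≠ 0 := by simpa using hz.2
    rw [hΓp, hY z hz.2]
    set Y := ENNReal.ofReal |yc z|
    set u := ‖U z‖ₑ
    have hYt : Y ≠ ⊤ := ENNReal.ofReal_ne_top
    rw [mul_pow, ENNReal.mul_rpow_of_nonneg _ _ hr, ← ENNReal.rpow_natCast u,
      ← ENNReal.rpow_natCast Y⁻¹, ← ENNReal.rpow_mul, ← ENNReal.rpow_mul, ← ENNReal.rpow_mul,
      ENNReal.inv_rpow, ← ENNReal.rpow_neg]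
    have e : ∀ x1 x2 x4 g x5 : ℝ≥0∞, x1 * g * x2 * (x4 * x5) = (x2 * x4) * g * (x1 * x5) :=
      fun _ _ _ _ _ => by ring
    rw [e, ← ENNReal.rpow_add_of_nonneg _ _ (by positivity) (by positivity),
      ← ENNReal.rpow_add _ _ hY0 hYt]
    have e1 : 2 * ((n : ℝ) + 1) / (n - 1) * ((n - 1) / d) + ((2 : ℕ) : ℝ) * ((d - (n + 1)) / d) =
        (2 : ℕ) := by push_cast; field_simp; ring
    have e2 : (d - ((n : ℝ) + 1)) * (2 / d) + -(((2 : ℕ) : ℝ) * ((d - (n + 1)) / d)) = 0 := by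
      push_cast; ring
    rw [e1, e2, ENNReal.rpow_zero, mul_one]

lemma eLpNorm_add_le_of_bound {α E F H : Type*} [MeasurableSpace α] {μ : Measure α}
    [NormedAddCommGroup E] [NormedAddCommGroup F] [NormedAddCommGroup H] {f : α → E} {g : α → F}
    {h : α → H} (hg : AEStronglyMeasurable g μ) (hh : AEStronglyMeasurable h μ) {c c' : ℝ}
    (hc : 0 ≤ c) (hc' : 0 ≤ c') (hfg : ∀ᵐ z ∂μ, ‖f z‖ ≤ c * ‖g z‖ + c' * ‖h z‖) :
    eLpNorm f 2 μ ≤ ENNReal.ofReal c * eLpNorm g 2 μ + ENNReal.ofReal c' * eLpNorm h 2 μ := by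
  have h1 : eLpNorm f 2 μ ≤ eLpNorm (fun z => c * ‖g z‖ + c' * ‖h z‖) 2 μ := by
    refine eLpNorm_mono_ae ?_
    filter_upwards [hfg] with z hz
    exact hz.trans (le_abs_self _)
  refine h1.trans ((eLpNorm_add_le (hg.norm.const_mul c) (hh.norm.const_mul c')
    (by norm_num)).trans ?_)
  refine add_le_add ?_ ?_
  · refine eLpNorm_le_mul_eLpNorm_of_ae_le_mul (ae_of_all _ fun z => ?_) _
    simp [abs_of_nonneg hc]
  · refine eLpNorm_le_mul_eLpNorm_of_ae_le_mul (ae_of_all _ fun z => ?_) _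
    simp [abs_of_nonneg hc']

/-- The weighted Sobolev estimate: multiplication by `G` is controlled by the weighted Dirichlet
and Hardy norms. -/
lemma exists_eLpNorm_mul_le (hn : 1 ≤ n) {d : ℝ} (hd4 : 4 ≤ d) (hdn : n + 1 ≤ d) (b : ℝ)
    {G : Space n → Space n} (hGm : AEStronglyMeasurable G (volume.restrict (B n 1)))
    (hG : ∫⁻ z in B n 1, ENNReal.ofReal (|yc z|) ^ (d - (n + 1)) * ‖G z‖ₑ ^ d ≠ ⊤) :
    ∃ C : ℝ≥0∞, C ≠ ⊤ ∧ ∀ Φ : Space n → ℝ, IsTest (B n 1 \ charSet n) Φ →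
      eLpNorm (fun z => |yc z| ^ (b / 2) * Φ z * ‖G z‖) 2 (volume.restrict (B n 1)) ≤
        C * (eLpNorm (fun z => |yc z| ^ (b / 2) • gradient Φ z) 2 (volume.restrict (B n 1)) +
          eLpNorm (fun z => |yc z| ^ (b / 2 - 1) * Φ z) 2 (volume.restrict (B n 1))) := by
  obtain ⟨C, hC, hCU⟩ := exists_lintegral_mul_sq_le_energy hn hd4 hdn hGm hG
  refine ⟨C ^ (1 / 2 : ℝ) * (ENNReal.ofReal (|b / 2|) + 2),
    ENNReal.mul_ne_top (ENNReal.rpow_ne_top_of_nonneg (by norm_num) hC) (by finiteness),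
    fun Φ hΦ => ?_⟩
  set m := (volume : Measure (Space n)).restrict (B n 1) with hm
  set E1 := eLpNorm (fun z => |yc z| ^ (b / 2) • gradient Φ z) 2 m with hE1
  set E2 := eLpNorm (fun z => |yc z| ^ (b / 2 - 1) * Φ z) 2 m with hE2
  -- Absorbing the weight into the function reduces to the unweighted estimate. U is smooth because
  -- Φ vanishes near Σ; differentiating the power of |y| costs |b/2| times the Hardy norm.
  let U : Space n → ℝ := fun z => Φ z * |yc z| ^ (b / 2)
  have hU : IsTest (B n 1 \ charSet n) U :=
    hΦ.mul_contDiffOn isOpen_ball_diff (contDiffOn_rpow_abs_yc _)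
  have hsub : ∀ {E : Type} [NormedAddCommGroup E] (f : Space n → E), (∀ z ∉ B n 1, f z = 0) →
      ∫⁻ z, ‖f z‖ₑ ^ 2 = eLpNorm f 2 m ^ 2 := fun f hf => by
    rw [eLpNorm_two_sq, ← lintegral_indicator Metric.isOpen_ball.measurableSet]
    refine lintegral_congr fun z => ?_
    by_cases hz : z ∈ B n 1
    · simp [hz]
    · simp [hz, hf z hz]
  have hUB : ∀ z ∉ B n 1, z ∉ tsupport U := fun z hz h => hz (hU.2.2 h).1
  have hgU : eLpNorm (gradient U) 2 m ≤ E1 + ENNReal.ofReal |b / 2| * E2 := by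
    have := eLpNorm_add_le_of_bound (f := gradient U) (μ := m) (c := 1) (c' := |b / 2|)
      (g := fun z => |yc z| ^ (b / 2) • gradient Φ z) (h := fun z => |yc z| ^ (b / 2 - 1) * Φ z)
      ((measurable_pow_yc _).smul (measurable_gradient Φ)).aestronglyMeasurable
      ((measurable_pow_yc _).mul hΦ.1.continuous.measurable).aestronglyMeasurable
      zero_le_one (abs_nonneg _) ?_
    · simpa using this
    · filter_upwards [ae_restrict_ball] with z hz
      obtain ⟨σ, hσ, hσg⟩ := gradient_rpow_abs_yc (b / 2) hz.2
      have hd1 : DifferentiableAt ℝ Φ z := hΦ.1.differentiable (by simp) z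
      have hd2 : DifferentiableAt ℝ (fun z : Space n => |yc z| ^ (b / 2)) z :=
        ((contDiffOn_rpow_abs_yc (Ω := B n 1) (b / 2)).contDiffAt
          (isOpen_ball_diff.mem_nhds hz)).differentiableAt (by simp)
      rw [gradient_mul hd1 hd2, hσg, one_mul]
      refine (norm_add_le _ _).trans (le_of_eq ?_)
      rw [norm_smul, norm_smul, norm_ey, norm_mul, norm_mul, norm_mul, Real.norm_eq_abs σ, hσ,
        Real.norm_eq_abs (b / 2)]
      ring
  have hUy : eLpNorm (fun z => U z * (yc z)⁻¹) 2 m ≤ E2 := by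
    refine eLpNorm_mono_ae ?_
    filter_upwards [ae_restrict_ball] with z hz
    rw [norm_mul, norm_mul, norm_mul, norm_inv, Real.norm_eq_abs (yc z),
      Real.rpow_sub_one (abs_ne_zero.2 hz.2), norm_div, Real.norm_eq_abs |yc z|, abs_abs]
    exact le_of_eq (by ring)
  have hen : energy U ≤ ((ENNReal.ofReal (|b / 2|) + 2) * (E1 + E2)) ^ 2 := by
    have h1 : energy U ≤ (E1 + ENNReal.ofReal |b / 2| * E2) ^ 2 + E2 ^ 2 := by
      rw [energy, hsub _ fun z hz => gradient_eq_zero_of_notMem (hUB z hz),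
        hsub _ fun z hz => by rw [image_eq_zero_of_notMem_tsupport (hUB z hz), zero_mul]]
      gcongr
    refine h1.trans ?_
    set β := ENNReal.ofReal |b / 2|
    calc (E1 + β * E2) ^ 2 + E2 ^ 2 ≤ (E1 + β * E2 + E2) ^ 2 := by
          rw [add_sq (E1 + β * E2)]
          gcongr
          exact le_self_add
      _ ≤ _ := by
          gcongr
          calc E1 + β * E2 + E2 ≤ (E1 + β * E2 + E2) + (E1 + E2 + β * E1) := le_self_add
            _ = _ := by ring
  refine (ENNReal.pow_right_strictMono two_ne_zero).le_iff_le.1 ?_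
  calc eLpNorm (fun z => |yc z| ^ (b / 2) * Φ z * ‖G z‖) 2 m ^ 2
      = ∫⁻ z in B n 1, ‖U z‖ₑ ^ 2 * ‖G z‖ₑ ^ 2 := by
        rw [eLpNorm_two_sq]
        refine lintegral_congr fun z => ?_
        rw [enorm_mul, mul_pow, enorm_norm, mul_comm (|yc z| ^ (b / 2))]
    _ ≤ C * energy U := hCU U hU
    _ ≤ C * ((ENNReal.ofReal (|b / 2|) + 2) * (E1 + E2)) ^ 2 := by gcongr
    _ = _ := by
        rw [mul_assoc, mul_pow (C ^ (1 / 2 : ℝ)), ← ENNReal.rpow_natCast (C ^ (1 / 2 : ℝ)),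
          ← ENNReal.rpow_mul]
        norm_num

/-! ### Cutoff functions near the characteristic manifold -/

/-- A smooth function of one variable, zero on `[-1, 1]` and one outside `(-2, 2)`. -/
noncomputable def cutoffProfile (t : ℝ) : ℝ := Real.smoothTransition (t ^ 2 - 1)

lemma contDiff_cutoffProfile : ContDiff ℝ ∞ cutoffProfile :=
  Real.smoothTransition.contDiff.comp ((contDiff_id.pow 2).sub contDiff_const)

lemma cutoffProfile_eq_zero {t : ℝ} (h : |t| ≤ 1) : cutoffProfile t = 0 :=
  Real.smoothTransition.zero_of_nonpos (by have := (sq_le_one_iff_abs_le_one t).2 h; linarith)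

lemma cutoffProfile_eq_one {t : ℝ} (h : 2 ≤ |t|) : cutoffProfile t = 1 :=
  Real.smoothTransition.one_of_one_le (by rw [← sq_abs]; nlinarith)

lemma deriv_cutoffProfile_eq_zero {t : ℝ} (h : 2 < |t|) : deriv cutoffProfile t = 0 := by
  have : cutoffProfile =ᶠ[𝓝 t] fun _ => 1 := by
    filter_upwards [continuous_abs.continuousAt.eventually (lt_mem_nhds h)] with s hs
    exact cutoffProfile_eq_one hs.le
  rw [this.deriv_eq, deriv_const]

lemma exists_mul_deriv_cutoffProfile_le :
    ∃ C : ℝ, 0 < C ∧ ∀ t, |t * deriv cutoffProfile t| ≤ C := by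
  have hc : Continuous fun t => t * deriv cutoffProfile t :=
    continuous_id.mul (contDiff_cutoffProfile.continuous_deriv (by simp))
  obtain ⟨C, hC⟩ := (isCompact_Icc (a := (-2 : ℝ)) (b := 2)).exists_bound_of_continuousOn
    hc.continuousOn
  refine ⟨max C 1, by positivity, fun t => ?_⟩
  rcases le_or_gt |t| 2 with h | h
  · exact (hC t (abs_le.1 h)).trans (le_max_left _ _)
  · rw [deriv_cutoffProfile_eq_zero h]; simp

/-- The cutoff functions `η_j`, which vanish for `j |y| ≤ 1` and are one for `j |y| ≥ 2`. -/
noncomputable def cutoff (j : ℕ) (z : Space n) : ℝ := cutoffProfile (j * yc z)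

lemma contDiff_cutoff (j : ℕ) : ContDiff ℝ ∞ (cutoff (n := n) j) :=
  contDiff_cutoffProfile.comp (contDiff_const.mul contDiff_yc)

lemma abs_cutoff_le (j : ℕ) (z : Space n) : |cutoff j z| ≤ 1 := by
  have h0 : 0 ≤ cutoff j z := Real.smoothTransition.nonneg _
  rw [abs_of_nonneg h0]
  exact Real.smoothTransition.le_one _

lemma cutoff_eq_zero {j : ℕ} {z : Space n} (h : (j : ℝ) * |yc z| ≤ 1) : cutoff j z = 0 :=
  cutoffProfile_eq_zero (by rwa [abs_mul, Nat.abs_cast])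

lemma eventually_two_lt {z : Space n} (hz : yc z ≠ 0) :
    ∀ᶠ j : ℕ in atTop, 2 < (j : ℝ) * |yc z| :=
  ((tendsto_natCast_atTop_atTop (R := ℝ)).atTop_mul_const (abs_pos.2 hz)).eventually_gt_atTop 2

lemma eventually_cutoff_eq_one {z : Space n} (hz : yc z ≠ 0) :
    ∀ᶠ j : ℕ in atTop, cutoff j z = 1 := by
  filter_upwards [eventually_two_lt hz] with j hj
  exact cutoffProfile_eq_one (by rw [abs_mul, Nat.abs_cast]; exact hj.le)

lemma gradient_cutoff (j : ℕ) (z : Space n) :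
    gradient (cutoff j) z = (deriv cutoffProfile (j * yc z) * j) • ey n := by
  have hd : DifferentiableAt ℝ (yc : Space n → ℝ) z :=
    (contDiff_yc (m := 1)).differentiable (by simp) z
  have h1 : gradient (fun z : Space n => (j : ℝ) * yc z) z = (j : ℝ) • ey n := by
    rw [gradient_comp (h := fun t => (j : ℝ) * t) (by fun_prop) hd, gradient_yc]
    simp
  have := gradient_comp (h := cutoffProfile) (f := fun z : Space n => (j : ℝ) * yc z) (z := z)
    (contDiff_cutoffProfile.differentiable (by simp) _) (hd.const_mul _)
  rw [h1, smul_smul] at this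
  exact this

/-- Scale invariance: the quantity is |t η'(t)| at t = jy, with η the profile, hence bounded
uniformly in j. The resulting factor 1/|y| is exactly the one Hardy's inequality controls. -/
lemma exists_gradient_cutoff_le : ∃ C : ℝ, 0 < C ∧ ∀ (j : ℕ) (z : Space n),
    ‖gradient (cutoff j) z‖ * |yc z| ≤ C := by
  obtain ⟨C, hC, h⟩ := exists_mul_deriv_cutoffProfile_le
  refine ⟨C, hC, fun j z => le_trans (le_of_eq ?_) (h (j * yc z))⟩
  rw [gradient_cutoff, norm_smul, norm_ey, Real.norm_eq_abs, abs_mul, abs_mul, abs_mul]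
  ring

lemma gradient_cutoff_eq_zero_of_lt {j : ℕ} {z : Space n} (h : (j : ℝ) * |yc z| < 1) :
    gradient (cutoff j) z = 0 := by
  have : (cutoff j : Space n → ℝ) =ᶠ[𝓝 z] fun _ => 0 := by
    filter_upwards [(continuous_const.mul continuous_yc.abs).continuousAt.eventually
      (gt_mem_nhds h)] with w hw
    exact cutoff_eq_zero hw.le
  rw [this.gradient_eq, gradient_fun_const]

lemma eventually_gradient_cutoff_eq_zero {z : Space n} (hz : yc z ≠ 0) :
    ∀ᶠ j : ℕ in atTop, gradient (cutoff j) z = 0 := by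
  filter_upwards [eventually_two_lt hz] with j hj
  rw [gradient_cutoff, deriv_cutoffProfile_eq_zero (by rwa [abs_mul, Nat.abs_cast]), zero_mul,
    zero_smul]

lemma tsupport_cutoff_subset (j : ℕ) : tsupport (cutoff (n := n) j) ⊆ {z | 1 ≤ (j : ℝ) * |yc z|} := by
  refine closure_minimal (fun z hz => ?_)
    (isClosed_le continuous_const (continuous_const.mul continuous_yc.abs))
  by_contra h
  exact hz (cutoff_eq_zero (not_le.1 h).le)

lemma IsTest.mul_cutoff {r : ℝ} {φ : Space n → ℝ} (hφ : IsTest (B n r) φ) (j : ℕ) :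
    IsTest (B n r \ charSet n) (fun z => φ z * cutoff j z) := by
  refine ⟨hφ.1.mul (contDiff_cutoff j), hφ.2.1.mul_right, fun z hz => ⟨?_, fun h0 => ?_⟩⟩
  · exact hφ.2.2 (tsupport_mul_subset_left hz)
  · have := tsupport_cutoff_subset j (tsupport_mul_subset_right hz)
    have h0' : yc z = 0 := h0
    simp [h0'] at this
    linarith

lemma IsTest.sub {Ω : Set (Space n)} {φ ψ : Space n → ℝ} (hφ : IsTest Ω φ) (hψ : IsTest Ω ψ) :
    IsTest Ω (fun z => φ z - ψ z) :=
  ⟨hφ.1.sub hψ.1, hφ.2.1.sub hψ.2.1, (tsupport_sub _ _).trans (union_subset hφ.2.2 hψ.2.2)⟩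

lemma gradient_sub' {f g : Space n → ℝ} {z : Space n} (hf : DifferentiableAt ℝ f z)
    (hg : DifferentiableAt ℝ g z) :
    gradient (fun z => f z - g z) z = gradient f z - gradient g z := by
  simp only [gradient, fderiv_fun_sub hf hg, map_sub]

/-! ### Convergence in `L²` -/

/-- Dominated convergence in L², with a multiple of |F| as the dominating function. -/
lemma tendsto_eLpNorm_smul_of_bounded {E : Type*} [NormedAddCommGroup E] [NormedSpace ℝ E]
    {μ : Measure (Space n)} {F : Space n → E} (hF : MemLp F 2 μ) {f : ℕ → Space n → E}
    (hf : ∀ j, AEStronglyMeasurable (f j) μ) (C : ℝ) (hb : ∀ j, ∀ᵐ z ∂μ, ‖f j z‖ ≤ C * ‖F z‖)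
    (h0 : ∀ᵐ z ∂μ, Tendsto (fun j => f j z) atTop (𝓝 0)) :
    Tendsto (fun j => eLpNorm (f j) 2 μ) atTop (𝓝 0) := by
  have h2 : Tendsto (fun j => ∫⁻ z, ‖f j z‖ₑ ^ 2 ∂μ) atTop (𝓝 (∫⁻ _, 0 ∂μ)) := by
    refine tendsto_lintegral_of_dominated_convergence' (fun z => (ENNReal.ofReal C * ‖F z‖ₑ) ^ 2)
      (fun j => (hf j).enorm.pow_const 2) (fun j => ?_) ?_ ?_
    · filter_upwards [hb j] with z hz
      gcongr
      rw [← ofReal_norm, ← ofReal_norm]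
      refine (ENNReal.ofReal_le_ofReal hz).trans (le_of_eq ?_)
      rcases le_or_gt 0 C with hC | hC
      · exact ENNReal.ofReal_mul hC
      · rw [ENNReal.ofReal_of_nonpos (mul_nonpos_of_nonpos_of_nonneg hC.le (norm_nonneg _)),
          ENNReal.ofReal_of_nonpos hC.le, zero_mul]
    · simp_rw [mul_pow]
      rw [lintegral_const_mul' _ _ (by finiteness), ← eLpNorm_two_sq]
      have := hF.2.ne
      finiteness
    · filter_upwards [h0] with z hz
      have h1 : Tendsto (fun j => ‖f j z‖ₑ) atTop (𝓝 0) := by simpa using hz.enorm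
      simpa [Function.comp_def] using ((ENNReal.continuous_pow 2).tendsto 0).comp h1
  simp only [lintegral_zero] at h2
  have h3 := h2.ennrpow_const (1 / 2 : ℝ)
  rw [ENNReal.zero_rpow_of_pos (by norm_num)] at h3
  refine h3.congr fun j => ?_
  rw [← eLpNorm_two_sq, ← ENNReal.rpow_natCast, ← ENNReal.rpow_mul]
  norm_num

lemma eLpNorm_le_add_of_sub {E : Type*} [NormedAddCommGroup E] {μ : Measure (Space n)}
    {f g h : Space n → E} (hf : AEStronglyMeasurable f μ) (hg : AEStronglyMeasurable g μ)
    (hh : AEStronglyMeasurable h μ) :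
    eLpNorm (fun z => f z - h z) 2 μ ≤
      eLpNorm (fun z => f z - g z) 2 μ + eLpNorm (fun z => g z - h z) 2 μ := by
  have := eLpNorm_add_le (hf.sub hg) (hg.sub hh) (p := 2) (by norm_num)
  refine le_trans (le_of_eq ?_) this
  congr 1
  ext1 z
  simp

lemma tendsto_zero_of_le_mul {α : Type*} {l : Filter α} {f g : α → ℝ≥0∞} {C : ℝ≥0∞} (hC : C ≠ ⊤)
    (hg : Tendsto g l (𝓝 0)) (h : ∀ k, f k ≤ C * g k) : Tendsto f l (𝓝 0) := by
  refine tendsto_of_tendsto_of_tendsto_of_le_of_le tendsto_const_nhds ?_ (fun _ => zero_le) h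
  simpa using ENNReal.Tendsto.const_mul hg (Or.inr hC)

lemma tendsto_eLpNorm_of_bound {E F : Type*} [NormedAddCommGroup E] [NormedAddCommGroup F]
    {μ : Measure (Space n)} {f : ℕ → Space n → E} {g : ℕ → Space n → F} (C : ℝ)
    (hg : Tendsto (fun k => eLpNorm (g k) 2 μ) atTop (𝓝 0))
    (h : ∀ k, ∀ᵐ z ∂μ, ‖f k z‖ ≤ C * ‖g k z‖) :
    Tendsto (fun k => eLpNorm (f k) 2 μ) atTop (𝓝 0) :=
  tendsto_zero_of_le_mul ENNReal.ofReal_ne_top hg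
    fun k => eLpNorm_le_mul_eLpNorm_of_ae_le_mul (h k) 2

lemma tendsto_eLpNorm_of_bound_add {E F H : Type*} [NormedAddCommGroup E] [NormedAddCommGroup F]
    [NormedAddCommGroup H] {μ : Measure (Space n)} {f : ℕ → Space n → E} {g : ℕ → Space n → F}
    {h : ℕ → Space n → H} {C C' : ℝ} (hC : 0 ≤ C) (hC' : 0 ≤ C')
    (hgm : ∀ k, AEStronglyMeasurable (g k) μ) (hhm : ∀ k, AEStronglyMeasurable (h k) μ)
    (hg : Tendsto (fun k => eLpNorm (g k) 2 μ) atTop (𝓝 0))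
    (hh : Tendsto (fun k => eLpNorm (h k) 2 μ) atTop (𝓝 0))
    (hb : ∀ k, ∀ᵐ z ∂μ, ‖f k z‖ ≤ C * ‖g k z‖ + C' * ‖h k z‖) :
    Tendsto (fun k => eLpNorm (f k) 2 μ) atTop (𝓝 0) := by
  have h1 := (ENNReal.Tendsto.const_mul hg (Or.inr (ENNReal.ofReal_ne_top (r := C)))).add
    (ENNReal.Tendsto.const_mul hh (Or.inr (ENNReal.ofReal_ne_top (r := C'))))
  simp only [mul_zero, add_zero] at h1
  exact tendsto_of_tendsto_of_tendsto_of_le_of_le tendsto_const_nhds h1 (fun _ => zero_le)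
    fun k => eLpNorm_add_le_of_bound (hgm k) (hhm k) hC hC' (hb k)

/-- If `s Φ_k → s f` in `L²` and `Γ s Φ_k` is a Cauchy sequence in `L²`, then its limit
is `Γ s f`. -/
lemma tendsto_eLpNorm_mul_of_cauchy {μ : Measure (Space n)} {s Γ f : Space n → ℝ}
    {Φ : ℕ → Space n → ℝ} (hsm : AEStronglyMeasurable s μ)
    (hΓ : AEStronglyMeasurable Γ μ) (hf : AEStronglyMeasurable f μ)
    (hΦ : ∀ k, AEStronglyMeasurable (Φ k) μ)
    (hlim : Tendsto (fun k => eLpNorm (fun z => s z * (Φ k z - f z)) 2 μ) atTop (𝓝 0))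
    (hc : ∀ δ > 0, ∃ N, ∀ k ≥ N, ∀ l ≥ N,
      eLpNorm (fun z => s z * (Φ k z - Φ l z) * Γ z) 2 μ ≤ δ) :
    Tendsto (fun k => eLpNorm (fun z => s z * (Φ k z - f z) * Γ z) 2 μ) atTop (𝓝 0) := by
  have hmeas : TendstoInMeasure μ (fun k z => s z * Φ k z) atTop (fun z => s z * f z) := by
    refine tendstoInMeasure_of_tendsto_eLpNorm (p := 2) (by norm_num)
      (fun k => hsm.mul (hΦ k)) (hsm.mul hf) (hlim.congr fun k => ?_)
    refine eLpNorm_congr_ae (ae_of_all _ fun z => ?_)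
    simp [mul_sub]
  obtain ⟨ns, hmono, hns⟩ := hmeas.exists_seq_tendsto_ae
  rw [ENNReal.tendsto_nhds_zero]
  intro δ hδ
  obtain ⟨N, hN⟩ := hc δ hδ
  filter_upwards [eventually_ge_atTop N] with k hk
  -- Fatou in the second index, along an almost everywhere convergent subsequence, turns the Cauchy
  -- bound into a bound on the distance to the limit.
  have hpt : ∀ᵐ z ∂μ, Tendsto (fun i => s z * (Φ k z - Φ (ns i) z) * Γ z) atTop
      (𝓝 (s z * (Φ k z - f z) * Γ z)) := by
    filter_upwards [hns] with z hz
    have := ((tendsto_const_nhds (x := s z * Φ k z)).sub hz).mul_const (Γ z)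
    simpa [mul_sub] using this
  refine (Lp.eLpNorm_lim_le_liminf_eLpNorm (fun i => (hsm.mul ((hΦ k).sub (hΦ _))).mul hΓ) _
    hpt).trans (liminf_le_of_frequently_le' (Eventually.frequently ?_))
  filter_upwards [hmono.tendsto_atTop.eventually_ge_atTop N] with i hi
  exact hN k hk _ hi

/-! ### Approximation by functions supported away from the characteristic manifold -/

lemma rpow_sub_one_mul_abs {y : ℝ} (hy : y ≠ 0) (β : ℝ) : |y| ^ (β - 1) * |y| = |y| ^ β := by
  rw [← Real.rpow_add_one (abs_ne_zero.2 hy), sub_add_cancel]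

/-- If `u` is a limit of smooth functions in the weighted `H¹` norm and `u / y` is square
integrable, then `ζ u` is a limit of test functions supported away from `{y = 0}`, together with
the gradients and the quotients by `y`. -/
lemma exists_test_approx {b : ℝ} {u : Space n → ℝ} {g : Space n → Space n}
    {ψ : ℕ → Space n → ℝ} (hψ : ∀ k, ContDiffOn ℝ ∞ (ψ k) (B n 1))
    (hum : AEStronglyMeasurable u (volume.restrict (B n 1)))
    (hgm : AEStronglyMeasurable g (volume.restrict (B n 1)))
    (hu2 : MemLp (fun z => |yc z| ^ (b / 2) • u z) 2 (volume.restrict (B n 1)))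
    (hg2 : MemLp (fun z => |yc z| ^ (b / 2) • g z) 2 (volume.restrict (B n 1)))
    (hu : Tendsto (fun k => eLpNorm (fun z => |yc z| ^ (b / 2) • (ψ k z - u z)) 2
      (volume.restrict (B n 1))) atTop (𝓝 0))
    (hg : Tendsto (fun k => eLpNorm (fun z => |yc z| ^ (b / 2) • (gradient (ψ k) z - g z)) 2
      (volume.restrict (B n 1))) atTop (𝓝 0))
    (hy : MemLp (fun z => |yc z| ^ (b / 2 - 1) * u z) 2 (volume.restrict (B n 1)))
    {ζ : Space n → ℝ} (hζ : IsTest (B n 1) ζ) :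
    ∃ Φ : ℕ → Space n → ℝ, (∀ k, IsTest (B n 1 \ charSet n) (Φ k)) ∧
      Tendsto (fun k => eLpNorm (fun z => |yc z| ^ (b / 2) * (Φ k z - ζ z * u z)) 2
        (volume.restrict (B n 1))) atTop (𝓝 0) ∧
      Tendsto (fun k => eLpNorm (fun z => |yc z| ^ (b / 2) • (gradient (Φ k) z -
        (ζ z • g z + u z • gradient ζ z))) 2 (volume.restrict (B n 1))) atTop (𝓝 0) ∧
      Tendsto (fun k => eLpNorm (fun z => |yc z| ^ (b / 2 - 1) * (Φ k z - ζ z * u z)) 2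
        (volume.restrict (B n 1))) atTop (𝓝 0) := by
  set m := (volume : Measure (Space n)).restrict (B n 1) with hm
  obtain ⟨M, hM, hMζ⟩ := hζ.exists_bound
  obtain ⟨C, hC, hCη⟩ := exists_gradient_cutoff_le (n := n)
  have hpm : ∀ β : ℝ, AEStronglyMeasurable (fun z : Space n => |yc z| ^ β) m := fun β =>
    (measurable_pow_yc β).aestronglyMeasurable
  have hζm : AEStronglyMeasurable ζ m := hζ.1.continuous.aestronglyMeasurable
  have hζgm : AEStronglyMeasurable (gradient ζ) m := (measurable_gradient ζ).aestronglyMeasurable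
  have hηm : ∀ j, AEStronglyMeasurable (cutoff (n := n) j) m := fun j =>
    (contDiff_cutoff j).continuous.aestronglyMeasurable
  have hηgm : ∀ j, AEStronglyMeasurable (gradient (cutoff (n := n) j)) m := fun j =>
    (measurable_gradient _).aestronglyMeasurable
  have hψm : ∀ k, AEStronglyMeasurable (ψ k) m := fun k =>
    (hψ k).continuousOn.aestronglyMeasurable Metric.isOpen_ball.measurableSet
  have hψgm : ∀ k, AEStronglyMeasurable (gradient (ψ k)) m := fun k =>
    (measurable_gradient _).aestronglyMeasurable
  let Φ : ℕ → ℕ → Space n → ℝ := fun j k z => ζ z * cutoff j z * ψ k z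
  have hΦt : ∀ j k, IsTest (B n 1 \ charSet n) (Φ j k) := fun j k =>
    (hζ.mul_cutoff j).mul_contDiffOn isOpen_ball_diff ((hψ k).mono sdiff_subset)
  let T : ℕ → Space n → ℝ := fun j z => ζ z * cutoff j z * u z
  let D : ℕ → Space n → Space n := fun j z =>
    (ζ z * cutoff j z) • g z + u z • (cutoff j z • gradient ζ z + ζ z • gradient (cutoff j) z)
  have hTm : ∀ j, AEStronglyMeasurable (T j) m := fun j => (hζm.mul (hηm j)).mul hum
  have hDm : ∀ j, AEStronglyMeasurable (D j) m := fun j =>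
    ((hζm.mul (hηm j)).smul hgm).add
      (hum.smul (((hηm j).smul hζgm).add (hζm.smul (hηgm j))))
  have hD0m : AEStronglyMeasurable (fun z => ζ z • g z + u z • gradient ζ z) m :=
    (hζm.smul hgm).add (hum.smul hζgm)
  -- For fixed j the cutoff and its gradient vanish where j|y| < 1, so negative powers of |y| cost
  -- only constants depending on j. This suffices for the limit k → ∞ at fixed j.
  have hηy : ∀ (j : ℕ) (z : Space n), yc z ≠ 0 → |cutoff j z| ≤ j * |yc z| := by
    intro j z hz
    rcases le_or_gt ((j : ℝ) * |yc z|) 1 with h | h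
    · rw [cutoff_eq_zero h, abs_zero]; positivity
    · exact (abs_cutoff_le j z).trans h.le
  have hηg : ∀ (j : ℕ) (z : Space n), yc z ≠ 0 → ‖gradient (cutoff j) z‖ ≤ C * j := by
    intro j z hz
    rcases lt_or_ge ((j : ℝ) * |yc z|) 1 with h | h
    · rw [gradient_cutoff_eq_zero_of_lt h, norm_zero]; positivity
    · calc ‖gradient (cutoff j) z‖ ≤ ‖gradient (cutoff j) z‖ * (j * |yc z|) :=
            le_mul_of_one_le_right (norm_nonneg _) h
        _ = ‖gradient (cutoff j) z‖ * |yc z| * j := by ring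
        _ ≤ C * j := by gcongr; exact hCη j z
  have hζη : ∀ (j : ℕ) (z : Space n), |ζ z * cutoff j z| ≤ M := fun j z => by
    rw [abs_mul]
    exact (mul_le_mul (hMζ z).1 (abs_cutoff_le j z) (abs_nonneg _) hM.le).trans (mul_one M).le
  -- convergence as `k → ∞`
  have hk1 : ∀ j, Tendsto (fun k => eLpNorm (fun z => |yc z| ^ (b / 2) * Φ j k z -
      |yc z| ^ (b / 2) * T j z) 2 m) atTop (𝓝 0) := fun j => by
    refine tendsto_eLpNorm_of_bound M hu fun k => ae_of_all _ fun z => ?_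
    have e : |yc z| ^ (b / 2) * Φ j k z - |yc z| ^ (b / 2) * T j z =
        (ζ z * cutoff j z) * (|yc z| ^ (b / 2) • (ψ k z - u z)) := by
      simp only [Φ, T, smul_eq_mul]; ring
    rw [e, norm_mul]
    gcongr
    exact hζη j z
  have hk2 : ∀ j, Tendsto (fun k => eLpNorm (fun z => |yc z| ^ (b / 2) • gradient (Φ j k) z -
      |yc z| ^ (b / 2) • D j z) 2 m) atTop (𝓝 0) := fun j => by
    refine tendsto_eLpNorm_of_bound_add (C := M) (C' := M + M * (C * j)) hM.le (by positivity)
      (g := fun k z => |yc z| ^ (b / 2) • (gradient (ψ k) z - g z))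
      (h := fun k z => |yc z| ^ (b / 2) • (ψ k z - u z))
      (fun k => (hpm _).smul ((hψgm k).sub hgm)) (fun k => (hpm _).smul ((hψm k).sub hum)) hg hu
      fun k => ?_
    filter_upwards [ae_restrict_ball] with z hz
    have hd1 : DifferentiableAt ℝ ζ z := hζ.1.differentiable (by simp) z
    have hd2 : DifferentiableAt ℝ (cutoff (n := n) j) z :=
      (contDiff_cutoff j).differentiable (by simp) z
    have hd3 : DifferentiableAt ℝ (ψ k) z :=
      ((hψ k).contDiffAt (Metric.isOpen_ball.mem_nhds hz.1)).differentiableAt (by simp)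
    have e : |yc z| ^ (b / 2) • gradient (Φ j k) z - |yc z| ^ (b / 2) • D j z =
        (ζ z * cutoff j z) • (|yc z| ^ (b / 2) • (gradient (ψ k) z - g z)) +
        (|yc z| ^ (b / 2) • (ψ k z - u z)) •
          (cutoff j z • gradient ζ z + ζ z • gradient (cutoff j) z) := by
      simp only [Φ, D]
      rw [gradient_mul (hd1.fun_mul hd2) hd3, gradient_mul hd1 hd2]
      simp only [smul_eq_mul]
      module
    rw [e]
    refine (norm_add_le _ _).trans (add_le_add ?_ ?_)
    · rw [norm_smul]; gcongr; exact hζη j z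
    · rw [norm_smul, mul_comm]
      gcongr
      refine (norm_add_le _ _).trans (add_le_add ?_ ?_)
      · rw [norm_smul]
        exact (mul_le_mul (abs_cutoff_le j z) (hMζ z).2 (norm_nonneg _) zero_le_one).trans
          (one_mul M).le
      · rw [norm_smul]
        exact mul_le_mul (hMζ z).1 (hηg j z hz.2) (norm_nonneg _) hM.le
  have hk3 : ∀ j, Tendsto (fun k => eLpNorm (fun z => |yc z| ^ (b / 2 - 1) * Φ j k z -
      |yc z| ^ (b / 2 - 1) * T j z) 2 m) atTop (𝓝 0) := fun j => by
    refine tendsto_eLpNorm_of_bound (M * j) hu fun k => ?_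
    filter_upwards [ae_restrict_ball] with z hz
    have e : |yc z| ^ (b / 2 - 1) * Φ j k z - |yc z| ^ (b / 2 - 1) * T j z =
        (ζ z * cutoff j z) * (|yc z| ^ (b / 2 - 1) * (ψ k z - u z)) := by
      simp only [Φ, T]; ring
    have q1 : ‖|yc z| ^ (b / 2 - 1)‖ = |yc z| ^ (b / 2 - 1) := Real.norm_of_nonneg (by positivity)
    have q2 : ‖|yc z| ^ (b / 2)‖ = |yc z| ^ (b / 2) := Real.norm_of_nonneg (by positivity)
    rw [e, norm_mul, norm_mul, norm_mul, norm_smul, q1, q2,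
      ← rpow_sub_one_mul_abs hz.2 (b / 2)]
    calc ‖ζ z‖ * ‖cutoff j z‖ * (|yc z| ^ (b / 2 - 1) * ‖ψ k z - u z‖)
        ≤ M * (j * |yc z|) * (|yc z| ^ (b / 2 - 1) * ‖ψ k z - u z‖) := by
          gcongr
          · exact (hMζ z).1
          · exact hηy j z hz.2
      _ = _ := by ring
  -- convergence as `j → ∞`
  have hj1 : Tendsto (fun j => eLpNorm (fun z => |yc z| ^ (b / 2) * T j z -
      |yc z| ^ (b / 2) * (ζ z * u z)) 2 m) atTop (𝓝 0) := by
    refine tendsto_eLpNorm_smul_of_bounded hu2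
      (fun j => ((hpm _).mul (hTm j)).sub ((hpm _).mul (hζm.mul hum))) (M * 2) (fun j => ?_) ?_
    · refine ae_of_all _ fun z => ?_
      have e : |yc z| ^ (b / 2) * T j z - |yc z| ^ (b / 2) * (ζ z * u z) =
          ζ z * (cutoff j z - 1) * (|yc z| ^ (b / 2) • u z) := by
        simp only [T, smul_eq_mul]; ring
      rw [e, norm_mul, norm_mul]
      gcongr
      · exact (hMζ z).1
      · refine (norm_sub_le _ _).trans ?_
        have := abs_cutoff_le j z
        rw [norm_one, Real.norm_eq_abs]; linarith
    · filter_upwards [ae_restrict_ball] with z hz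
      refine tendsto_const_nhds.congr' ?_
      filter_upwards [eventually_cutoff_eq_one hz.2] with j hj
      simp [T, hj]
  have hj3 : Tendsto (fun j => eLpNorm (fun z => |yc z| ^ (b / 2 - 1) * T j z -
      |yc z| ^ (b / 2 - 1) * (ζ z * u z)) 2 m) atTop (𝓝 0) := by
    refine tendsto_eLpNorm_smul_of_bounded hy
      (fun j => ((hpm _).mul (hTm j)).sub ((hpm _).mul (hζm.mul hum))) (M * 2) (fun j => ?_) ?_
    · refine ae_of_all _ fun z => ?_
      have e : |yc z| ^ (b / 2 - 1) * T j z - |yc z| ^ (b / 2 - 1) * (ζ z * u z) =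
          ζ z * (cutoff j z - 1) * (|yc z| ^ (b / 2 - 1) * u z) := by
        simp only [T]; ring
      rw [e, norm_mul, norm_mul]
      gcongr
      · exact (hMζ z).1
      · refine (norm_sub_le _ _).trans ?_
        have := abs_cutoff_le j z
        rw [norm_one, Real.norm_eq_abs]; linarith
    · filter_upwards [ae_restrict_ball] with z hz
      refine tendsto_const_nhds.congr' ?_
      filter_upwards [eventually_cutoff_eq_one hz.2] with j hj
      simp [T, hj]
  -- The dangerous term is ζ u ∇η_j, bounded by a multiple of |u|/|y|. That is square integrable for
  -- the weight by hypothesis, and the term is eventually zero at every point off Σ, so dominated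
  -- convergence applies.
  have hj2 : Tendsto (fun j => eLpNorm (fun z => |yc z| ^ (b / 2) • D j z -
      |yc z| ^ (b / 2) • (ζ z • g z + u z • gradient ζ z)) 2 m) atTop (𝓝 0) := by
    have hF : MemLp (fun z => ‖|yc z| ^ (b / 2) • g z‖ + ‖|yc z| ^ (b / 2) • u z‖ +
        ‖|yc z| ^ (b / 2 - 1) * u z‖) 2 m := (hg2.norm.add hu2.norm).add hy.norm
    refine tendsto_zero_of_le_mul ENNReal.one_ne_top (g := fun j => eLpNorm (fun z =>
      ‖|yc z| ^ (b / 2) • D j z - |yc z| ^ (b / 2) • (ζ z • g z + u z • gradient ζ z)‖) 2 m) ?_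
      fun j => by rw [eLpNorm_norm, one_mul]
    refine tendsto_eLpNorm_smul_of_bounded hF
      (fun j => (((hpm _).smul (hDm j)).sub ((hpm _).smul hD0m)).norm) (M * (2 + C)) (fun j => ?_) ?_
    · filter_upwards [ae_restrict_ball] with z hz
      have e : |yc z| ^ (b / 2) • D j z - |yc z| ^ (b / 2) • (ζ z • g z + u z • gradient ζ z) =
          (ζ z * (cutoff j z - 1)) • (|yc z| ^ (b / 2) • g z) +
          ((cutoff j z - 1) * (|yc z| ^ (b / 2) • u z)) • gradient ζ z +
          (ζ z * (|yc z| ^ (b / 2 - 1) * u z)) • (|yc z| • gradient (cutoff j) z) := by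
        simp only [D, smul_eq_mul]
        rw [← rpow_sub_one_mul_abs hz.2 (b / 2)]
        module
      have h2 : ‖cutoff j z - 1‖ ≤ 2 := by
        refine (norm_sub_le _ _).trans ?_
        have := abs_cutoff_le j z
        rw [norm_one, Real.norm_eq_abs]; linarith
      rw [norm_norm, e]
      have n1 : ‖(ζ z * (cutoff j z - 1)) • (|yc z| ^ (b / 2) • g z)‖ ≤
          M * 2 * ‖|yc z| ^ (b / 2) • g z‖ := by
        rw [norm_smul, norm_mul]; gcongr; exact (hMζ z).1
      have n2 : ‖((cutoff j z - 1) * (|yc z| ^ (b / 2) • u z)) • gradient ζ z‖ ≤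
          2 * ‖|yc z| ^ (b / 2) • u z‖ * M := by
        rw [norm_smul, norm_mul]; gcongr; exact (hMζ z).2
      have n3 : ‖(ζ z * (|yc z| ^ (b / 2 - 1) * u z)) • (|yc z| • gradient (cutoff j) z)‖ ≤
          M * ‖|yc z| ^ (b / 2 - 1) * u z‖ * C := by
        rw [norm_smul, norm_mul (ζ z), norm_smul, norm_abs_eq_norm, mul_comm ‖yc z‖]
        gcongr
        · exact (hMζ z).1
        · exact hCη j z
      refine (norm_add₃_le).trans ((add_le_add (add_le_add n1 n2) n3).trans ?_)
      refine le_trans ?_ (mul_le_mul_of_nonneg_left (Real.le_norm_self _) (by positivity))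
      have p1 := mul_nonneg (mul_nonneg hM.le hC.le) (norm_nonneg (|yc z| ^ (b / 2) • g z))
      have p2 := mul_nonneg (mul_nonneg hM.le hC.le) (norm_nonneg (|yc z| ^ (b / 2) • u z))
      have p3 := mul_nonneg hM.le (norm_nonneg (|yc z| ^ (b / 2 - 1) * u z))
      nlinarith
    · filter_upwards [ae_restrict_ball] with z hz
      refine tendsto_const_nhds.congr' ?_
      filter_upwards [eventually_cutoff_eq_one hz.2, eventually_gradient_cutoff_eq_zero hz.2]
        with j hj hj'
      simp [D, hj, hj']
  -- the diagonal sequence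
  have hex : ∀ i : ℕ, ∃ j k,
      eLpNorm (fun z => |yc z| ^ (b / 2) * (Φ j k z - ζ z * u z)) 2 m ≤ ((i : ℝ≥0∞) + 1)⁻¹ ∧
      eLpNorm (fun z => |yc z| ^ (b / 2) • (gradient (Φ j k) z -
        (ζ z • g z + u z • gradient ζ z))) 2 m ≤ ((i : ℝ≥0∞) + 1)⁻¹ ∧
      eLpNorm (fun z => |yc z| ^ (b / 2 - 1) * (Φ j k z - ζ z * u z)) 2 m ≤
        ((i : ℝ≥0∞) + 1)⁻¹ := by
    intro i
    have hδ : 0 < ((i : ℝ≥0∞) + 1)⁻¹ / 2 := by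
      refine ENNReal.div_pos (ENNReal.inv_ne_zero.2 (by finiteness)) (by norm_num)
    obtain ⟨j, h1, h2, h3⟩ := ((ENNReal.tendsto_nhds_zero.1 hj1 _ hδ).and
      ((ENNReal.tendsto_nhds_zero.1 hj2 _ hδ).and (ENNReal.tendsto_nhds_zero.1 hj3 _ hδ))).exists
    obtain ⟨k, h4, h5, h6⟩ := ((ENNReal.tendsto_nhds_zero.1 (hk1 j) _ hδ).and
      ((ENNReal.tendsto_nhds_zero.1 (hk2 j) _ hδ).and
        (ENNReal.tendsto_nhds_zero.1 (hk3 j) _ hδ))).exists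
    have hΦm : AEStronglyMeasurable (Φ j k) m := (hΦt j k).1.continuous.aestronglyMeasurable
    have hΦgm : AEStronglyMeasurable (gradient (Φ j k)) m :=
      (measurable_gradient _).aestronglyMeasurable
    refine ⟨j, k, ?_, ?_, ?_⟩
    · simp_rw [mul_sub]
      refine (eLpNorm_le_add_of_sub ((hpm _).mul hΦm) ((hpm _).mul (hTm j))
        ((hpm _).mul (hζm.mul hum))).trans ((add_le_add h4 h1).trans (ENNReal.add_halves _).le)
    · simp_rw [smul_sub]
      refine (eLpNorm_le_add_of_sub ((hpm _).smul hΦgm) ((hpm _).smul (hDm j))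
        ((hpm _).smul hD0m)).trans ((add_le_add h5 h2).trans (ENNReal.add_halves _).le)
    · simp_rw [mul_sub]
      refine (eLpNorm_le_add_of_sub ((hpm _).mul hΦm) ((hpm _).mul (hTm j))
        ((hpm _).mul (hζm.mul hum))).trans ((add_le_add h6 h3).trans (ENNReal.add_halves _).le)
  choose J K h1 h2 h3 using hex
  have hi : Tendsto (fun i : ℕ => ((i : ℝ≥0∞) + 1)⁻¹) atTop (𝓝 0) := by
    have := ENNReal.tendsto_inv_nat_nhds_zero.comp (tendsto_add_atTop_nat 1)
    simpa [Function.comp_def] using this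
  exact ⟨fun i => Φ (J i) (K i), fun i => hΦt _ _,
    tendsto_of_tendsto_of_tendsto_of_le_of_le tendsto_const_nhds hi (fun _ => zero_le) h1,
    tendsto_of_tendsto_of_tendsto_of_le_of_le tendsto_const_nhds hi (fun _ => zero_le) h2,
    tendsto_of_tendsto_of_tendsto_of_le_of_le tendsto_const_nhds hi (fun _ => zero_le) h3⟩

/-! ### The weight `ρ` -/

/-- The exponent `b` such that `ρ_ε^a` is comparable to `|y|^b` near `y = 0`. -/
noncomputable def wExp (ε a : ℝ) : ℝ := if ε = 0 then a else 0

lemma wExp_neg (ε a : ℝ) : wExp ε (-a) = -wExp ε a := by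
  unfold wExp; split_ifs <;> simp

lemma wExp_lt_one {a : ℝ} (ha : a < 1) (ε : ℝ) : wExp ε a < 1 := by
  unfold wExp; split_ifs <;> linarith

lemma rho_reflect (ε a y : ℝ) : rho ε a (-y) = rho ε a y := by simp [rho]

lemma rho_pos {ε : ℝ} (hε : 0 ≤ ε) (a : ℝ) {y : ℝ} (hy : y ≠ 0) : 0 < rho ε a y := by
  unfold rho
  split_ifs with h h'
  · exact Real.rpow_pos_of_pos (abs_pos.2 hy) _
  all_goals
    have hε' : 0 < ε := lt_of_le_of_ne hε (Ne.symm h)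
    positivity

/-- The two normalizing factors are exchanged by a ↦ -a: min(ε^(-a), 1) and max(ε^a, 1) are inverse
to each other. For this reason 1/ρ_ε^a is again a weight of the same family and is the integrand
defining χ and v. -/
lemma rho_neg {ε : ℝ} (hε : 0 ≤ ε) (a : ℝ) {y : ℝ} (hy : y ≠ 0) :
    rho ε (-a) y = (rho ε a y)⁻¹ := by
  rcases hε.eq_or_lt with rfl | hε'
  · simp [rho, Real.rpow_neg (abs_nonneg y)]
  have hq : 0 < ε ^ 2 + y ^ 2 := by positivity
  have h1 : (ε ^ 2 + y ^ 2) ^ (-a / 2) = ((ε ^ 2 + y ^ 2) ^ (a / 2))⁻¹ := by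
    rw [neg_div, Real.rpow_neg hq.le]
  have hp : 0 < ε ^ a := Real.rpow_pos_of_pos hε' a
  have e0 : ε ^ (-a) = (ε ^ a)⁻¹ := Real.rpow_neg hε a
  have h2 : max (ε ^ a) 1 = (min (ε ^ (-a)) 1)⁻¹ := by
    rw [e0]
    rcases le_total (ε ^ a) 1 with h | h
    · rw [max_eq_right h, min_eq_right ((one_le_inv₀ hp).2 h), inv_one]
    · rw [max_eq_left h, min_eq_left (inv_le_one_of_one_le₀ h), inv_inv]
  have h3 : min (ε ^ a) 1 = (max (ε ^ (-a)) 1)⁻¹ := by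
    rw [e0]
    rcases le_total (ε ^ a) 1 with h | h
    · rw [min_eq_left h, max_eq_left ((one_le_inv₀ hp).2 h), inv_inv]
    · rw [min_eq_right h, max_eq_right (inv_le_one_of_one_le₀ h), inv_one]
  rcases lt_trichotomy a 0 with ha | rfl | ha
  · rw [rho, rho, if_neg hε'.ne', if_neg hε'.ne', if_pos (by linarith), if_neg (by linarith), h1,
      neg_neg, h3, mul_inv]
  · simp [rho, hε'.ne']
  · rw [rho, rho, if_neg hε'.ne', if_neg hε'.ne', if_neg (by linarith), if_pos ha.le, h1,
      neg_neg, h2, mul_inv]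

lemma continuousAt_rho {ε : ℝ} (hε : 0 ≤ ε) (a : ℝ) {y : ℝ} (hy : ε ≠ 0 ∨ y ≠ 0) :
    ContinuousAt (rho ε a) y := by
  unfold rho
  split_ifs with h h'
  · exact continuous_abs.continuousAt.rpow_const (Or.inl (abs_ne_zero.2 (hy.resolve_left (by simp [h]))))
  all_goals
    refine ContinuousAt.mul (ContinuousAt.rpow_const (by fun_prop) (Or.inl ?_)) continuousAt_const
    have hε' : 0 < ε := lt_of_le_of_ne hε (Ne.symm h)
    positivity

lemma measurable_rho (ε a : ℝ) : Measurable (rho ε a) := by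
  unfold rho
  split_ifs with h h'
  · exact (measurable_id.abs).pow_const _
  all_goals exact ((measurable_const.add (measurable_id.pow_const 2)).pow_const _).mul_const _

/-- For ε > 0 the weight is continuous and positive on [-1, 1], hence comparable to a constant. The
constants depend on ε, which is harmless because ε is fixed. -/
lemma exists_rho_bounds {ε : ℝ} (hε : 0 ≤ ε) (a : ℝ) : ∃ c C : ℝ, 0 < c ∧ 0 < C ∧
    ∀ y, y ≠ 0 → |y| ≤ 1 → c * |y| ^ wExp ε a ≤ rho ε a y ∧ rho ε a y ≤ C * |y| ^ wExp ε a := by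
  rcases hε.eq_or_lt with rfl | hε'
  · exact ⟨1, 1, one_pos, one_pos, fun y _ _ => by simp [rho, wExp]⟩
  · have hc : ContinuousOn (rho ε a) (Icc (-1) 1) := fun y _ =>
      (continuousAt_rho hε a (Or.inl hε'.ne')).continuousWithinAt
    have hpos : ∀ y, 0 < rho ε a y := fun y => by
      unfold rho
      rw [if_neg hε'.ne']
      split_ifs <;> positivity
    obtain ⟨y1, -, h1⟩ := isCompact_Icc.exists_isMinOn (nonempty_Icc.2 (by norm_num)) hc
    obtain ⟨y2, -, h2⟩ := isCompact_Icc.exists_isMaxOn (nonempty_Icc.2 (by norm_num)) hc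
    refine ⟨rho ε a y1, rho ε a y2, hpos _, hpos _, fun y _ hy => ?_⟩
    simp only [wExp, if_neg hε'.ne', Real.rpow_zero, mul_one]
    exact ⟨h1 (abs_le.1 hy), h2 (abs_le.1 hy)⟩

lemma comparable_rho {ε : ℝ} (hε : 0 ≤ ε) (a : ℝ) :
    Comparable (fun z : Space n => rho ε a (yc z)) (B n 1) (wExp ε a) := by
  obtain ⟨c, C, hc, hC, h⟩ := exists_rho_bounds hε a
  exact ⟨c, C, hc, hC, fun z hz hy => h _ hy (abs_yc_lt hz).le⟩

/-! ### Integrals of functions comparable to a power -/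

lemma intervalIntegrable_rpow_abs {β : ℝ} (hβ : -1 < β) (c d : ℝ) :
    IntervalIntegrable (fun s : ℝ => |s| ^ β) volume c d := by
  have h0 : ∀ y : ℝ, 0 ≤ y → IntervalIntegrable (fun s : ℝ => |s| ^ β) volume 0 y := fun y hy =>
    (intervalIntegral.intervalIntegrable_rpow' hβ).congr (by
      rw [uIoc_of_le hy]
      intro s hs
      simp [abs_of_pos hs.1])
  have h1 : ∀ y : ℝ, IntervalIntegrable (fun s : ℝ => |s| ^ β) volume 0 y := fun y => by
    rcases le_total 0 y with hy | hy
    · exact h0 y hy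
    · have := (IntervalIntegrable.iff_comp_neg).1 (h0 (-y) (by linarith))
      simpa using this
  exact (h1 c).symm.trans (h1 d)

lemma abs_integral_bounds_of_pos {β c C y : ℝ} (hβ : -1 < β) (hc : 0 ≤ c) (hy : 0 < y) {k : ℝ → ℝ}
    (hk : IntervalIntegrable k volume 0 y)
    (hb : ∀ s, 0 < s → s ≤ y → c * s ^ β ≤ k s ∧ k s ≤ C * s ^ β) :
    c / (β + 1) * y ^ (β + 1) ≤ |∫ s in (0 : ℝ)..y, k s| ∧
      |∫ s in (0 : ℝ)..y, k s| ≤ C / (β + 1) * y ^ (β + 1) := by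
  have hi : ∀ C : ℝ, IntervalIntegrable (fun s : ℝ => C * s ^ β) volume 0 y := fun C =>
    (intervalIntegral.intervalIntegrable_rpow' hβ).const_mul C
  have hI : ∀ C : ℝ, ∫ s in (0 : ℝ)..y, C * s ^ β = C / (β + 1) * y ^ (β + 1) := fun C => by
    rw [intervalIntegral.integral_const_mul, integral_rpow (Or.inl hβ),
      Real.zero_rpow (by linarith)]
    ring
  have h1 := intervalIntegral.integral_mono_on_of_le_Ioo hy.le (hi c) hk
    fun s hs => (hb s hs.1 hs.2.le).1
  have h2 := intervalIntegral.integral_mono_on_of_le_Ioo hy.le hk (hi C)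
    fun s hs => (hb s hs.1 hs.2.le).2
  rw [hI] at h1 h2
  have h0 : 0 ≤ c / (β + 1) * y ^ (β + 1) :=
    mul_nonneg (div_nonneg hc (by linarith)) (by positivity)
  rw [abs_of_nonneg (h0.trans h1)]
  exact ⟨h1, h2⟩

lemma abs_integral_bounds {β c C y : ℝ} (hβ : -1 < β) (hc : 0 ≤ c) (hy : y ≠ 0) {k : ℝ → ℝ}
    (hk : IntervalIntegrable k volume 0 y)
    (hb : ∀ s, s ≠ 0 → |s| ≤ |y| → c * |s| ^ β ≤ k s ∧ k s ≤ C * |s| ^ β) :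
    c / (β + 1) * |y| ^ (β + 1) ≤ |∫ s in (0 : ℝ)..y, k s| ∧
      |∫ s in (0 : ℝ)..y, k s| ≤ C / (β + 1) * |y| ^ (β + 1) := by
  rcases lt_or_gt_of_ne hy with h | h
  · have e : ∫ s in (0 : ℝ)..y, k s = -∫ s in (0 : ℝ)..(-y), k (-s) := by
      rw [intervalIntegral.integral_comp_neg, neg_neg, neg_zero, intervalIntegral.integral_symm]
    rw [e, abs_neg, abs_of_neg h]
    refine abs_integral_bounds_of_pos hβ hc (by linarith) ?_ fun s hs hsy => ?_
    · simpa using (IntervalIntegrable.iff_comp_neg).1 hk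
    · have := hb (-s) (by linarith : -s < 0).ne (by
        rw [abs_neg, abs_of_pos hs, abs_of_neg h]; exact hsy)
      rwa [abs_neg, abs_of_pos hs] at this
  · rw [abs_of_pos h]
    refine abs_integral_bounds_of_pos hβ hc h hk fun s hs hsy => ?_
    have := hb s hs.ne' (by rw [abs_of_pos hs, abs_of_pos h]; exact hsy)
    rwa [abs_of_pos hs] at this

lemma intervalIntegrable_of_le_rpow {β C y : ℝ} (hβ : -1 < β) {k : ℝ → ℝ}
    (hk : AEStronglyMeasurable k (volume.restrict (uIoc 0 y)))
    (hb : ∀ s, s ≠ 0 → |s| ≤ |y| → |k s| ≤ C * |s| ^ β) :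
    IntervalIntegrable k volume 0 y := by
  refine ((intervalIntegrable_rpow_abs hβ 0 y).const_mul C).mono_fun hk ?_
  have h0 : ∀ᵐ s ∂(volume.restrict (uIoc 0 y)), s ≠ 0 :=
    ae_restrict_of_ae (by simp [ae_iff, measure_singleton])
  filter_upwards [h0, ae_restrict_mem measurableSet_uIoc] with s hs hs'
  refine (hb s hs ?_).trans (Real.le_norm_self _)
  rcases le_total 0 y with h | h
  · rw [uIoc_of_le h] at hs'
    rw [abs_of_pos hs'.1, abs_of_nonneg h]; exact hs'.2
  · rw [uIoc_of_ge h] at hs'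
    rw [abs_of_nonpos hs'.2, abs_of_nonpos h]; linarith [hs'.1]

/-! ### The weight `ω` -/

lemma intervalIntegrable_rho {ε a : ℝ} (hε : 0 ≤ ε) (ha : a < 1) (c d : ℝ) :
    IntervalIntegrable (rho ε (-a)) volume c d := by
  rcases hε.eq_or_lt with rfl | hε'
  · have : rho 0 (-a) = fun s => |s| ^ (-a) := by ext1 s; simp [rho]
    rw [this]
    exact intervalIntegrable_rpow_abs (by linarith) c d
  · exact (continuous_iff_continuousAt.2
      fun y => continuousAt_rho hε (-a) (Or.inl hε'.ne')).intervalIntegrable c d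

lemma measurable_omega {ε a : ℝ} (hε : 0 ≤ ε) (ha : a < 1) : Measurable (omega ε a) := by
  have h : Continuous (chi ε a) :=
    intervalIntegral.continuous_primitive (intervalIntegrable_rho hε ha) 0
  exact ((measurable_rho ε a).mul_const _).mul (h.measurable.pow_const 2)

/-- Exponent count b + 2(1 - b) = 2 - b. It covers both ω, with f = (1-a)χ, and ρv², with f = v, so
the two weights are comparable. -/
lemma comparable_mul_sq {ε a : ℝ} (hε : 0 ≤ ε) {f : Space n → ℝ}
    (hf : Comparable (fun z => |f z|) (B n 1) (1 - wExp ε a)) :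
    Comparable (fun z => rho ε a (yc z) * f z ^ 2) (B n 1) (2 - wExp ε a) := by
  obtain ⟨c, C, hc, hC, h⟩ := comparable_rho (n := n) hε a
  obtain ⟨c', C', hc', hC', h'⟩ := hf
  refine ⟨c * c' ^ 2, C * C' ^ 2, by positivity, by positivity, fun z hz hy => ?_⟩
  have hy' : 0 < |yc z| := abs_pos.2 hy
  have e : |yc z| ^ (2 - wExp ε a) =
      |yc z| ^ wExp ε a * (|yc z| ^ (1 - wExp ε a)) ^ 2 := by
    rw [← Real.rpow_natCast, ← Real.rpow_mul hy'.le, ← Real.rpow_add hy']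
    congr 1; push_cast; ring
  have h1 := h z hz hy
  have h2 := h' z hz hy
  beta_reduce at h1 h2 ⊢
  rw [e, ← sq_abs (f z)]
  constructor
  · calc c * c' ^ 2 * (|yc z| ^ wExp ε a * (|yc z| ^ (1 - wExp ε a)) ^ 2)
        = (c * |yc z| ^ wExp ε a) * (c' * |yc z| ^ (1 - wExp ε a)) ^ 2 := by ring
      _ ≤ _ := by
        gcongr
        · exact (rho_pos hε a hy).le
        · exact h1.1
        · exact h2.1
  · have h3 : rho ε a (yc z) * |f z| ^ 2 ≤
        (C * |yc z| ^ wExp ε a) * (C' * |yc z| ^ (1 - wExp ε a)) ^ 2 :=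
      mul_le_mul h1.2 (pow_le_pow_left₀ (abs_nonneg _) h2.2 2) (by positivity) (by positivity)
    exact h3.trans_eq (by ring)

lemma comparable_chi {ε a : ℝ} (hε : 0 ≤ ε) (ha : a < 1) :
    Comparable (fun z : Space n => |(1 - a) * chi ε a (yc z)|) (B n 1) (1 - wExp ε a) := by
  obtain ⟨c, C, hc, hC, h⟩ := exists_rho_bounds hε (-a)
  have hb := wExp_lt_one ha ε
  have ha' : 0 < 1 - a := by linarith
  have hb' : 0 < -wExp ε a + 1 := by linarith
  refine ⟨(1 - a) * (c / (-wExp ε a + 1)), (1 - a) * (C / (-wExp ε a + 1)), by positivity,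
    by positivity, fun z hz hy => ?_⟩
  have := abs_integral_bounds (β := -wExp ε a) (by linarith) hc.le hy
    (intervalIntegrable_rho hε ha 0 (yc z)) (c := c) (C := C) fun s hs hsy => by
      rw [← wExp_neg]; exact h s hs (hsy.trans (abs_yc_lt hz).le)
  beta_reduce
  rw [abs_mul, abs_of_pos ha', mul_assoc, mul_assoc, sub_eq_neg_add 1 (wExp ε a)]
  exact ⟨mul_le_mul_of_nonneg_left this.1 ha'.le, mul_le_mul_of_nonneg_left this.2 ha'.le⟩

lemma comparable_omega {ε a : ℝ} (hε : 0 ≤ ε) (ha : a < 1) :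
    Comparable (fun z : Space n => omega ε a (yc z)) (B n 1) (2 - wExp ε a) := by
  have := comparable_mul_sq hε (comparable_chi (n := n) hε ha)
  convert this using 2 with z
  rw [omega]; ring

/-! ### The matrix -/

section Matrix

variable {A : Space n → Matrix (Fin (n + 1)) (Fin (n + 1)) ℝ}

lemma dotProduct_eq_inner (z w : Space n) : z.ofLp ⬝ᵥ w.ofLp = inner ℝ w z := by
  simp [EuclideanSpace.inner_eq_star_dotProduct]

lemma dotProduct_self_eq (z : Space n) : z.ofLp ⬝ᵥ z.ofLp = ‖z‖ ^ 2 := by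
  rw [dotProduct_eq_inner, real_inner_self_eq_norm_sq]

lemma MatrixAssumption.exists_mu_bounds (hA : MatrixAssumption A) :
    ∃ l₁ l₂ : ℝ, 0 < l₁ ∧ 0 < l₂ ∧ ∀ z ∈ B n 1, l₁ ≤ mu A z ∧ mu A z ≤ l₂ := by
  obtain ⟨l₁, l₂, h1, h12, h⟩ := hA.elliptic
  refine ⟨l₁, l₂, h1, h1.trans_le h12, fun z hz => ?_⟩
  have := h z hz (Pi.single (Fin.last n) 1)
  simpa [mu] using this

lemma MatrixAssumption.mu_pos (hA : MatrixAssumption A) {z : Space n} (hz : z ∈ B n 1) :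
    0 < mu A z := by
  obtain ⟨l₁, l₂, h1, -, h⟩ := hA.exists_mu_bounds
  exact h1.trans_le (h z hz).1

lemma continuousOn_entry (hA : MatrixAssumption A) (i j : Fin (n + 1)) :
    ContinuousOn (fun z => A z i j) (B n 1) :=
  (continuous_id.matrix_elem i j).comp_continuousOn hA.cont

lemma MatrixAssumption.continuousOn_mu (hA : MatrixAssumption A) : ContinuousOn (mu A) (B n 1) :=
  continuousOn_entry hA _ _

lemma MatrixAssumption.mu_reflect (hA : MatrixAssumption A) {z : Space n} (hz : z ∈ B n 1) :
    mu A (reflect z) = mu A z := by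
  have h := congrFun (congrFun (hA.reflection z hz) (Fin.last n)) (Fin.last n)
  simp only [matJ, Matrix.mul_diagonal, Matrix.diagonal_mul] at h
  simp only [mu, h]
  simp

/-- Diagonal entries are values of the quadratic form at unit vectors; off-diagonal ones follow by
polarization with e_i ± e_j, using symmetry. -/
lemma MatrixAssumption.exists_abs_entry_le (hA : MatrixAssumption A) :
    ∃ L : ℝ, 0 < L ∧ ∀ z ∈ B n 1, ∀ i j, |A z i j| ≤ L := by
  obtain ⟨l₁, l₂, h1, h12, h⟩ := hA.elliptic
  have hl2 : 0 < l₂ := h1.trans_le h12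
  refine ⟨l₂, hl2, fun z hz i j => ?_⟩
  have hdiag : ∀ i, |A z i i| ≤ l₂ := fun i => by
    have := h z hz (Pi.single i 1)
    simp at this
    rw [abs_of_nonneg (by linarith)]; exact this.2
  by_cases hij : i = j
  · subst hij; exact hdiag i
  have hs : A z j i = A z i j := by
    have := congrFun (congrFun (hA.symm z hz) i) j
    simpa [Matrix.transpose_apply] using this
  have hp := h z hz (Pi.single i 1 + Pi.single j 1)
  have hm := h z hz (Pi.single i 1 - Pi.single j 1)
  simp [Matrix.mulVec_add, Matrix.mulVec_sub, dotProduct_add, dotProduct_sub, hij, Ne.symm hij, hs] at hp hm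
  rw [abs_le]
  constructor <;> linarith [hp.1, hp.2, hm.1, hm.2]

lemma MatrixAssumption.exists_dotProduct_le (hA : MatrixAssumption A) :
    ∃ L : ℝ, 0 < L ∧ ∀ z ∈ B n 1, ∀ ξ η : Space n, |(A z *ᵥ ξ.ofLp) ⬝ᵥ η.ofLp| ≤ L * ‖ξ‖ * ‖η‖ := by
  obtain ⟨L, hL, h⟩ := hA.exists_abs_entry_le
  refine ⟨(n + 1) * ((n + 1) * L), by positivity, fun z hz ξ η => ?_⟩
  have h1 : ∀ i, |(A z *ᵥ ξ.ofLp) i| ≤ (n + 1) * L * ‖ξ‖ := fun i => by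
    rw [Matrix.mulVec, dotProduct]
    refine (Finset.abs_sum_le_sum_abs _ _).trans ?_
    refine (Finset.sum_le_card_nsmul _ _ (L * ‖ξ‖) fun j _ => ?_).trans (le_of_eq ?_)
    · rw [abs_mul]
      exact mul_le_mul (h z hz i j) (PiLp.norm_apply_le ξ j) (abs_nonneg _) hL.le
    · simp; ring
  rw [dotProduct]
  refine (Finset.abs_sum_le_sum_abs _ _).trans ?_
  refine (Finset.sum_le_card_nsmul _ _ ((n + 1) * L * ‖ξ‖ * ‖η‖) fun j _ => ?_).trans (le_of_eq ?_)
  · rw [abs_mul]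
    exact mul_le_mul (h1 j) (PiLp.norm_apply_le η j) (abs_nonneg _) (by positivity)
  · simp; ring

lemma MatrixAssumption.dotProduct_comm (hA : MatrixAssumption A) {z : Space n} (hz : z ∈ B n 1)
    (ξ η : Fin (n + 1) → ℝ) : (A z *ᵥ ξ) ⬝ᵥ η = (A z *ᵥ η) ⬝ᵥ ξ := by
  rw [_root_.dotProduct_comm, Matrix.dotProduct_mulVec, ← Matrix.mulVec_transpose,
    (hA.symm z hz).eq]

/-! ### The characteristic odd function -/

lemma continuousOn_mu_withY (hA : MatrixAssumption A) {z : Space n} (hz : z ∈ B n 1) :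
    ContinuousOn (fun s => mu A (withY z s)) {s | |s| ≤ |yc z|} :=
  hA.continuousOn_mu.comp (continuous_withY.comp (Continuous.prodMk_right z)).continuousOn
    fun _ hs => withY_mem hz hs

lemma exists_vChar_integrand_bounds (hA : MatrixAssumption A) {ε : ℝ} (hε : 0 ≤ ε) (a : ℝ) :
    ∃ c C : ℝ, 0 < c ∧ 0 < C ∧ ∀ z ∈ B n 1, ∀ s, s ≠ 0 → |s| ≤ |yc z| →
      c * |s| ^ (-wExp ε a) ≤ rho ε (-a) s * (mu A (withY z s))⁻¹ ∧
      rho ε (-a) s * (mu A (withY z s))⁻¹ ≤ C * |s| ^ (-wExp ε a) := by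
  obtain ⟨c, C, hc, hC, h⟩ := exists_rho_bounds hε (-a)
  obtain ⟨l₁, l₂, h1, h2, hl⟩ := hA.exists_mu_bounds
  refine ⟨c * l₂⁻¹, C * l₁⁻¹, by positivity, by positivity, fun z hz s hs hsy => ?_⟩
  have hr := h s hs (hsy.trans (abs_yc_lt hz).le)
  rw [wExp_neg] at hr
  have hm := hl _ (withY_mem hz hsy)
  have hmp := hA.mu_pos (withY_mem hz hsy)
  have hrp := rho_pos hε (-a) hs
  constructor
  · calc c * l₂⁻¹ * |s| ^ (-wExp ε a) = (c * |s| ^ (-wExp ε a)) * l₂⁻¹ := by ring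
      _ ≤ _ := mul_le_mul hr.1 (inv_anti₀ hmp hm.2) (by positivity) hrp.le
  · calc rho ε (-a) s * (mu A (withY z s))⁻¹ ≤ (C * |s| ^ (-wExp ε a)) * l₁⁻¹ :=
        mul_le_mul hr.2 (inv_anti₀ h1 hm.1) (by positivity) (by positivity)
      _ = _ := by ring

lemma uIoc_subset_abs_le (y : ℝ) : uIoc 0 y ⊆ {s | |s| ≤ |y|} := fun s hs => by
  rcases le_total 0 y with h | h
  · rw [uIoc_of_le h] at hs
    rw [mem_ofPred_eq, abs_of_pos hs.1, abs_of_nonneg h]; exact hs.2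
  · rw [uIoc_of_ge h] at hs
    rw [mem_ofPred_eq, abs_of_nonpos hs.2, abs_of_nonpos h]; linarith [hs.1]

lemma intervalIntegrable_vChar (hA : MatrixAssumption A) {ε a : ℝ} (hε : 0 ≤ ε) (ha : a < 1)
    {z : Space n} (hz : z ∈ B n 1) :
    IntervalIntegrable (fun s => rho ε (-a) s * (mu A (withY z s))⁻¹) volume 0 (yc z) := by
  obtain ⟨c, C, hc, hC, h⟩ := exists_vChar_integrand_bounds hA hε a
  refine intervalIntegrable_of_le_rpow (β := -wExp ε a) (C := C)
    (by linarith [wExp_lt_one ha ε]) ?_ fun s hs hsy => ?_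
  · refine (measurable_rho ε (-a)).aestronglyMeasurable.mul ?_
    refine (((continuousOn_mu_withY hA hz).mono (uIoc_subset_abs_le _)).aestronglyMeasurable
      measurableSet_uIoc).inv₀
  · rw [abs_of_nonneg (mul_nonneg (rho_pos hε (-a) hs).le
      (inv_nonneg.2 (hA.mu_pos (withY_mem hz hsy)).le))]
    exact (h z hz s hs hsy).2

lemma comparable_vChar (hA : MatrixAssumption A) {ε a : ℝ} (hε : 0 ≤ ε) (ha : a < 1) :
    Comparable (fun z : Space n => |vChar ε a A z|) (B n 1) (1 - wExp ε a) := by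
  obtain ⟨c, C, hc, hC, h⟩ := exists_vChar_integrand_bounds hA hε a
  have hb := wExp_lt_one ha ε
  have ha' : 0 < 1 - a := by linarith
  have hb' : 0 < -wExp ε a + 1 := by linarith
  refine ⟨(1 - a) * (c / (-wExp ε a + 1)), (1 - a) * (C / (-wExp ε a + 1)), by positivity,
    by positivity, fun z hz hy => ?_⟩
  have := abs_integral_bounds (β := -wExp ε a) (by linarith) hc.le hy
    (intervalIntegrable_vChar hA hε ha hz) (c := c) (C := C) fun s hs hsy => h z hz s hs hsy
  beta_reduce
  rw [vChar, abs_mul, abs_of_pos ha', mul_assoc, mul_assoc, sub_eq_neg_add 1 (wExp ε a)]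
  exact ⟨mul_le_mul_of_nonneg_left this.1 ha'.le, mul_le_mul_of_nonneg_left this.2 ha'.le⟩

lemma vChar_ne_zero (hA : MatrixAssumption A) {ε a : ℝ} (hε : 0 ≤ ε) (ha : a < 1)
    {z : Space n} (hz : z ∈ B n 1) (hy : yc z ≠ 0) : vChar ε a A z ≠ 0 :=
  abs_pos.1 ((comparable_vChar hA hε ha).pos hz hy)

/-- Conjugation by J leaves the lower right entry unchanged, so μ is even in y. The integrand of v
is then even in s and its primitive odd. -/
lemma vChar_reflect (hA : MatrixAssumption A) (ε a : ℝ) {z : Space n} (hz : z ∈ B n 1) :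
    vChar ε a A (reflect z) = -vChar ε a A z := by
  rw [vChar, vChar, yc_reflect, ← mul_neg]
  congr 1
  have e : ∀ s, withY (reflect z) s = withY z s := fun s => withY_withY z _ s
  simp only [e]
  have h1 := intervalIntegral.integral_comp_neg (a := (0 : ℝ)) (b := yc z)
    (fun s => rho ε (-a) s * (mu A (withY z s))⁻¹)
  rw [neg_zero] at h1
  rw [intervalIntegral.integral_symm, ← h1]
  congr 1
  refine intervalIntegral.integral_congr_ae (ae_of_all _ fun s hs => ?_)
  have hm : withY z s ∈ B n 1 := withY_mem hz (uIoc_subset_abs_le _ hs)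
  have h2 := hA.mu_reflect hm
  rw [reflect, withY_withY, yc_withY] at h2
  simp only [rho_reflect, h2]

end Matrix

/-! ### Regularity of the characteristic odd function -/

section Characteristic

variable {A : Space n → Matrix (Fin (n + 1)) (Fin (n + 1)) ℝ}

lemma continuousOn_vChar (hA : MatrixAssumption A) {ε a : ℝ} (hε : 0 ≤ ε) (ha : a < 1) :
    ContinuousOn (vChar ε a A) (B n 1 \ charSet n) := by
  obtain ⟨c, C, hc, hC, h⟩ := exists_vChar_integrand_bounds hA hε a
  have hb := wExp_lt_one ha ε
  set b := wExp ε a with hbdef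
  intro z₀ hz₀
  refine ContinuousAt.continuousWithinAt ?_
  have hy₀ : yc z₀ ≠ 0 := hz₀.2
  have hy₀' : 0 < |yc z₀| := abs_pos.2 hy₀
  -- Rescaling s = yθ fixes the interval of integration, so that dominated convergence on [0, 1]
  -- gives continuity.
  have e : vChar ε a A = fun z => (1 - a) * (yc z * ∫ θ in (0 : ℝ)..1,
      rho ε (-a) (yc z * θ) * (mu A (withY z (yc z * θ)))⁻¹) := by
    ext1 z
    rw [vChar, intervalIntegral.mul_integral_comp_mul_left
      (f := fun s => rho ε (-a) s * (mu A (withY z s))⁻¹), mul_zero, mul_one]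
  rw [e]
  refine continuousAt_const.mul (continuous_yc.continuousAt.mul ?_)
  have hev : ∀ᶠ z in 𝓝 z₀, z ∈ B n 1 ∧ |yc z₀| / 2 < |yc z| :=
    (Metric.isOpen_ball.eventually_mem hz₀.1).and
      ((continuous_abs.comp continuous_yc).continuousAt.eventually (lt_mem_nhds (by
        simp only [Function.comp]; linarith)))
  have habs : ∀ z : Space n, ∀ θ ∈ uIoc (0 : ℝ) 1, |yc z * θ| ≤ |yc z| := fun z θ hθ => by
    rw [uIoc_of_le zero_le_one] at hθ
    rw [abs_mul, abs_of_pos hθ.1]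
    exact mul_le_of_le_one_right (abs_nonneg _) hθ.2
  -- Near z₀ one has |y₀|/2 < |y| < 1. The first summand bounds |y|^(-b) when b ≥ 0, and the 1
  -- bounds it when b ≤ 0.
  refine intervalIntegral.continuousAt_of_dominated_interval
    (bound := fun θ => C * ((|yc z₀| / 2) ^ (-b) + 1) * θ ^ (-b)) ?_ ?_ ?_ ?_
  · filter_upwards [hev] with z hz
    refine ((measurable_rho ε (-a)).comp (measurable_const_mul (yc z))).aestronglyMeasurable.mul ?_
    refine (ContinuousOn.aestronglyMeasurable ?_ measurableSet_uIoc).inv₀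
    exact (continuousOn_mu_withY hA hz.1).comp (continuous_const_mul (yc z)).continuousOn
      fun θ hθ => habs z θ hθ
  · filter_upwards [hev] with z hz
    refine ae_of_all _ fun θ hθ => ?_
    have hθ' := hθ
    rw [uIoc_of_le zero_le_one] at hθ'
    have hyz : 0 < |yc z| := by linarith [hz.2]
    have hyz1 := abs_yc_lt hz.1
    have hne : yc z * θ ≠ 0 := mul_ne_zero (abs_pos.1 hyz) hθ'.1.ne'
    have h1 := h z hz.1 _ hne (habs z θ hθ)
    rw [Real.norm_of_nonneg ((mul_nonneg hc.le (Real.rpow_nonneg (abs_nonneg _) _)).trans h1.1)]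
    refine h1.2.trans ?_
    rw [mul_assoc, abs_mul, abs_of_pos hθ'.1, Real.mul_rpow hyz.le hθ'.1.le]
    refine mul_le_mul_of_nonneg_left (mul_le_mul_of_nonneg_right ?_ (Real.rpow_nonneg hθ'.1.le _)) hC.le
    rcases le_total 0 b with hb0 | hb0
    · refine (Real.rpow_le_rpow_of_nonpos (by positivity) hz.2.le (by linarith)).trans ?_
      linarith
    · refine (Real.rpow_le_one hyz.le hyz1.le (by linarith)).trans ?_
      have : 0 ≤ (|yc z₀| / 2) ^ (-b) := by positivity
      linarith
  · exact (intervalIntegral.intervalIntegrable_rpow' (by linarith)).const_mul _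
  · refine ae_of_all _ fun θ hθ => ?_
    have hθ' := hθ
    rw [uIoc_of_le zero_le_one] at hθ'
    have hne : yc z₀ * θ ≠ 0 := mul_ne_zero hy₀ hθ'.1.ne'
    have hm : withY z₀ (yc z₀ * θ) ∈ B n 1 := withY_mem hz₀.1 (habs z₀ θ hθ)
    have hcy : Continuous fun z : Space n => yc z * θ := continuous_yc.mul continuous_const
    refine ContinuousAt.mul ?_ (ContinuousAt.inv₀ ?_ (hA.mu_pos hm).ne')
    · exact ContinuousAt.comp (g := rho ε (-a)) (continuousAt_rho hε (-a) (Or.inr hne))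
        hcy.continuousAt
    · have h1 : ContinuousAt (mu A) (withY z₀ (yc z₀ * θ)) :=
        hA.continuousOn_mu.continuousAt (Metric.isOpen_ball.mem_nhds hm)
      exact ContinuousAt.comp (g := mu A) (f := fun z => withY z (yc z * θ)) h1
        (continuous_withY.comp (continuous_id.prodMk hcy)).continuousAt

/-- Moving along e_y changes only the upper limit of the integral, so this is the fundamental
theorem of calculus. The matrix A is merely continuous, so this argument yields the y-derivative
only. -/
lemma hasLineDerivAt_vChar (hA : MatrixAssumption A) {ε a : ℝ} (hε : 0 ≤ ε) (ha : a < 1)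
    {z : Space n} (hz : z ∈ B n 1 \ charSet n) :
    HasLineDerivAt ℝ (vChar ε a A) ((1 - a) * (rho ε (-a) (yc z) * (mu A z)⁻¹)) z (ey n) := by
  have hy : yc z ≠ 0 := hz.2
  set U : Set ℝ := {s | s ≠ 0 ∧ withY z s ∈ B n 1} with hU
  have hcw : Continuous fun s => withY z s := continuous_withY.comp (Continuous.prodMk_right z)
  have hUo : IsOpen U := isOpen_ne.inter (Metric.isOpen_ball.preimage hcw)
  have hcont : ContinuousOn (fun s => rho ε (-a) s * (mu A (withY z s))⁻¹) U := fun s hs => by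
    refine ContinuousAt.continuousWithinAt ?_
    refine (continuousAt_rho hε (-a) (Or.inr hs.1)).mul
      (ContinuousAt.inv₀ ?_ (hA.mu_pos hs.2).ne')
    exact ContinuousAt.comp (g := mu A)
      (hA.continuousOn_mu.continuousAt (Metric.isOpen_ball.mem_nhds hs.2)) hcw.continuousAt
  have hyU : yc z ∈ U := ⟨hy, by rw [withY_self]; exact hz.1⟩
  have hd := intervalIntegral.integral_hasDerivAt_right (intervalIntegrable_vChar hA hε ha hz.1)
    (hcont.stronglyMeasurableAtFilter hUo _ hyU) (hcont.continuousAt (hUo.mem_nhds hyU))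
  rw [withY_self] at hd
  have hd' : HasDerivAt (fun u => ∫ s in (0 : ℝ)..u, rho ε (-a) s * (mu A (withY z s))⁻¹)
      (rho ε (-a) (yc z) * (mu A z)⁻¹) (yc z + 0) := by rwa [add_zero]
  have hl := (hd'.comp_const_add (yc z) 0).const_mul (1 - a)
  refine hl.congr_of_eventuallyEq (Eventually.of_forall fun t => ?_)
  simp only [vChar, withY_add_ey, yc_add, yc_smul, yc_ey, mul_one]

end Characteristic

/-! ### Weak gradients and line derivatives -/

lemma integrable_smul_of_support_subset {E : Type*} [NormedAddCommGroup E] [NormedSpace ℝ E]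
    {χ : Space n → ℝ} (hχ : Continuous χ) {K : Set (Space n)} (hK : IsCompact K)
    (hs : ∀ z, z ∉ K → χ z = 0) {D : Space n → E} (hD : IntegrableOn D K) :
    Integrable (fun z => χ z • D z) := by
  have h1 : IntegrableOn (fun z => χ z • D z) K := hD.continuousOn_smul hχ.continuousOn hK
  refine (integrableOn_iff_integrable_of_support_subset fun z hz => ?_).1 h1
  by_contra h
  exact hz (by simp [hs z h])

/-- Integration by parts against the constant function 1. -/
lemma integral_lineDeriv_eq_zero {f f' : Space n → ℝ} {v : Space n} (hf : Integrable f)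
    (hf' : Integrable f') (h : ∀ z, HasLineDerivAt ℝ f (f' z) z v) : ∫ z, f' z = 0 := by
  have := integral_bilinear_hasLineDerivAt_right_eq_neg_left_of_integrable
    (μ := (volume : Measure (Space n))) (f := fun _ => (1 : ℝ)) (f' := fun _ => 0) (g := f)
    (g' := f') (v := v) (B := ContinuousLinearMap.mul ℝ ℝ) (by simp) (by simpa using hf')
    (by simpa using hf) (fun z _ => by simpa [HasLineDerivAt] using hasDerivAt_const _ _)
    fun z _ => h z
  simpa using this

/-- Both the weak y-derivative and the classical one satisfy the same integration by parts formula
against test functions, the classical one because φv is integrable with an integrable line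
derivative. The fundamental lemma of the calculus of variations identifies them. -/
lemma ae_yc_weakGradient {O : Set (Space n)} (hO : IsOpen O) {v d : Space n → ℝ}
    {Dv : Space n → Space n} (hv : ContinuousOn v O) (hd : ContinuousOn d O)
    (hl : ∀ z ∈ O, HasLineDerivAt ℝ v (d z) z (ey n)) (hDv : LocallyIntegrableOn Dv O)
    (hw : ∀ φ : Space n → ℝ, IsTest O φ → ∫ z in O, v z • gradient φ z = -∫ z in O, φ z • Dv z) :
    ∀ᵐ z, z ∈ O → yc (Dv z) = d z := by
  have hOl := hO.isLocallyClosed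
  have hycD : LocallyIntegrableOn (fun z => yc (Dv z)) O := fun z hz => by
    obtain ⟨t, ht, hi⟩ := hDv z hz
    exact ⟨t, ht, (ycL n).integrable_comp hi⟩
  have hdl : LocallyIntegrableOn d O := hd.locallyIntegrableOn hO.measurableSet
  have key := IsOpen.ae_eq_zero_of_integral_contDiff_smul_eq_zero hO (hycD.sub hdl)
    fun φ hφ hφc hφs => ?_
  · filter_upwards [key] with z hz hzO
    simpa [sub_eq_zero] using hz hzO
  have hφt : IsTest O φ := ⟨hφ, hφc, hφs⟩
  have hz0 : ∀ z, z ∉ tsupport φ → φ z = 0 := fun z hz => image_eq_zero_of_notMem_tsupport hz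
  have hgc := continuous_gradient hφ
  have hKint : ∀ {E : Type} [NormedAddCommGroup E] {D : Space n → E}, LocallyIntegrableOn D O →
      IntegrableOn D (tsupport φ) := fun hD => hD.integrableOn_compact_subset hφs hφc
  have hvK : IntegrableOn v (tsupport φ) := hKint (hv.locallyIntegrableOn hO.measurableSet)
  have i1 : Integrable (fun z => yc (gradient φ z) • v z) :=
    integrable_smul_of_support_subset (continuous_yc.comp hgc) hφc
      (fun z hz => by simp [gradient_eq_zero_of_notMem hz, yc]) hvK
  have i2 : Integrable (fun z => φ z • d z) :=
    integrable_smul_of_support_subset hφ.continuous hφc hz0 (hKint hdl)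
  have i3 : Integrable (fun z => φ z • v z) :=
    integrable_smul_of_support_subset hφ.continuous hφc hz0 hvK
  have i4 : Integrable (fun z => φ z • Dv z) :=
    integrable_smul_of_support_subset hφ.continuous hφc hz0 (hKint hDv)
  have i5 : Integrable (fun z => v z • gradient φ z) := by
    have := hvK.smul_continuousOn hgc.continuousOn hφc
    refine (integrableOn_iff_integrable_of_support_subset fun z hz => ?_).1 this
    by_contra h
    exact hz (by simp [gradient_eq_zero_of_notMem h])
  have h1 : ∫ z, (yc (gradient φ z) • v z + φ z • d z) = 0 := by
    refine integral_lineDeriv_eq_zero (v := ey n) i3 (i1.add i2) fun z => ?_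
    by_cases hz : z ∈ tsupport φ
    · have hp : HasLineDerivAt ℝ φ (yc (gradient φ z)) z (ey n) := by
        rw [yc_gradient]
        exact ((hφ.differentiable (by simp)) z).hasFDerivAt.hasLineDerivAt _
      have := HasDerivAt.mul hp (hl z (hφs hz))
      simp only [zero_smul, add_zero] at this
      exact this
    · have he : (fun z => φ z • v z) =ᶠ[𝓝 z] fun _ => 0 := by
        filter_upwards [notMem_tsupport_iff_eventuallyEq.1 hz] with w hw
        simp [hw]
      rw [gradient_eq_zero_of_notMem hz, hz0 z hz]
      have h0 : HasLineDerivAt ℝ (fun _ : Space n => (0 : ℝ)) 0 z (ey n) := by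
        simpa [HasLineDerivAt] using hasDerivAt_const _ _
      simpa [yc] using he.hasLineDerivAt_iff.2 h0
  have h2 := congrArg (ycL n) (hw φ hφt)
  rw [map_neg, setIntegral_eq_integral_of_forall_compl_eq_zero
      (fun z hz => by rw [gradient_eq_zero_of_notMem (fun h => hz (hφs h)), smul_zero]),
    setIntegral_eq_integral_of_forall_compl_eq_zero
      (fun z hz => by rw [hz0 z (fun h => hz (hφs h)), zero_smul]),
    ← (ycL n).integral_comp_comm i4, ← (ycL n).integral_comp_comm i5] at h2
  simp only [map_smul, ycL_apply, smul_eq_mul] at h2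
  rw [integral_add i1 i2] at h1
  simp only [smul_eq_mul] at h1 i2 ⊢
  have i4' : Integrable (fun z => φ z * yc (Dv z)) := by
    simpa [ycL_apply] using (ycL n).integrable_comp i4
  have e : ∀ z, φ z * ((fun z => yc (Dv z)) - d) z = φ z * yc (Dv z) - φ z * d z := fun z => by
    simp [mul_sub]
  simp only [e]
  rw [integral_sub i4' i2]
  simp only [mul_comm (yc _) (v _)] at h1
  linarith

/-! ### The gradient of the characteristic odd function -/

section Gradient

variable {A : Space n → Matrix (Fin (n + 1)) (Fin (n + 1)) ℝ}

/-- Multiplied by ρ this reads ρA∇v = ρvG + (1-a)e_y, whose last term is divergence free: G measures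
how far v is from being a solution. In the last row μ∂_yv is exactly (1-a)/ρ; in the other rows the
contribution μT∂_yv becomes vT̄. -/
lemma mulVec_gradient_vChar (hA : MatrixAssumption A) {ε a : ℝ} (hε : 0 ≤ ε) (ha : a < 1)
    {Dv : Space n → Space n} {z : Space n} (hz : z ∈ B n 1) (hy : yc z ≠ 0)
    (hD : yc (Dv z) = (1 - a) * (rho ε (-a) (yc z) * (mu A z)⁻¹)) :
    A z *ᵥ (Dv z).ofLp =
      (vChar ε a A z • fieldG ε a A Dv z + ((1 - a) / rho ε a (yc z)) • ey n).ofLp := by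
  have hv := vChar_ne_zero hA hε ha hz hy
  have hμ := (hA.mu_pos hz).ne'
  have hρ := (rho_pos hε a hy).ne'
  rw [rho_neg hε a hy] at hD
  have hD' : (Dv z).ofLp (Fin.last n) = (1 - a) * ((rho ε a (yc z))⁻¹ * (mu A z)⁻¹) := hD
  have hs : ∀ j : Fin n, A z (Fin.last n) j.castSucc = A z j.castSucc (Fin.last n) := fun j => by
    simpa [Matrix.transpose_apply] using
      congrFun (congrFun (hA.symm z hz) j.castSucc) (Fin.last n)
  have hl : (ey n).ofLp (Fin.last n) = 1 := yc_ey
  have hc : ∀ j : Fin n, (ey n).ofLp j.castSucc = 0 := fun j => by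
    simp [ey, Fin.castSucc_ne_last]
  have hμl : A z (Fin.last n) (Fin.last n) = mu A z := rfl
  ext i
  rcases Fin.eq_castSucc_or_eq_last i with ⟨i, rfl⟩ | rfl
  · simp only [Matrix.mulVec, dotProduct, Fin.sum_univ_castSucc, hD', fieldG, mkVec,
      WithLp.ofLp_add, WithLp.ofLp_smul, Pi.add_apply, Pi.smul_apply, smul_eq_mul,
      Fin.snoc_castSucc, hc, bField, xPart, barT, fieldT, tildeA, Matrix.submatrix_apply, mul_zero,
      add_zero]
    field_simp
  · simp only [Matrix.mulVec, dotProduct, Fin.sum_univ_castSucc, hD', fieldG, mkVec, hl, hμl,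
      WithLp.ofLp_add, WithLp.ofLp_smul, Pi.add_apply, Pi.smul_apply, smul_eq_mul, Fin.snoc_last,
      bField, Matrix.one_mulVec, xPart, fieldT, hs]
    have e : ∀ j : Fin n, A z j.castSucc (Fin.last n) / mu A z *
        ((vChar ε a A z)⁻¹ * (Dv z).ofLp j.castSucc) =
        ((mu A z)⁻¹ * (vChar ε a A z)⁻¹) *
          (A z j.castSucc (Fin.last n) * (Dv z).ofLp j.castSucc) := fun j => by ring
    simp only [e, ← Finset.mul_sum]
    field_simp

lemma dotProduct_gradient_vChar (hA : MatrixAssumption A) {ε a : ℝ} (hε : 0 ≤ ε) (ha : a < 1)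
    {Dv : Space n → Space n} {z : Space n} (hz : z ∈ B n 1) (hy : yc z ≠ 0)
    (hD : yc (Dv z) = (1 - a) * (rho ε (-a) (yc z) * (mu A z)⁻¹)) (ξ : Space n) :
    (A z *ᵥ (Dv z).ofLp) ⬝ᵥ ξ.ofLp =
      vChar ε a A z * inner ℝ (fieldG ε a A Dv z) ξ + (1 - a) / rho ε a (yc z) * yc ξ := by
  rw [mulVec_gradient_vChar hA hε ha hz hy hD, dotProduct_eq_inner, inner_add_right,
    inner_smul_right, inner_smul_right, inner_ey, real_inner_comm]

/-- Ellipticity with ξ = ∇v, the flux being known from the splitting of A∇v. The vertical part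
(1-a)/ρ is at most a multiple of |v|/|y|, because ρ|v| is comparable to |y|^b |y|^(1-b) = |y|. The
full gradient, including ∇_xv, is thus controlled by G. -/
lemma exists_norm_gradient_vChar_le (hA : MatrixAssumption A) {ε a : ℝ} (hε : 0 ≤ ε) (ha : a < 1)
    (Dv : Space n → Space n) : ∃ C : ℝ, 0 < C ∧ ∀ z ∈ B n 1, yc z ≠ 0 →
      yc (Dv z) = (1 - a) * (rho ε (-a) (yc z) * (mu A z)⁻¹) →
      ‖Dv z‖ ≤ C * |vChar ε a A z| * (‖fieldG ε a A Dv z‖ + |yc z|⁻¹) := by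
  obtain ⟨l₁, l₂, h1, -, hl⟩ := hA.elliptic
  obtain ⟨c, C', hc, -, hρ⟩ := comparable_rho (n := n) hε a
  obtain ⟨c', C'', hc', -, hv⟩ := comparable_vChar hA hε ha
  have ha' : 0 < 1 - a := by linarith
  set C₁ := (1 - a) * (c * c')⁻¹ with hC₁
  have hC₁p : 0 < C₁ := by positivity
  refine ⟨l₁⁻¹ * (1 + C₁), by positivity, fun z hz hy hD => ?_⟩
  have hyp : 0 < |yc z| := abs_pos.2 hy
  have hρp := rho_pos hε a hy
  have hvp : 0 < |vChar ε a A z| := (comparable_vChar hA hε ha).pos hz hy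
  have h2 := (hl z hz (Dv z).ofLp).1
  rw [dotProduct_gradient_vChar hA hε ha hz hy hD, dotProduct_self_eq] at h2
  have h3 : vChar ε a A z * inner ℝ (fieldG ε a A Dv z) (Dv z) ≤
      |vChar ε a A z| * (‖fieldG ε a A Dv z‖ * ‖Dv z‖) := by
    refine (le_abs_self _).trans ?_
    rw [abs_mul]
    exact mul_le_mul_of_nonneg_left (abs_real_inner_le_norm _ _) (abs_nonneg _)
  have h4 : (1 - a) / rho ε a (yc z) ≤ C₁ * |vChar ε a A z| * |yc z|⁻¹ := by
    have h5 : c * c' * |yc z| ≤ rho ε a (yc z) * |vChar ε a A z| := by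
      have e : |yc z| = |yc z| ^ wExp ε a * |yc z| ^ (1 - wExp ε a) := by
        rw [← Real.rpow_add hyp]; simp
      calc c * c' * |yc z| = (c * |yc z| ^ wExp ε a) * (c' * |yc z| ^ (1 - wExp ε a)) := by
            conv_lhs => rw [e]
            ring
        _ ≤ _ := mul_le_mul (hρ z hz hy).1 (hv z hz hy).1 (by positivity) hρp.le
    rw [hC₁, div_le_iff₀ hρp]
    calc (1 - a) = (1 - a) * (c * c')⁻¹ * |yc z|⁻¹ * (c * c' * |yc z|) := by field_simp
      _ ≤ (1 - a) * (c * c')⁻¹ * |yc z|⁻¹ * (rho ε a (yc z) * |vChar ε a A z|) :=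
        mul_le_mul_of_nonneg_left h5 (by positivity)
      _ = _ := by ring
  have h6 : (1 - a) / rho ε a (yc z) * yc (Dv z) ≤ C₁ * |vChar ε a A z| * |yc z|⁻¹ * ‖Dv z‖ :=
    (mul_le_mul_of_nonneg_left ((le_abs_self _).trans (abs_yc_le _)) (by positivity)).trans
      (mul_le_mul_of_nonneg_right h4 (norm_nonneg _))
  rcases (norm_nonneg (Dv z)).eq_or_lt with h0 | h0
  · rw [← h0]; positivity
  have h7 : l₁ * ‖Dv z‖ ≤ |vChar ε a A z| * ‖fieldG ε a A Dv z‖ + C₁ * |vChar ε a A z| * |yc z|⁻¹ :=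
    le_of_mul_le_mul_right (by nlinarith) h0
  rw [mul_assoc, mul_assoc, ← div_eq_inv_mul, le_div_iff₀' h1]
  refine h7.trans ?_
  have h8 : 0 ≤ |vChar ε a A z| * |yc z|⁻¹ := by positivity
  have h9 : 0 ≤ C₁ * (|vChar ε a A z| * ‖fieldG ε a A Dv z‖) := by positivity
  nlinarith

end Gradient

/-! ### Integrability of powers of `|y|` -/

/-- The ball lies in the cube [-1, 1]^(n+1), on which the function is a product of one-variable
integrable functions. -/
lemma integrableOn_rpow_abs_yc {β : ℝ} (hβ : -1 < β) :
    IntegrableOn (fun z : Space n => |yc z| ^ β) (B n 1) := by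
  let k : Fin (n + 1) → ℝ → ℝ := fun i s =>
    (Icc (-1 : ℝ) 1).indicator (fun s => if i = Fin.last n then |s| ^ β else 1) s
  have hk : ∀ i, Integrable (k i) := fun i => by
    refine (integrable_indicator_iff measurableSet_Icc).2 ?_
    by_cases hi : i = Fin.last n
    · simp only [hi, if_true]
      have := intervalIntegrable_rpow_abs hβ (-1) 1
      rw [intervalIntegrable_iff_integrableOn_Icc_of_le (by norm_num)] at this
      exact this
    · simp only [hi, if_false]
      exact integrableOn_const (by simp)
  have hp : Integrable (fun x : Fin (n + 1) → ℝ => ∏ i, k i (x i)) :=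
    Integrable.fintype_prod (μ := fun _ => volume) hk
  have hp' : Integrable (fun z : Space n => ∏ i, k i (z i)) :=
    (PiLp.volume_preserving_ofLp (Fin (n + 1))).integrable_comp_of_integrable hp
  refine hp'.integrableOn.congr_fun (fun z hz => ?_) Metric.isOpen_ball.measurableSet
  have hm : ∀ i, z i ∈ Icc (-1 : ℝ) 1 := fun i => by
    have h1 : ‖z i‖ ≤ ‖z‖ := PiLp.norm_apply_le z i
    have h2 : ‖z‖ < 1 := by simpa using hz
    exact abs_le.1 (by simpa using h1.trans h2.le)
  beta_reduce
  rw [Fin.prod_univ_castSucc]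
  simp only [k, indicator_of_mem (hm _)]
  simp [Fin.castSucc_ne_last, yc]

lemma isFiniteMeasure_wMeasure {q : Space n → ℝ} (hq : Measurable q) {β : ℝ} (hβ : -1 < β)
    (hc : Comparable q (B n 1) β) : IsFiniteMeasure (wMeasure q (B n 1)) := by
  have hpos := hc
  obtain ⟨c, C, -, hC, h⟩ := hc
  have hi : IntegrableOn (fun z => C * |yc z| ^ β) (B n 1) :=
    (integrableOn_rpow_abs_yc hβ).const_mul C
  refine isFiniteMeasure_withDensity_ofReal (Integrable.mono' hi hq.aestronglyMeasurable ?_).2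
  filter_upwards [ae_restrict_ball] with z hz
  rw [Real.norm_of_nonneg (hpos.pos hz.1 hz.2).le]
  exact (h z hz.1 hz.2).2

/-- Since |y| < 1 in the ball, raising the exponent of |y| only decreases the weight; the measure
being finite, the integrability exponent may be lowered from p to d. -/
lemma lintegral_rpow_abs_yc_mul_ne_top {E : Type*} [NormedAddCommGroup E] {q : Space n → ℝ}
    (hq : Measurable q) {β : ℝ} (hβ : -1 < β) (hc : Comparable q (B n 1) β) {G : Space n → E}
    {d γ : ℝ} (hd : 0 < d) (hγ : β ≤ γ) {p : ℝ≥0∞} (hp : ENNReal.ofReal d ≤ p)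
    (hG : MemLp G p (wMeasure q (B n 1))) :
    ∫⁻ z in B n 1, ENNReal.ofReal (|yc z| ^ γ) * ‖G z‖ₑ ^ d ≠ (⊤ : ℝ≥0∞) := by
  have hfin := isFiniteMeasure_wMeasure hq hβ hc
  have hG' := hG.mono_exponent hp
  obtain ⟨c, C, hc0, -, h⟩ := hc
  have h1 := hG'.2
  rw [eLpNorm_lt_top_iff_lintegral_rpow_enorm_lt_top (by simpa using hd) ENNReal.ofReal_ne_top,
    ENNReal.toReal_ofReal hd.le, lintegral_wMeasure hq] at h1
  refine ne_top_of_le_ne_top (ENNReal.mul_ne_top (ENNReal.ofReal_ne_top (r := c⁻¹)) h1.ne) ?_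
  rw [← lintegral_const_mul' _ _ ENNReal.ofReal_ne_top]
  refine lintegral_mono_ae ?_
  filter_upwards [ae_restrict_ball] with z hz
  rw [← mul_assoc, ← ENNReal.ofReal_mul (by positivity)]
  refine mul_le_mul_left (ENNReal.ofReal_le_ofReal ?_) _
  have hy : 0 < |yc z| := abs_pos.2 hz.2
  have h2 := (h z hz.1 hz.2).1
  rw [inv_mul_eq_div, le_div_iff₀' hc0]
  refine le_trans (mul_le_mul_of_nonneg_left ?_ hc0.le) h2
  exact Real.rpow_le_rpow_of_exponent_ge hy (abs_yc_lt hz.1).le hγ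

/-! ### Compact subsets of `B_1 \ Σ` -/

lemma exists_rpow_abs_yc_le {K : Set (Space n)} (hK : IsCompact K)
    (hKO : K ⊆ B n 1 \ charSet n) (β : ℝ) : ∃ C : ℝ, 0 < C ∧ ∀ z ∈ K, |yc z| ^ β ≤ C := by
  obtain ⟨C, hC⟩ := hK.exists_bound_of_continuousOn
    ((contDiffOn_rpow_abs_yc (Ω := B n 1) β).continuousOn.mono hKO)
  exact ⟨max C 1, by positivity,
    fun z hz => (le_abs_self _).trans ((hC z hz).trans (le_max_left _ _))⟩

/-- On a compact set off Σ every power of |y| is bounded, so weights may be dropped. -/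
lemma memLp_compact_of_weighted {E : Type*} [NormedAddCommGroup E] [NormedSpace ℝ E]
    {K : Set (Space n)} (hK : IsCompact K) (hKO : K ⊆ B n 1 \ charSet n) {β : ℝ} {f : Space n → E}
    (hf : MemLp (fun z => |yc z| ^ β • f z) 2 (volume.restrict (B n 1))) :
    MemLp f 2 (volume.restrict K) := by
  obtain ⟨C, -, h⟩ := exists_rpow_abs_yc_le hK hKO (-β)
  have hf' := hf.mono_measure (Measure.restrict_mono (hKO.trans sdiff_subset) le_rfl)
  have e : ∀ z ∈ K, |yc z| ^ (-β) • |yc z| ^ β • f z = f z := fun z hz => by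
    have : 0 < |yc z| := abs_pos.2 (hKO hz).2
    rw [smul_smul, ← Real.rpow_add this, neg_add_cancel, Real.rpow_zero, one_smul]
  have hm : AEStronglyMeasurable f (volume.restrict K) := by
    refine ((measurable_pow_yc (-β)).aestronglyMeasurable.smul hf'.1).congr ?_
    filter_upwards [ae_restrict_mem hK.measurableSet] with z hz using e z hz
  refine hf'.of_le_mul (c := C) hm ?_
  filter_upwards [ae_restrict_mem hK.measurableSet] with z hz
  conv_lhs => rw [← e z hz, norm_smul]
  refine mul_le_mul_of_nonneg_right ?_ (norm_nonneg _)
  rw [Real.norm_of_nonneg (Real.rpow_nonneg (abs_nonneg _) _)]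
  exact h z hz

lemma tendsto_eLpNorm_weighted_of_compact {E : Type*} [NormedAddCommGroup E] [NormedSpace ℝ E]
    {K : Set (Space n)} (hK : IsCompact K) (hKO : K ⊆ B n 1 \ charSet n) (β : ℝ)
    {f : ℕ → Space n → E} (h0 : ∀ m, ∀ z, z ∉ K → f m z = 0)
    (hf : Tendsto (fun m => eLpNorm (f m) 2 (volume.restrict K)) atTop (𝓝 0)) :
    Tendsto (fun m => eLpNorm (fun z => |yc z| ^ β • f m z) 2 (volume.restrict (B n 1)))
      atTop (𝓝 0) := by
  obtain ⟨C, -, h⟩ := exists_rpow_abs_yc_le hK hKO β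
  refine tendsto_zero_of_le_mul (C := ENNReal.ofReal C) ENNReal.ofReal_ne_top hf fun m => ?_
  calc eLpNorm (fun z => |yc z| ^ β • f m z) 2 (volume.restrict (B n 1))
      ≤ eLpNorm (fun z => |yc z| ^ β • f m z) 2 volume :=
        eLpNorm_mono_measure _ Measure.restrict_le_self
    _ = eLpNorm (fun z => |yc z| ^ β • f m z) 2 (volume.restrict K) := by
        rw [eLpNorm_restrict_eq_of_support_subset]
        intro z hz
        by_contra hzK
        exact hz (by simp [h0 m z hzK])
    _ ≤ _ := by
        refine eLpNorm_le_mul_eLpNorm_of_ae_le_mul ?_ _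
        filter_upwards [ae_restrict_mem hK.measurableSet] with z hz
        rw [norm_smul, Real.norm_of_nonneg (Real.rpow_nonneg (abs_nonneg _) _)]
        exact mul_le_mul_of_nonneg_right (h z hz) (norm_nonneg _)

/-- The weak gradient of v is only assumed locally integrable. The pointwise bound by |v|(|G| +
1/|y|) upgrades it to locally square integrable off Σ, as mollification in L² requires. -/
lemma memLp_compact_of_norm_le {K : Set (Space n)} (hK : IsCompact K)
    (hKO : K ⊆ B n 1 \ charSet n) {v : Space n → ℝ} (hv : ContinuousOn v (B n 1 \ charSet n))
    {Dv G : Space n → Space n} (hDm : LocallyIntegrableOn Dv (B n 1 \ charSet n)) {C β : ℝ}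
    (hC : 0 < C) (hDb : ∀ᵐ z ∂(volume.restrict (B n 1)),
      ‖Dv z‖ ≤ C * |v z| * (‖G z‖ + |yc z|⁻¹))
    (hG : MemLp (fun z => |yc z| ^ β • G z) 2 (volume.restrict (B n 1))) :
    MemLp Dv 2 (volume.restrict K) := by
  obtain ⟨M, hM⟩ := hK.exists_bound_of_continuousOn (hv.mono hKO)
  obtain ⟨M', hM', hy⟩ := exists_rpow_abs_yc_le hK hKO (-1)
  have hfin : IsFiniteMeasure (volume.restrict K) := ⟨by simpa using hK.measure_lt_top⟩
  have h1 : MemLp (fun z => ‖G z‖ + M') 2 (volume.restrict K) :=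
    (memLp_compact_of_weighted hK hKO hG).norm.add (memLp_const M')
  have hm : AEStronglyMeasurable Dv (volume.restrict K) :=
    (hDm.integrableOn_compact_subset hKO hK).1
  refine h1.of_le_mul (c := C * |M|) hm ?_
  filter_upwards [ae_restrict_mem hK.measurableSet,
    ae_restrict_of_ae_restrict_of_subset (hKO.trans sdiff_subset) hDb] with z hz hzD
  refine hzD.trans ?_
  rw [Real.norm_of_nonneg (by positivity)]
  have h2 := hy z hz
  rw [Real.rpow_neg_one] at h2
  have h3 : |v z| ≤ |M| := (hM z hz).trans (le_abs_self M)
  gcongr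

/-! ### Smooth approximation of quotients -/

/-- Compares ∇(Φ/V) with the formal gradient of Φ/v at one point: x and X stand for V and ∇V, w and
D for v and its weak gradient, t and g for Φ and ∇Φ. The error is linear in V - v, weighted by 1 +
|Dv|, and in ∇V - Dv. -/
lemma norm_quotient_gradient_sub_le {x w t M c : ℝ} (hc : 0 < c) (hM : 0 ≤ M)
    (hx : |x⁻¹| ≤ 2 / c) (hw : |w⁻¹| ≤ 1 / c) (hd : |x⁻¹ - w⁻¹| ≤ 2 / c ^ 2 * |x - w|)
    (ht : |t| ≤ M) {g : Space n} (hg : ‖g‖ ≤ M) (X D : Space n) :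
    ‖t • -(x ^ 2)⁻¹ • X + x⁻¹ • g - w⁻¹ • (g - (t / w) • D)‖ ≤
      M * (2 / c ^ 2) * (1 + 3 / c) * ‖(x - w) * (1 + ‖D‖)‖ + M * (4 / c ^ 2) * ‖X - D‖ := by
  have e : t • -(x ^ 2)⁻¹ • X + x⁻¹ • g - w⁻¹ • (g - (t / w) • D) =
      (x⁻¹ - w⁻¹) • g - (t * (x⁻¹ * x⁻¹)) • (X - D) -
        (t * ((x⁻¹ - w⁻¹) * (x⁻¹ + w⁻¹))) • D := by
    rw [div_eq_mul_inv, pow_two, mul_inv]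
    module
  have hsum : |x⁻¹ + w⁻¹| ≤ 3 / c :=
    (abs_add_le _ _).trans ((add_le_add hx hw).trans_eq (by ring))
  rw [e]
  refine (norm_sub_le _ _).trans ((add_le_add (norm_sub_le _ _) le_rfl).trans ?_)
  simp only [norm_smul, norm_mul, Real.norm_eq_abs]
  have t1 : |x⁻¹ - w⁻¹| * ‖g‖ ≤ 2 / c ^ 2 * |x - w| * M :=
    mul_le_mul hd hg (norm_nonneg _) (by positivity)
  have t2 : |t| * (|x⁻¹| * |x⁻¹|) * ‖X - D‖ ≤ M * (2 / c * (2 / c)) * ‖X - D‖ := by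
    gcongr
  have t3 : |t| * (|x⁻¹ - w⁻¹| * |x⁻¹ + w⁻¹|) * ‖D‖ ≤
      M * (2 / c ^ 2 * |x - w| * (3 / c)) * ‖D‖ := by
    gcongr
  rw [abs_of_nonneg (show 0 ≤ 1 + ‖D‖ by positivity)]
  have t4 : 0 ≤ M * (2 / c ^ 2) * |x - w| * ‖D‖ := by positivity
  have t5 : 0 ≤ M * (2 / c ^ 2) * |x - w| * (3 / c) := by positivity
  calc _ ≤ 2 / c ^ 2 * |x - w| * M + M * (2 / c * (2 / c)) * ‖X - D‖ +
        M * (2 / c ^ 2 * |x - w| * (3 / c)) * ‖D‖ := add_le_add (add_le_add t1 t2) t3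
    _ = (M * (2 / c ^ 2) * |x - w| + M * (2 / c ^ 2) * |x - w| * (3 / c) * ‖D‖) +
        M * (4 / c ^ 2) * ‖X - D‖ := by ring
    _ ≤ M * (2 / c ^ 2) * (1 + 3 / c) * (|x - w| * (1 + ‖D‖)) + M * (4 / c ^ 2) * ‖X - D‖ := by
      refine add_le_add ?_ le_rfl
      linarith

/-- The denominator v, not smooth, is replaced by its mollifications V_m. On the support of Φ one
has |v| ≥ c > 0 and uniform convergence, so Φ/V_m is smooth for large m. Uniform convergence alone
does not bound (V_m - v)Dv directly in L²; dominated convergence with |Dv| square integrable does.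
-/
lemma exists_quotient_approx {v : Space n → ℝ} {Dv : Space n → Space n}
    (hv : ContinuousOn v (B n 1 \ charSet n)) (hv0 : ∀ z ∈ B n 1 \ charSet n, v z ≠ 0)
    (hw : ∀ φ : Space n → ℝ, IsTest (B n 1 \ charSet n) φ →
      ∫ z in B n 1 \ charSet n, v z • gradient φ z = -∫ z in B n 1 \ charSet n, φ z • Dv z)
    (hD : ∀ K ⊆ B n 1 \ charSet n, IsCompact K → MemLp Dv 2 (volume.restrict K))
    {Φ : Space n → ℝ} (hΦ : IsTest (B n 1 \ charSet n) Φ) (β : ℝ) :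
    ∃ W : ℕ → Space n → ℝ, (∀ m, ContDiff ℝ ∞ (W m)) ∧
      Tendsto (fun m => eLpNorm (fun z => |yc z| ^ β • (W m z - Φ z / v z)) 2
        (volume.restrict (B n 1))) atTop (𝓝 0) ∧
      Tendsto (fun m => eLpNorm (fun z => |yc z| ^ β • (gradient (W m) z -
        (v z)⁻¹ • (gradient Φ z - (Φ z / v z) • Dv z))) 2 (volume.restrict (B n 1)))
        atTop (𝓝 0) := by
  set K := tsupport Φ with hKdef
  have hK : IsCompact K := hΦ.2.1
  have hKO : K ⊆ B n 1 \ charSet n := hΦ.2.2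
  obtain ⟨V, hV, hVu, hVg⟩ := exists_smooth_approx isOpen_ball_diff hv hw hD hK hKO
  obtain ⟨c, hc, hcv⟩ := IsCompact.exists_forall_le' (f := fun z => |v z|) (a := (0 : ℝ)) hK
    (continuous_abs.comp_continuousOn (hv.mono hKO)) fun z hz => abs_pos.2 (hv0 z (hKO hz))
  -- From the index N on, V_m is within c/2 of v, hence |V_m| ≥ c/2 on the support of Φ; the
  -- sequence is shifted by N.
  obtain ⟨N, hN⟩ := eventually_atTop.1 (Metric.tendstoUniformlyOn_iff.1 hVu (c / 2) (by linarith))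
  obtain ⟨M, hM, hΦb⟩ := hΦ.exists_bound
  have hδ : ∀ m, ∀ z ∈ K, |V (m + N) z - v z| ≤ c / 2 := fun m z hz => by
    have := hN (m + N) (by omega) z hz
    rw [dist_comm, Real.dist_eq] at this
    exact this.le
  have hVc : ∀ m, ∀ z ∈ K, c / 2 ≤ |V (m + N) z| := fun m z hz => by
    have h1 := hcv z hz
    have h2 := abs_sub_abs_le_abs_sub (v z) (V (m + N) z)
    rw [abs_sub_comm] at h2
    linarith [hδ m z hz]
  have hVne : ∀ m, ∀ z ∈ K, V (m + N) z ≠ 0 := fun m z hz =>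
    abs_pos.1 (by linarith [hVc m z hz])
  have hinv : ∀ m, ∀ z ∈ K, |(V (m + N) z)⁻¹ - (v z)⁻¹| ≤ 2 / c ^ 2 * |V (m + N) z - v z| := by
    intro m z hz
    have h1 := hVne m z hz
    have h2 := hv0 z (hKO hz)
    rw [inv_sub_inv h1 h2, abs_div, abs_mul, abs_sub_comm, div_le_iff₀ (by positivity)]
    have h3 : c / 2 * c ≤ |V (m + N) z| * |v z| :=
      mul_le_mul (hVc m z hz) (hcv z hz) hc.le (abs_nonneg _)
    calc |V (m + N) z - v z| = 2 / c ^ 2 * |V (m + N) z - v z| * (c / 2 * c) := by field_simp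
      _ ≤ _ := mul_le_mul_of_nonneg_left h3 (by positivity)
  have hsm : ∀ m, ContDiff ℝ ∞ fun z => Φ z * (V (m + N) z)⁻¹ := fun m => by
    refine contDiff_mul_of_tsupport_subset (Ω := {z | V (m + N) z ≠ 0})
      (isOpen_ne.preimage (hV _).continuous) hΦ.1 (fun z hz => hVne m z hz) ?_
    exact (hV _).contDiffOn.inv fun z hz => hz
  have hKm := hK.measurableSet
  have hfin : IsFiniteMeasure (volume.restrict K) := ⟨by simpa using hK.measure_lt_top⟩
  have hvm : AEStronglyMeasurable v (volume.restrict K) := (hv.mono hKO).aestronglyMeasurable hKm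
  have hDK := hD K hKO hK
  have hΦ0 : ∀ z, z ∉ K → Φ z = 0 := fun z hz => image_eq_zero_of_notMem_tsupport hz
  -- the differences `V - v`, weighted by a square integrable function
  have hdiff : ∀ h : Space n → ℝ, MemLp h 2 (volume.restrict K) →
      Tendsto (fun m => eLpNorm (fun z => (V (m + N) z - v z) * h z) 2 (volume.restrict K))
        atTop (𝓝 0) := fun h hh => by
    refine tendsto_eLpNorm_smul_of_bounded hh (fun m => ?_) (c / 2) (fun m => ?_) ?_
    · exact ((hV _).continuous.aestronglyMeasurable.sub hvm).mul hh.1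
    · filter_upwards [ae_restrict_mem hKm] with z hz
      rw [norm_mul]
      exact mul_le_mul_of_nonneg_right (hδ m z hz) (norm_nonneg _)
    · filter_upwards [ae_restrict_mem hKm] with z hz
      have h1 := (tendsto_add_atTop_iff_nat N).2 (hVu.tendsto_at hz)
      simpa using (h1.sub_const (v z)).mul_const (h z)
  refine ⟨fun m z => Φ z * (V (m + N) z)⁻¹, hsm, ?_, ?_⟩
  · refine tendsto_eLpNorm_weighted_of_compact hK hKO β (fun m z hz => by simp [hΦ0 z hz]) ?_
    refine tendsto_eLpNorm_of_bound (M * (2 / c ^ 2)) (hdiff _ (memLp_const 1)) fun m => ?_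
    filter_upwards [ae_restrict_mem hKm] with z hz
    rw [div_eq_mul_inv, ← mul_sub, norm_mul, mul_one, mul_assoc]
    exact mul_le_mul (hΦb z).1 (hinv m z hz) (norm_nonneg _) hM.le
  · refine tendsto_eLpNorm_weighted_of_compact hK hKO β (fun m z hz => ?_) ?_
    · have h1 : z ∉ tsupport fun z => Φ z * (V (m + N) z)⁻¹ :=
        fun h => hz (tsupport_mul_subset_left h)
      simp [gradient_eq_zero_of_notMem h1, gradient_eq_zero_of_notMem hz, hΦ0 z hz]
    have hg' : Tendsto (fun m => eLpNorm (fun z => gradient (V (m + N)) z - Dv z) 2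
        (volume.restrict K)) atTop (𝓝 0) := (tendsto_add_atTop_iff_nat N).2 hVg
    have hh : MemLp (fun z => 1 + ‖Dv z‖) 2 (volume.restrict K) :=
      MemLp.add (f := fun _ => (1 : ℝ)) (g := fun z => ‖Dv z‖) (memLp_const (1 : ℝ)) hDK.norm
    refine tendsto_eLpNorm_of_bound_add (C := M * (2 / c ^ 2) * (1 + 3 / c))
      (C' := M * (4 / c ^ 2)) (by positivity) (by positivity) (fun m => ?_) (fun m => ?_)
      (hdiff _ hh) hg' fun m => ?_
    · exact ((hV _).continuous.aestronglyMeasurable.sub hvm).mul hh.1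
    · exact (continuous_gradient (hV _)).aestronglyMeasurable.sub hDK.1
    filter_upwards [ae_restrict_mem hKm] with z hz
    have hVd : DifferentiableAt ℝ (V (m + N)) z := (hV _).differentiable (by simp) z
    have hne := hVne m z hz
    have hvne := hv0 z (hKO hz)
    have e1 : gradient (fun z => (V (m + N) z)⁻¹) z =
        (-(V (m + N) z ^ 2)⁻¹) • gradient (V (m + N)) z := by
      rw [gradient_comp (h := fun x => x⁻¹) (differentiableAt_inv hne) hVd, deriv_inv]
    rw [gradient_mul (g := fun z => (V (m + N) z)⁻¹) (hΦ.1.differentiable (by simp) z)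
      (hVd.inv hne), e1]
    refine norm_quotient_gradient_sub_le hc hM.le ?_ ?_ (hinv m z hz) (hΦb z).1 (hΦb z).2 _ _
    · rw [abs_inv, inv_le_comm₀ (abs_pos.2 hne) (by positivity), inv_div]
      exact hVc m z hz
    · rw [abs_inv, inv_le_comm₀ (abs_pos.2 hvne) (by positivity), one_div, inv_inv]
      exact hcv z hz

/-! ### Limits of integrals -/

lemma MemLp.integrable_inner' {α E : Type*} [MeasurableSpace α] {μ : Measure α}
    [NormedAddCommGroup E] [InnerProductSpace ℝ E] {f g : α → E} (hf : MemLp f 2 μ)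
    (hg : MemLp g 2 μ) : Integrable (fun z => inner ℝ (f z) (g z)) μ := by
  refine (hf.norm.integrable_mul hg.norm).mono' (hf.1.inner hg.1) (ae_of_all _ fun z => ?_)
  exact norm_inner_le_norm _ _

lemma tendsto_integral_inner {α E : Type*} [MeasurableSpace α] {μ : Measure α}
    [NormedAddCommGroup E] [InnerProductSpace ℝ E] {H f : α → E} {F : ℕ → α → E}
    (hH : MemLp H 2 μ) (hf : MemLp f 2 μ) (hF : ∀ m, MemLp (F m) 2 μ)
    (h : Tendsto (fun m => eLpNorm (fun z => F m z - f z) 2 μ) atTop (𝓝 0)) :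
    Tendsto (fun m => ∫ z, inner ℝ (H z) (F m z) ∂μ) atTop (𝓝 (∫ z, inner ℝ (H z) (f z) ∂μ)) := by
  refine tendsto_integral_of_L1' _ (MemLp.integrable_inner' hH hf).1
    (Eventually.of_forall fun m => MemLp.integrable_inner' hH (hF m)) ?_
  refine tendsto_zero_of_le_mul (C := eLpNorm H 2 μ) hH.2.ne h fun m => ?_
  have := eLpNorm_le_eLpNorm_mul_eLpNorm'_of_norm (p := 2) (q := 2) (r := 1) (μ := μ) hH.1
    ((hF m).1.sub hf.1) (fun x y => inner ℝ x y) 1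
    (ae_of_all _ fun z => by simpa using norm_inner_le_norm (𝕜 := ℝ) _ _)
  simp only [ENNReal.coe_one, one_mul] at this
  refine le_trans (le_of_eq ?_) this
  congr 1
  funext z
  simp [inner_sub_right]

lemma tendsto_eLpNorm_of_tendstoUniformlyOn {V : ℕ → Space n → ℝ} {v : Space n → ℝ}
    {K : Set (Space n)} (hK : IsCompact K) (h : TendstoUniformlyOn V v atTop K) :
    Tendsto (fun m => eLpNorm (fun z => V m z - v z) 2 (volume.restrict K)) atTop (𝓝 0) := by
  set c := (volume.restrict K) univ ^ (2 : ℝ≥0∞).toReal⁻¹ with hc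
  have hcf : c ≠ ⊤ := by
    rw [hc, Measure.restrict_apply_univ]
    exact (ENNReal.rpow_lt_top_of_nonneg (by simp) hK.measure_lt_top.ne).ne
  have ht : Tendsto (fun δ : ℝ => c * ENNReal.ofReal δ) (𝓝[>] 0) (𝓝 0) := by
    have h1 : Tendsto (fun δ : ℝ => ENNReal.ofReal δ) (𝓝[>] 0) (𝓝 0) := by
      simpa using (ENNReal.continuous_ofReal.tendsto 0).mono_left nhdsWithin_le_nhds
    simpa using ENNReal.Tendsto.const_mul h1 (Or.inr hcf)
  rw [ENNReal.tendsto_nhds_zero] at ht ⊢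
  intro δ hδ
  obtain ⟨η, hη, hη0⟩ := ((ht δ hδ).and self_mem_nhdsWithin).exists
  filter_upwards [Metric.tendstoUniformlyOn_iff.1 h η hη0] with m hm
  refine (eLpNorm_le_of_ae_bound (C := η) ?_).trans hη
  filter_upwards [ae_restrict_mem hK.measurableSet] with z hz
  have := hm z hz
  rw [dist_comm, Real.dist_eq] at this
  exact this.le

lemma tendsto_eLpNorm_compact_of_weighted {E : Type*} [NormedAddCommGroup E] [NormedSpace ℝ E]
    {K : Set (Space n)} (hK : IsCompact K) (hKO : K ⊆ B n 1 \ charSet n) {β : ℝ}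
    {f : ℕ → Space n → E} (hf : Tendsto (fun m => eLpNorm (fun z => |yc z| ^ β • f m z) 2
      (volume.restrict (B n 1))) atTop (𝓝 0)) :
    Tendsto (fun m => eLpNorm (f m) 2 (volume.restrict K)) atTop (𝓝 0) := by
  obtain ⟨C, -, h⟩ := exists_rpow_abs_yc_le hK hKO (-β)
  refine tendsto_zero_of_le_mul (C := ENNReal.ofReal C) ENNReal.ofReal_ne_top hf fun m => ?_
  refine le_trans ?_ (mul_le_mul_right (eLpNorm_mono_measure _
    (Measure.restrict_mono (hKO.trans sdiff_subset) le_rfl)) _)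
  refine eLpNorm_le_mul_eLpNorm_of_ae_le_mul ?_ _
  filter_upwards [ae_restrict_mem hK.measurableSet] with z hz
  have hy : 0 < |yc z| := abs_pos.2 (hKO hz).2
  have e : |yc z| ^ (-β) • |yc z| ^ β • f m z = f m z := by
    rw [smul_smul, ← Real.rpow_add hy, neg_add_cancel, Real.rpow_zero, one_smul]
  conv_lhs => rw [← e, norm_smul]
  refine mul_le_mul_of_nonneg_right ?_ (norm_nonneg _)
  rw [Real.norm_of_nonneg (Real.rpow_nonneg (abs_nonneg _) _)]
  exact h z hz

lemma IsTest.memLp_weighted {φ : Space n → ℝ} (hφ : IsTest (B n 1 \ charSet n) φ) (β : ℝ) :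
    MemLp (fun z => |yc z| ^ β • φ z) 2 (volume.restrict (B n 1)) ∧
      MemLp (fun z => |yc z| ^ β • gradient φ z) 2 (volume.restrict (B n 1)) := by
  have hK : IsCompact (tsupport φ) := hφ.2.1
  obtain ⟨M, hM, hb⟩ := hφ.exists_bound
  have hfin : IsFiniteMeasure (volume.restrict (B n 1)) := ⟨by simp [measure_ball_lt_top]⟩
  obtain ⟨C, hC, hy⟩ := exists_rpow_abs_yc_le hK hφ.2.2 β
  have key : ∀ {E : Type} [NormedAddCommGroup E] [NormedSpace ℝ E] {f : Space n → E},
      AEStronglyMeasurable f (volume.restrict (B n 1)) → (∀ z, ‖f z‖ ≤ M) →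
      (∀ z, z ∉ tsupport φ → f z = 0) →
      MemLp (fun z => |yc z| ^ β • f z) 2 (volume.restrict (B n 1)) := fun {E _ _ f} hm h h0 => by
    refine MemLp.of_bound ((measurable_pow_yc _).aestronglyMeasurable.smul hm) (C * M)
      (ae_of_all _ fun z => ?_)
    by_cases hz : z ∈ tsupport φ
    · rw [norm_smul, Real.norm_of_nonneg (Real.rpow_nonneg (abs_nonneg _) _)]
      exact mul_le_mul (hy z hz) (h z) (norm_nonneg _) hC.le
    · simp only [h0 z hz, smul_zero, norm_zero]
      positivity
  exact ⟨key hφ.1.continuous.aestronglyMeasurable (fun z => (hb z).1)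
    fun z hz => image_eq_zero_of_notMem_tsupport hz,
    key (continuous_gradient hφ.1).aestronglyMeasurable (fun z => (hb z).2)
    fun z hz => gradient_eq_zero_of_notMem hz⟩

/-- Test functions vanishing near Σ lie in every weighted space. For a weight like |y|^a with a ≤ -1
an arbitrary test function need not, which is why the equation of u is used only off Σ. -/
lemma memH1_of_isTest {p : Space n → ℝ} (hp : Measurable p) {β : ℝ} (hc : Comparable p (B n 1) β)
    {φ : Space n → ℝ} (hφ : IsTest (B n 1 \ charSet n) φ) : MemH1 p (B n 1) φ (gradient φ) :=
  ⟨(hc.memLp_iff hp).2 (hφ.memLp_weighted _).1, (hc.memLp_iff hp).2 (hφ.memLp_weighted _).2,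
    fun _ => φ, fun _ => ContDiff.smoothUpTo hφ.1, by simp, by simp⟩

/-! ### Testing with products `Φ v` -/

/-- The function Φv is not smooth, so the equation is tested with ΦV_m. On the support of Φ the V_m
converge uniformly and their gradients in L², which passes to the limit in the flux against H in L²
and in the source against h in L¹. -/
lemma weakForm_mul {v : Space n → ℝ} {Dv : Space n → Space n}
    (hv : ContinuousOn v (B n 1 \ charSet n))
    (hw : ∀ φ : Space n → ℝ, IsTest (B n 1 \ charSet n) φ →
      ∫ z in B n 1 \ charSet n, v z • gradient φ z = -∫ z in B n 1 \ charSet n, φ z • Dv z)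
    (hD : ∀ K ⊆ B n 1 \ charSet n, IsCompact K → MemLp Dv 2 (volume.restrict K))
    {H : Space n → Space n} {h : Space n → ℝ}
    (hH : ∀ K ⊆ B n 1 \ charSet n, IsCompact K → MemLp H 2 (volume.restrict K))
    (hh : ∀ K ⊆ B n 1 \ charSet n, IsCompact K → IntegrableOn h K)
    (heq : ∀ φ : Space n → ℝ, IsTest (B n 1 \ charSet n) φ →
      ∫ z in B n 1, inner ℝ (H z) (gradient φ z) = ∫ z in B n 1, h z * φ z)
    {Φ : Space n → ℝ} (hΦ : IsTest (B n 1 \ charSet n) Φ) :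
    IntegrableOn (fun z => inner ℝ (H z) (v z • gradient Φ z + Φ z • Dv z)) (B n 1) ∧
      IntegrableOn (fun z => h z * (Φ z * v z)) (B n 1) ∧
      ∫ z in B n 1, inner ℝ (H z) (v z • gradient Φ z + Φ z • Dv z) =
        ∫ z in B n 1, h z * (Φ z * v z) := by
  set K := tsupport Φ with hKdef
  have hK : IsCompact K := hΦ.2.1
  have hKO : K ⊆ B n 1 \ charSet n := hΦ.2.2
  have hKm := hK.measurableSet
  have hK1 : K ⊆ B n 1 := hKO.trans sdiff_subset
  obtain ⟨V, hV, hVu, hVg⟩ := exists_smooth_approx isOpen_ball_diff hv hw hD hK hKO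
  obtain ⟨M, hM, hΦb⟩ := hΦ.exists_bound
  have hfin : IsFiniteMeasure (volume.restrict K) := ⟨by simpa using hK.measure_lt_top⟩
  have hvm : AEStronglyMeasurable v (volume.restrict K) := (hv.mono hKO).aestronglyMeasurable hKm
  obtain ⟨Mv, hMv⟩ := hK.exists_bound_of_continuousOn (hv.mono hKO)
  have hDK := hD K hKO hK
  have hΦ0 : ∀ z, z ∉ K → Φ z = 0 := fun z hz => image_eq_zero_of_notMem_tsupport hz
  have hgΦ0 : ∀ z, z ∉ K → gradient Φ z = 0 := fun z hz => gradient_eq_zero_of_notMem hz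
  have hres : ∀ {f : Space n → ℝ}, (∀ z, z ∉ K → f z = 0) →
      ∫ z in B n 1, f z = ∫ z in K, f z := fun hf =>
    setIntegral_eq_of_subset_of_forall_sdiff_eq_zero Metric.isOpen_ball.measurableSet hK1
      fun z hz => hf z hz.2
  have hgm : ∀ m z, gradient (fun z => Φ z * V m z) z =
      Φ z • gradient (V m) z + V m z • gradient Φ z := fun m z =>
    gradient_mul (hΦ.1.differentiable (by simp) z) ((hV m).differentiable (by simp) z)
  have key : ∀ m, ∫ z in K, inner ℝ (H z) (Φ z • gradient (V m) z + V m z • gradient Φ z) =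
      ∫ z in K, h z * (Φ z * V m z) := fun m => by
    have h1 := heq _ (hΦ.mul_contDiffOn isOpen_ball_diff (hV m).contDiffOn)
    rw [hres (fun z hz => by simp [hgm, hΦ0 z hz, hgΦ0 z hz]),
      hres (fun z hz => by simp [hΦ0 z hz])] at h1
    simpa only [hgm] using h1
  have hgradΦ : Continuous (gradient Φ) := continuous_gradient hΦ.1
  have hlimit : MemLp (fun z => Φ z • Dv z + v z • gradient Φ z) 2 (volume.restrict K) := by
    refine MemLp.add (f := fun z => Φ z • Dv z) (g := fun z => v z • gradient Φ z) ?_ ?_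
    · refine hDK.of_le_mul (c := M) (hΦ.1.continuous.aestronglyMeasurable.smul hDK.1)
        (ae_of_all _ fun z => ?_)
      rw [norm_smul]
      exact mul_le_mul_of_nonneg_right (hΦb z).1 (norm_nonneg _)
    · refine MemLp.of_bound (hvm.smul hgradΦ.aestronglyMeasurable) (Mv * M) ?_
      filter_upwards [ae_restrict_mem hKm] with z hz
      rw [norm_smul]
      exact mul_le_mul (hMv z hz) (hΦb z).2 (norm_nonneg _) ((norm_nonneg _).trans (hMv z hz))
  have hseq : ∀ m, MemLp (fun z => Φ z • gradient (V m) z + V m z • gradient Φ z) 2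
      (volume.restrict K) := fun m => by
    have hc : Continuous fun z => Φ z • gradient (V m) z + V m z • gradient Φ z :=
      (hΦ.1.continuous.smul (continuous_gradient (hV m))).add ((hV m).continuous.smul hgradΦ)
    obtain ⟨c, hc'⟩ := hK.exists_bound_of_continuousOn hc.continuousOn
    refine MemLp.of_bound hc.aestronglyMeasurable c ?_
    filter_upwards [ae_restrict_mem hKm] with z hz using hc' z hz
  have l1 := tendsto_integral_inner (hH K hKO hK) hlimit hseq (by
    refine tendsto_eLpNorm_of_bound_add hM.le hM.le
      (fun m => (continuous_gradient (hV m)).aestronglyMeasurable.sub hDK.1)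
      (fun m => (hV m).continuous.aestronglyMeasurable.sub hvm) hVg
      (tendsto_eLpNorm_of_tendstoUniformlyOn hK hVu) fun m => ae_of_all _ fun z => ?_
    have e : Φ z • gradient (V m) z + V m z • gradient Φ z - (Φ z • Dv z + v z • gradient Φ z) =
        Φ z • (gradient (V m) z - Dv z) + (V m z - v z) • gradient Φ z := by module
    rw [e]
    refine (norm_add_le _ _).trans ?_
    rw [norm_smul, norm_smul, mul_comm ‖V m z - v z‖]
    exact add_le_add (mul_le_mul_of_nonneg_right (hΦb z).1 (norm_nonneg _))
      (mul_le_mul_of_nonneg_right (hΦb z).2 (norm_nonneg _)))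
  have l2 : Tendsto (fun m => ∫ z in K, h z * (Φ z * V m z)) atTop
      (𝓝 (∫ z in K, h z * (Φ z * v z))) := by
    refine tendsto_integral_filter_of_dominated_convergence (fun z => ‖h z‖ * (M * (Mv + 1)))
      (Eventually.of_forall fun m => ?_) ?_ ((hh K hKO hK).norm.mul_const _) ?_
    · exact (hh K hKO hK).1.mul (hΦ.1.continuous.mul (hV m).continuous).aestronglyMeasurable
    · filter_upwards [Metric.tendstoUniformlyOn_iff.1 hVu 1 one_pos] with m hm
      filter_upwards [ae_restrict_mem hKm] with z hz
      have h1 := hm z hz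
      rw [dist_comm, Real.dist_eq] at h1
      have h2 := hMv z hz
      rw [Real.norm_eq_abs] at h2
      have h3 := abs_sub_abs_le_abs_sub (V m z) (v z)
      rw [norm_mul, norm_mul]
      refine mul_le_mul_of_nonneg_left (mul_le_mul (hΦb z).1 ?_ (norm_nonneg _) hM.le)
        (norm_nonneg _)
      rw [Real.norm_eq_abs]
      linarith
    · filter_upwards [ae_restrict_mem hKm] with z hz
      exact ((hVu.tendsto_at hz).const_mul (Φ z)).const_mul (h z)
  simp only [key] at l1
  have := tendsto_nhds_unique l1 l2
  refine ⟨IntegrableOn.of_forall_sdiff_eq_zero (s := K) ?_ Metric.isOpen_ball.measurableSet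
      fun z hz => by simp [hΦ0 z hz.2, hgΦ0 z hz.2],
    IntegrableOn.of_forall_sdiff_eq_zero (s := K) ?_ Metric.isOpen_ball.measurableSet
      fun z hz => by simp [hΦ0 z hz.2], ?_⟩
  · simpa only [IntegrableOn, add_comm] using MemLp.integrable_inner' (hH K hKO hK) hlimit
  · refine ((hh K hKO hK).norm.mul_const (M * Mv)).mono'
      ((hh K hKO hK).1.mul (hΦ.1.continuous.aestronglyMeasurable.mul hvm)) ?_
    filter_upwards [ae_restrict_mem hKm] with z hz
    rw [norm_mul, norm_mul]
    exact mul_le_mul_of_nonneg_left (mul_le_mul (hΦb z).1 (hMv z hz) (norm_nonneg _) hM.le)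
      (norm_nonneg _)
  rw [hres (fun z hz => by simp [hΦ0 z hz, hgΦ0 z hz]), hres (fun z hz => by simp [hΦ0 z hz]),
    ← this]
  simp only [add_comm]

/-! ### Integration by parts in the `y` direction -/

/-- The integrand is ∂_y(uΦ), and Φ has compact support. The identity is elementary for the smooth
approximations of u and passes to the limit, the weight being bounded above and below on the support
of Φ. -/
lemma integral_mul_yc_gradient_add {β : ℝ} {u : Space n → ℝ} {g : Space n → Space n}
    {ψ : ℕ → Space n → ℝ} (hψ : ∀ k, ContDiffOn ℝ ∞ (ψ k) (B n 1))
    (hu2 : MemLp (fun z => |yc z| ^ β • u z) 2 (volume.restrict (B n 1)))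
    (hg2 : MemLp (fun z => |yc z| ^ β • g z) 2 (volume.restrict (B n 1)))
    (hu : Tendsto (fun k => eLpNorm (fun z => |yc z| ^ β • (ψ k z - u z)) 2
      (volume.restrict (B n 1))) atTop (𝓝 0))
    (hg : Tendsto (fun k => eLpNorm (fun z => |yc z| ^ β • (gradient (ψ k) z - g z)) 2
      (volume.restrict (B n 1))) atTop (𝓝 0))
    {Φ : Space n → ℝ} (hΦ : IsTest (B n 1 \ charSet n) Φ) :
    IntegrableOn (fun z => u z * yc (gradient Φ z) + Φ z * yc (g z)) (B n 1) ∧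
      ∫ z in B n 1, (u z * yc (gradient Φ z) + Φ z * yc (g z)) = 0 := by
  set K := tsupport Φ with hKdef
  have hK : IsCompact K := hΦ.2.1
  have hKO : K ⊆ B n 1 \ charSet n := hΦ.2.2
  have hKm := hK.measurableSet
  have hK1 : K ⊆ B n 1 := hKO.trans sdiff_subset
  have hfin : IsFiniteMeasure (volume.restrict K) := ⟨by simpa using hK.measure_lt_top⟩
  obtain ⟨M, hM, hΦb⟩ := hΦ.exists_bound
  have hΦ0 : ∀ z, z ∉ K → Φ z = 0 := fun z hz => image_eq_zero_of_notMem_tsupport hz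
  have hgΦ0 : ∀ z, z ∉ K → gradient Φ z = 0 := fun z hz => gradient_eq_zero_of_notMem hz
  have huK := memLp_compact_of_weighted hK hKO hu2
  have hgK := memLp_compact_of_weighted hK hKO hg2
  have hcΦ := hΦ.1.continuous
  have hcg : Continuous fun z => yc (gradient Φ z) := continuous_yc.comp (continuous_gradient hΦ.1)
  have hd : MemLp (fun z => yc (gradient Φ z)) 2 (volume.restrict K) :=
    MemLp.of_bound hcg.aestronglyMeasurable M
      (ae_of_all _ fun z => (abs_yc_le _).trans (hΦb z).2)
  have hΦe : MemLp (fun z => Φ z • ey n) 2 (volume.restrict K) :=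
    MemLp.of_bound (hcΦ.smul continuous_const).aestronglyMeasurable M
      (ae_of_all _ fun z => by rw [norm_smul, norm_ey, mul_one]; exact (hΦb z).1)
  have hbd : ∀ {E : Type} [NormedAddCommGroup E] {f : Space n → E}, ContinuousOn f K →
      AEStronglyMeasurable f (volume.restrict K) → MemLp f 2 (volume.restrict K) :=
    fun hf hm => by
      obtain ⟨c, hc⟩ := hK.exists_bound_of_continuousOn hf
      exact MemLp.of_bound hm c (by
        filter_upwards [ae_restrict_mem hKm] with z hz using hc z hz)
  have hψK : ∀ k, MemLp (ψ k) 2 (volume.restrict K) := fun k =>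
    hbd ((hψ k).continuousOn.mono hK1) (((hψ k).continuousOn.mono hK1).aestronglyMeasurable hKm)
  have hgψK : ∀ k, MemLp (gradient (ψ k)) 2 (volume.restrict K) := fun k =>
    hbd ((continuousOn_gradient Metric.isOpen_ball (hψ k)).mono hK1)
      (measurable_gradient _).aestronglyMeasurable
  have l1 := tendsto_integral_inner hd huK hψK (tendsto_eLpNorm_compact_of_weighted hK hKO hu)
  have l2 := tendsto_integral_inner hΦe hgK hgψK (tendsto_eLpNorm_compact_of_weighted hK hKO hg)
  have i1 : ∀ {f : Space n → ℝ}, MemLp f 2 (volume.restrict K) →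
      IntegrableOn (fun z => inner ℝ (yc (gradient Φ z)) (f z)) K := fun hf =>
    MemLp.integrable_inner' hd hf
  have i2 : ∀ {f : Space n → Space n}, MemLp f 2 (volume.restrict K) →
      IntegrableOn (fun z => inner ℝ (Φ z • ey n) (f z)) K := fun hf =>
    MemLp.integrable_inner' hΦe hf
  have e2 : ∀ (z w : Space n), inner ℝ (Φ z • ey n) w = Φ z * yc w := fun z w => by
    rw [inner_smul_left, real_inner_comm, inner_ey]; rfl
  have e1 : ∀ (z : Space n) (x : ℝ), inner ℝ (yc (gradient Φ z)) x = x * yc (gradient Φ z) :=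
    fun z x => by simp
  simp only [e1, e2] at l1 l2 i1 i2
  have hz : ∀ k, (∫ z in K, ψ k z * yc (gradient Φ z)) +
      ∫ z in K, Φ z * yc (gradient (ψ k) z) = 0 := fun k => by
    rw [← integral_add (i1 (hψK k)) (i2 (hgψK k))]
    have hsm : ContDiff ℝ ∞ fun z => Φ z * ψ k z :=
      contDiff_mul_of_tsupport_subset Metric.isOpen_ball hΦ.1 hK1 (hψ k)
    have hcs : HasCompactSupport fun z => Φ z * ψ k z := hΦ.2.1.mul_right
    have hcy : Continuous fun z => yc (gradient (fun z => Φ z * ψ k z) z) :=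
      continuous_yc.comp (continuous_gradient hsm)
    have hts : tsupport (fun z => Φ z * ψ k z) ⊆ K := tsupport_mul_subset_left
    have h0 : ∫ z, yc (gradient (fun z => Φ z * ψ k z) z) = 0 := by
      refine integral_lineDeriv_eq_zero (v := ey n)
        (hsm.continuous.integrable_of_hasCompactSupport hcs)
        (hcy.integrable_of_hasCompactSupport (hcs.mono' fun z hz => ?_)) fun z => ?_
      · by_contra h
        exact hz (by simp [gradient_eq_zero_of_notMem h, yc])
      · rw [yc_gradient]
        exact (hsm.differentiable (by simp) z).hasFDerivAt.hasLineDerivAt _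
    rw [← setIntegral_eq_integral_of_forall_compl_eq_zero (s := K) fun z hz => by
      rw [gradient_eq_zero_of_notMem fun h => hz (hts h)]; rfl] at h0
    rw [← h0]
    refine setIntegral_congr_fun hKm fun z hz => ?_
    have hdz : DifferentiableAt ℝ (ψ k) z :=
      ((hψ k).contDiffAt (Metric.isOpen_ball.mem_nhds (hK1 hz))).differentiableAt (by simp)
    simp only [gradient_mul (hΦ.1.differentiable (by simp) z) hdz, yc_add, yc_smul]
    ring
  have hlim := tendsto_nhds_unique (l1.add l2) (by simp only [hz]; exact tendsto_const_nhds)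
  refine ⟨IntegrableOn.of_forall_sdiff_eq_zero ((i1 huK).add (i2 hgK))
    Metric.isOpen_ball.measurableSet fun z hz => by simp [hΦ0 z hz.2, hgΦ0 z hz.2, yc], ?_⟩
  rw [setIntegral_eq_of_subset_of_forall_sdiff_eq_zero Metric.isOpen_ball.measurableSet hK1
    fun z hz => by simp [hΦ0 z hz.2, hgΦ0 z hz.2, yc], integral_add (i1 huK) (i2 hgK)]
  exact hlim

/-! ### The quotient belongs to the weighted Sobolev space -/

lemma exists_cutoff_ball {r : ℝ} (hr : 0 < r) (hr1 : r < 1) : ∃ ζ : Space n → ℝ,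
    IsTest (B n 1) ζ ∧ ∀ z ∈ B n r, ζ z = 1 ∧ gradient ζ z = 0 := by
  let ζ : ContDiffBump (0 : Space n) := ⟨r, (1 + r) / 2, hr, by linarith⟩
  refine ⟨ζ, ⟨ζ.contDiff, ζ.hasCompactSupport, ?_⟩, fun z hz => ?_⟩
  · rw [ζ.tsupport_eq]
    exact Metric.closedBall_subset_ball (show (1 + r) / 2 < 1 by linarith)
  · have h1 : ∀ w ∈ B n r, ζ w = 1 := fun w hw =>
      ζ.one_of_mem_closedBall (Metric.ball_subset_closedBall hw)
    have h2 : (ζ : Space n → ℝ) =ᶠ[𝓝 z] fun _ => 1 := by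
      filter_upwards [Metric.isOpen_ball.mem_nhds hz] with w hw using h1 w hw
    exact ⟨h1 z hz, by rw [h2.gradient_eq, gradient_fun_const]⟩

lemma exists_index_le_of_tendsto {μ : Measure (Space n)} {s : Space n → ℝ} {E : Type*}
    [NormedAddCommGroup E] [NormedSpace ℝ E] {F : ℕ → Space n → E} {f : Space n → E}
    (hs : AEStronglyMeasurable s μ) (hF : ∀ k, AEStronglyMeasurable (F k) μ)
    (hf : AEStronglyMeasurable f μ)
    (h : Tendsto (fun k => eLpNorm (fun z => s z • (F k z - f z)) 2 μ) atTop (𝓝 0)) :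
    ∀ δ : ℝ≥0∞, 0 < δ → ∃ N, ∀ k ≥ N, ∀ l ≥ N,
      eLpNorm (fun z => s z • (F k z - F l z)) 2 μ ≤ δ := by
  intro δ hδ
  obtain ⟨N, hN⟩ := eventually_atTop.1 (ENNReal.tendsto_nhds_zero.1 h (δ / 2)
    (ENNReal.half_pos hδ.ne'))
  refine ⟨N, fun k hk l hl => ?_⟩
  have e : (fun z => s z • (F k z - F l z)) =
      (fun z => s z • (F k z - f z)) - fun z => s z • (F l z - f z) := by
    funext z
    simp only [Pi.sub_apply, ← smul_sub]
    congr 1; abel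
  rw [e]
  refine (eLpNorm_sub_le (hs.smul ((hF k).sub hf)) (hs.smul ((hF l).sub hf)) (by norm_num)).trans ?_
  calc _ ≤ δ / 2 + δ / 2 := add_le_add (hN k hk) (hN l hl)
    _ = δ := ENNReal.add_halves δ

/-- The weighted Sobolev estimate applied to Φ_k - Φ_l makes |G|Φ_k a Cauchy sequence in the
weighted L². Its limit is |G|ζu, and ζ = 1 with zero gradient on B_r. In this way an estimate proved
for test functions off Σ reaches u. -/
lemma exists_test_approx_mul (hn : 1 ≤ n) {d : ℝ} (hd4 : 4 ≤ d) (hdn : n + 1 ≤ d) {b : ℝ}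
    {G : Space n → Space n} (hGm : AEStronglyMeasurable G (volume.restrict (B n 1)))
    (hG : ∫⁻ z in B n 1, ENNReal.ofReal (|yc z|) ^ (d - (n + 1)) * ‖G z‖ₑ ^ d ≠ ⊤)
    {u : Space n → ℝ} {g : Space n → Space n}
    {ψ : ℕ → Space n → ℝ} (hψ : ∀ k, ContDiffOn ℝ ∞ (ψ k) (B n 1))
    (hum : AEStronglyMeasurable u (volume.restrict (B n 1)))
    (hgm : AEStronglyMeasurable g (volume.restrict (B n 1)))
    (hu2 : MemLp (fun z => |yc z| ^ (b / 2) • u z) 2 (volume.restrict (B n 1)))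
    (hg2 : MemLp (fun z => |yc z| ^ (b / 2) • g z) 2 (volume.restrict (B n 1)))
    (hu : Tendsto (fun k => eLpNorm (fun z => |yc z| ^ (b / 2) • (ψ k z - u z)) 2
      (volume.restrict (B n 1))) atTop (𝓝 0))
    (hg : Tendsto (fun k => eLpNorm (fun z => |yc z| ^ (b / 2) • (gradient (ψ k) z - g z)) 2
      (volume.restrict (B n 1))) atTop (𝓝 0))
    (hy : MemLp (fun z => |yc z| ^ (b / 2 - 1) * u z) 2 (volume.restrict (B n 1)))
    {r : ℝ} (hr : 0 < r) (hr1 : r < 1) :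
    ∃ Φ : ℕ → Space n → ℝ, (∀ k, IsTest (B n 1 \ charSet n) (Φ k)) ∧
      Tendsto (fun k => eLpNorm (fun z => |yc z| ^ (b / 2) * (Φ k z - u z)) 2
        (volume.restrict (B n r))) atTop (𝓝 0) ∧
      Tendsto (fun k => eLpNorm (fun z => |yc z| ^ (b / 2) • (gradient (Φ k) z - g z)) 2
        (volume.restrict (B n r))) atTop (𝓝 0) ∧
      Tendsto (fun k => eLpNorm (fun z => |yc z| ^ (b / 2 - 1) * (Φ k z - u z)) 2
        (volume.restrict (B n r))) atTop (𝓝 0) ∧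
      Tendsto (fun k => eLpNorm (fun z => |yc z| ^ (b / 2) * (Φ k z - u z) * ‖G z‖) 2
        (volume.restrict (B n r))) atTop (𝓝 0) ∧
      MemLp (fun z => |yc z| ^ (b / 2) * u z * ‖G z‖) 2 (volume.restrict (B n r)) := by
  obtain ⟨ζ, hζ, hζr⟩ := exists_cutoff_ball (n := n) hr hr1
  obtain ⟨Φ, hΦ, t1, t2, t3⟩ := exists_test_approx hψ hum hgm hu2 hg2 hu hg hy hζ
  obtain ⟨C, hC, hmul⟩ := exists_eLpNorm_mul_le hn hd4 hdn b hGm hG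
  have hle : volume.restrict (B n r) ≤ (volume.restrict (B n 1) : Measure (Space n)) :=
    Measure.restrict_mono (Metric.ball_subset_ball hr1.le) le_rfl
  have hB : ∀ᵐ z ∂(volume.restrict (B n r)), z ∈ B n r :=
    ae_restrict_mem Metric.isOpen_ball.measurableSet
  have hζu : AEStronglyMeasurable (fun z => ζ z * u z) (volume.restrict (B n 1)) :=
    hζ.1.continuous.aestronglyMeasurable.mul hum
  have hζg : AEStronglyMeasurable (fun z => ζ z • g z + u z • gradient ζ z)
      (volume.restrict (B n 1)) :=
    (hζ.1.continuous.aestronglyMeasurable.smul hgm).add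
      (hum.smul (continuous_gradient hζ.1).aestronglyMeasurable)
  have hs : ∀ β : ℝ, AEStronglyMeasurable (fun z : Space n => |yc z| ^ β)
      (volume.restrict (B n 1)) := fun β => (measurable_pow_yc β).aestronglyMeasurable
  have hΦm : ∀ k, AEStronglyMeasurable (Φ k) (volume.restrict (B n 1)) := fun k =>
    (hΦ k).1.continuous.aestronglyMeasurable
  have hgΦm : ∀ k, AEStronglyMeasurable (gradient (Φ k)) (volume.restrict (B n 1)) := fun k =>
    (continuous_gradient (hΦ k).1).aestronglyMeasurable
  have t4 : Tendsto (fun k => eLpNorm (fun z => |yc z| ^ (b / 2) * (Φ k z - ζ z * u z) * ‖G z‖) 2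
      (volume.restrict (B n 1))) atTop (𝓝 0) := by
    refine tendsto_eLpNorm_mul_of_cauchy (hs _) hGm.norm hζu hΦm t1 fun δ hδ => ?_
    -- Two terms of this size multiplied by C sum to at most δ; the added 1 keeps the denominator
    -- nonzero when C = 0.
    have hδ' : 0 < δ / (2 * C + 1) := ENNReal.div_pos hδ.ne' (by finiteness)
    obtain ⟨N₁, h1⟩ := exists_index_le_of_tendsto (hs _) hgΦm hζg t2 _ hδ'
    obtain ⟨N₂, h2⟩ := exists_index_le_of_tendsto (hs (b / 2 - 1)) hΦm hζu t3 _ hδ'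
    refine ⟨max N₁ N₂, fun k hk l hl => ?_⟩
    have h3 := hmul _ ((hΦ k).sub (hΦ l))
    refine h3.trans ?_
    have e : ∀ z, gradient (fun z => Φ k z - Φ l z) z = gradient (Φ k) z - gradient (Φ l) z :=
      fun z => gradient_sub' ((hΦ k).1.differentiable (by simp) z)
        ((hΦ l).1.differentiable (by simp) z)
    simp only [e]
    calc _ ≤ C * (δ / (2 * C + 1) + δ / (2 * C + 1)) :=
          mul_le_mul_right (add_le_add
            (h1 k ((le_max_left _ _).trans hk) l ((le_max_left _ _).trans hl))
            (h2 k ((le_max_right _ _).trans hk) l ((le_max_right _ _).trans hl))) _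
      _ = 2 * C * (δ / (2 * C + 1)) := by ring
      _ ≤ (2 * C + 1) * (δ / (2 * C + 1)) := mul_le_mul_left le_self_add _
      _ = δ := ENNReal.mul_div_cancel (by simp) (by finiteness)
  have hmono : ∀ {E : Type} [NormedAddCommGroup E] {F F' : ℕ → Space n → E},
      (∀ k, ∀ z ∈ B n r, F k z = F' k z) →
      Tendsto (fun k => eLpNorm (F' k) 2 (volume.restrict (B n 1))) atTop (𝓝 0) →
      Tendsto (fun k => eLpNorm (F k) 2 (volume.restrict (B n r))) atTop (𝓝 0) :=
    fun {E _ F F'} h ht => by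
      refine tendsto_of_tendsto_of_tendsto_of_le_of_le tendsto_const_nhds ht (fun _ => zero_le)
        fun k => ?_
      rw [eLpNorm_congr_ae (g := F' k) (by filter_upwards [hB] with z hz using h k z hz)]
      exact eLpNorm_mono_measure _ hle
  refine ⟨Φ, hΦ, hmono (fun k z hz => ?_) t1, hmono (fun k z hz => ?_) t2,
    hmono (fun k z hz => ?_) t3, hmono (fun k z hz => ?_) t4, ?_⟩
  · rw [(hζr z hz).1, one_mul]
  · rw [(hζr z hz).1, (hζr z hz).2, one_smul, smul_zero, add_zero]
  · rw [(hζr z hz).1, one_mul]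
  · rw [(hζr z hz).1, one_mul]
  -- Some Φ_k is at finite distance from ζu in the norm weighted by G and has finite norm itself, so
  -- the limit has finite norm.
  obtain ⟨k, hk⟩ := (t4.eventually (gt_mem_nhds ENNReal.zero_lt_top)).exists
  have m1 : MemLp (fun z => |yc z| ^ (b / 2) * (Φ k z - ζ z * u z) * ‖G z‖) 2
      (volume.restrict (B n 1)) :=
    ⟨((hs _).mul ((hΦm k).sub hζu)).mul hGm.norm, hk⟩
  have m2 : MemLp (fun z => |yc z| ^ (b / 2) * Φ k z * ‖G z‖) 2 (volume.restrict (B n 1)) := by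
    refine ⟨((hs _).mul (hΦm k)).mul hGm.norm, (hmul _ (hΦ k)).trans_lt ?_⟩
    exact ENNReal.mul_lt_top hC.lt_top (ENNReal.add_lt_top.2
      ⟨((hΦ k).memLp_weighted _).2.2, ((hΦ k).memLp_weighted _).1.2⟩)
  refine ((m2.sub m1).mono_measure hle).ae_eq ?_
  filter_upwards [hB] with z hz
  simp only [Pi.sub_apply, (hζr z hz).1]
  ring

/-- Exponent count (2-b)/2 = b/2 + (1-b): division by v exchanges the ω-weight for the ρ-weight. -/
lemma rpow_mul_inv_le {b c v y : ℝ} (hc : 0 < c) (hy : y ≠ 0) (hv : c * |y| ^ (1 - b) ≤ |v|) :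
    |y| ^ ((2 - b) / 2) * |v|⁻¹ ≤ c⁻¹ * |y| ^ (b / 2) := by
  have hy' : 0 < |y| := abs_pos.2 hy
  have hp : 0 < |y| ^ (1 - b) := Real.rpow_pos_of_pos hy' _
  have e : |y| ^ ((2 - b) / 2) = |y| ^ (b / 2) * |y| ^ (1 - b) := by
    rw [← Real.rpow_add hy']; congr 1; ring
  have hv' : 0 < |v| := (by positivity : 0 < c * |y| ^ (1 - b)).trans_le hv
  rw [← div_eq_mul_inv, div_le_iff₀ hv', e]
  calc |y| ^ (b / 2) * |y| ^ (1 - b) = c⁻¹ * |y| ^ (b / 2) * (c * |y| ^ (1 - b)) := by field_simp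
    _ ≤ _ := mul_le_mul_of_nonneg_left hv (by positivity)

/-- Inserting the bound on ∇v into v⁻¹(∇x - (x/v)∇v) leaves three norms of the numerator: the
gradient, the product with G, and the Hardy quotient. -/
lemma norm_weighted_quotient_gradient_le {b c C v y x Γ : ℝ} {X D : Space n} (hc : 0 < c)
    (hC : 0 ≤ C) (hy : y ≠ 0) (hv : c * |y| ^ (1 - b) ≤ |v|) (hD : ‖D‖ ≤ C * |v| * (Γ + |y|⁻¹)) :
    ‖|y| ^ ((2 - b) / 2) • v⁻¹ • (X - (x / v) • D)‖ ≤
      c⁻¹ * ‖|y| ^ (b / 2) • X‖ +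
        c⁻¹ * C * (‖|y| ^ (b / 2) * x * Γ‖ + ‖|y| ^ (b / 2 - 1) * x‖) := by
  have hy' : 0 < |y| := abs_pos.2 hy
  have hv' : 0 < |v| := (by positivity : 0 < c * |y| ^ (1 - b)).trans_le hv
  have h1 : ‖(x / v) • D‖ ≤ C * |x| * (Γ + |y|⁻¹) := by
    rw [norm_smul, Real.norm_eq_abs, abs_div]
    calc |x| / |v| * ‖D‖ ≤ |x| / |v| * (C * |v| * (Γ + |y|⁻¹)) :=
          mul_le_mul_of_nonneg_left hD (by positivity)
      _ = _ := by field_simp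
  have h2 : C * |x| * (Γ + |y|⁻¹) * |y| ^ (b / 2) =
      C * (|y| ^ (b / 2) * |x| * Γ + |y| ^ (b / 2 - 1) * |x|) := by
    rw [Real.rpow_sub_one hy'.ne']
    ring
  have hΓ : |y| ^ (b / 2) * |x| * Γ ≤ ‖|y| ^ (b / 2) * x * Γ‖ := by
    rw [norm_mul, norm_mul, Real.norm_of_nonneg (Real.rpow_nonneg hy'.le _)]
    exact mul_le_mul_of_nonneg_left (Real.le_norm_self _) (by positivity)
  rw [norm_smul, norm_smul, norm_inv, Real.norm_eq_abs v,
    Real.norm_of_nonneg (Real.rpow_nonneg hy'.le _), ← mul_assoc]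
  calc |y| ^ ((2 - b) / 2) * |v|⁻¹ * ‖X - (x / v) • D‖
      ≤ c⁻¹ * |y| ^ (b / 2) * (‖X‖ + C * |x| * (Γ + |y|⁻¹)) :=
        mul_le_mul (rpow_mul_inv_le hc hy hv)
          ((norm_sub_le _ _).trans (add_le_add le_rfl h1)) (norm_nonneg _) (by positivity)
    _ = c⁻¹ * (|y| ^ (b / 2) * ‖X‖) +
        c⁻¹ * (C * |x| * (Γ + |y|⁻¹) * |y| ^ (b / 2)) := by ring
    _ = c⁻¹ * (|y| ^ (b / 2) * ‖X‖) +
        c⁻¹ * C * (|y| ^ (b / 2) * |x| * Γ + |y| ^ (b / 2 - 1) * |x|) := by rw [h2]; ring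
    _ ≤ _ := by
      rw [norm_smul, Real.norm_of_nonneg (Real.rpow_nonneg hy'.le (b / 2))]
      refine add_le_add le_rfl (mul_le_mul_of_nonneg_left (add_le_add hΓ ?_) (by positivity))
      rw [norm_mul, Real.norm_of_nonneg (Real.rpow_nonneg hy'.le _), Real.norm_eq_abs]

lemma aestronglyMeasurable_of_continuousOn {v : Space n → ℝ} {r : ℝ} (hr : r ≤ 1)
    (hv : ContinuousOn v (B n 1 \ charSet n)) :
    AEStronglyMeasurable v (volume.restrict (B n r)) := by
  have := hv.aestronglyMeasurable (μ := volume) isOpen_ball_diff.measurableSet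
  rw [restrict_ball_diff] at this
  exact this.mono_measure (Measure.restrict_mono (Metric.ball_subset_ball hr) le_rfl)

lemma aestronglyMeasurable_of_locallyIntegrableOn {D : Space n → Space n} {r : ℝ} (hr : r ≤ 1)
    (hD : LocallyIntegrableOn D (B n 1 \ charSet n)) :
    AEStronglyMeasurable D (volume.restrict (B n r)) := by
  have := hD.aestronglyMeasurable
  rw [restrict_ball_diff] at this
  exact this.mono_measure (Measure.restrict_mono (Metric.ball_subset_ball hr) le_rfl)

/-- Two approximations are composed: Φ_k/v converges to u/v by the three-norm bound, and each Φ_k/v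
is approximated by smooth functions on B_1. The diagonal sequence shows that u/v is in the closure.
-/
lemma memH1_quotient {b r : ℝ} (hr1 : r ≤ 1) {v u : Space n → ℝ} {Dv g G : Space n → Space n}
    (hv : ContinuousOn v (B n 1 \ charSet n))
    (hcv : Comparable (fun z => |v z|) (B n 1) (1 - b))
    (hw : ∀ φ : Space n → ℝ, IsTest (B n 1 \ charSet n) φ →
      ∫ z in B n 1 \ charSet n, v z • gradient φ z = -∫ z in B n 1 \ charSet n, φ z • Dv z)
    (hDm : LocallyIntegrableOn Dv (B n 1 \ charSet n))
    (hD : ∀ K ⊆ B n 1 \ charSet n, IsCompact K → MemLp Dv 2 (volume.restrict K))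
    {C : ℝ} (hC : 0 < C) (hDb : ∀ᵐ z ∂(volume.restrict (B n 1)),
      ‖Dv z‖ ≤ C * |v z| * (‖G z‖ + |yc z|⁻¹))
    (hGm : AEStronglyMeasurable G (volume.restrict (B n r)))
    (hu2 : MemLp (fun z => |yc z| ^ (b / 2) • u z) 2 (volume.restrict (B n r)))
    (hum : AEStronglyMeasurable u (volume.restrict (B n r)))
    (hgm : AEStronglyMeasurable g (volume.restrict (B n r)))
    (hg2 : MemLp (fun z => |yc z| ^ (b / 2) • g z) 2 (volume.restrict (B n r)))
    (hy : MemLp (fun z => |yc z| ^ (b / 2 - 1) * u z) 2 (volume.restrict (B n r)))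
    (huG : MemLp (fun z => |yc z| ^ (b / 2) * u z * ‖G z‖) 2 (volume.restrict (B n r)))
    {Φ : ℕ → Space n → ℝ} (hΦ : ∀ k, IsTest (B n 1 \ charSet n) (Φ k))
    (t1 : Tendsto (fun k => eLpNorm (fun z => |yc z| ^ (b / 2) * (Φ k z - u z)) 2
        (volume.restrict (B n r))) atTop (𝓝 0))
    (t2 : Tendsto (fun k => eLpNorm (fun z => |yc z| ^ (b / 2) • (gradient (Φ k) z - g z)) 2
        (volume.restrict (B n r))) atTop (𝓝 0))
    (t3 : Tendsto (fun k => eLpNorm (fun z => |yc z| ^ (b / 2 - 1) * (Φ k z - u z)) 2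
        (volume.restrict (B n r))) atTop (𝓝 0))
    (t4 : Tendsto (fun k => eLpNorm (fun z => |yc z| ^ (b / 2) * (Φ k z - u z) * ‖G z‖) 2
        (volume.restrict (B n r))) atTop (𝓝 0))
    {q : Space n → ℝ} (hq : Measurable q) (hcq : Comparable q (B n 1) (2 - b)) :
    MemH1 q (B n r) (fun z => u z / v z) fun z => (v z)⁻¹ • (g z - (u z / v z) • Dv z) := by
  have hcqr := hcq.mono (Metric.ball_subset_ball hr1)
  have hv0 : ∀ z ∈ B n 1 \ charSet n, v z ≠ 0 := fun z hz => abs_pos.1 (hcv.pos hz.1 hz.2)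
  obtain ⟨c, C', hc, -, hcv⟩ := hcv
  have hae : ∀ᵐ z ∂(volume.restrict (B n r)), yc z ≠ 0 ∧ c * |yc z| ^ (1 - b) ≤ |v z| ∧
      ‖Dv z‖ ≤ C * |v z| * (‖G z‖ + |yc z|⁻¹) := by
    filter_upwards [ae_restrict_ball,
      ae_restrict_of_ae_restrict_of_subset (Metric.ball_subset_ball hr1) hDb] with z hz hz'
    exact ⟨hz.2, (hcv z (Metric.ball_subset_ball hr1 hz.1) hz.2).1, hz'⟩
  have hvm := aestronglyMeasurable_of_continuousOn hr1 hv
  have hDvm := aestronglyMeasurable_of_locallyIntegrableOn hr1 hDm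
  have hs : ∀ β : ℝ, AEStronglyMeasurable (fun z : Space n => |yc z| ^ β)
      (volume.restrict (B n r)) := fun β => (measurable_pow_yc β).aestronglyMeasurable
  have hqm : ∀ {x : Space n → ℝ} {X : Space n → Space n},
      AEStronglyMeasurable x (volume.restrict (B n r)) →
      AEStronglyMeasurable X (volume.restrict (B n r)) →
      AEStronglyMeasurable (fun z => (v z)⁻¹ • (X z - (x z / v z) • Dv z))
        (volume.restrict (B n r)) := fun hx hX =>
    hvm.inv₀.smul (hX.sub ((hx.mul hvm.inv₀).smul hDvm))
  -- The exceptional null set does not depend on x. Since the quotient and its formal gradient are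
  -- linear in the numerator, the same two bounds give finiteness for u and convergence for Φ_k - u.
  have hbound1 : ∀ᵐ z ∂(volume.restrict (B n r)), ∀ x : ℝ,
      ‖|yc z| ^ ((2 - b) / 2) • (x / v z)‖ ≤ c⁻¹ * ‖|yc z| ^ (b / 2) * x‖ := by
    filter_upwards [hae] with z hz x
    have h := rpow_mul_inv_le hc hz.1 hz.2.1
    rw [norm_smul, norm_div, norm_mul, Real.norm_of_nonneg (Real.rpow_nonneg (abs_nonneg _) _),
      Real.norm_of_nonneg (Real.rpow_nonneg (abs_nonneg _) _), div_eq_mul_inv, ← mul_assoc,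
      Real.norm_eq_abs (v z)]
    calc _ = |yc z| ^ ((2 - b) / 2) * |v z|⁻¹ * ‖x‖ := by ring_nf
      _ ≤ c⁻¹ * |yc z| ^ (b / 2) * ‖x‖ := mul_le_mul_of_nonneg_right h (norm_nonneg _)
      _ = _ := by ring
  have hbound2 : ∀ᵐ z ∂(volume.restrict (B n r)), ∀ (x : ℝ) (X : Space n),
      ‖|yc z| ^ ((2 - b) / 2) • (v z)⁻¹ • (X - (x / v z) • Dv z)‖ ≤
        c⁻¹ * ‖|yc z| ^ (b / 2) • X‖ + c⁻¹ * C *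
          ‖(‖|yc z| ^ (b / 2) * x * ‖G z‖‖ + ‖|yc z| ^ (b / 2 - 1) * x‖)‖ := by
    filter_upwards [hae] with z hz x X
    rw [Real.norm_of_nonneg (by positivity : 0 ≤ ‖|yc z| ^ (b / 2) * x * ‖G z‖‖ +
      ‖|yc z| ^ (b / 2 - 1) * x‖)]
    exact norm_weighted_quotient_gradient_le hc hC.le hz.1 hz.2.1 hz.2.2
  have hΦm : ∀ k, AEStronglyMeasurable (Φ k) (volume.restrict (B n r)) := fun k =>
    (hΦ k).1.continuous.aestronglyMeasurable
  have hgΦm : ∀ k, AEStronglyMeasurable (gradient (Φ k)) (volume.restrict (B n r)) := fun k =>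
    (continuous_gradient (hΦ k).1).aestronglyMeasurable
  have m34 : ∀ {x : Space n → ℝ}, AEStronglyMeasurable x (volume.restrict (B n r)) →
      AEStronglyMeasurable (fun z => ‖|yc z| ^ (b / 2) * x z * ‖G z‖‖ +
        ‖|yc z| ^ (b / 2 - 1) * x z‖) (volume.restrict (B n r)) := fun hx =>
    (((hs _).mul hx).mul hGm.norm).norm.add ((hs _).mul hx).norm
  have t34 : Tendsto (fun k => eLpNorm (fun z => ‖|yc z| ^ (b / 2) * (Φ k z - u z) * ‖G z‖‖ +
      ‖|yc z| ^ (b / 2 - 1) * (Φ k z - u z)‖) 2 (volume.restrict (B n r))) atTop (𝓝 0) := by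
    refine tendsto_eLpNorm_of_bound_add zero_le_one zero_le_one
      (fun k => ((hs _).mul ((hΦm k).sub hum)).mul hGm.norm)
      (fun k => (hs _).mul ((hΦm k).sub hum)) t4 t3 fun k => ae_of_all _ fun z => ?_
    rw [one_mul, one_mul, Real.norm_of_nonneg (by positivity)]
    exact le_rfl
  -- convergence of the quotients `Φ k / v`
  have c1 : Tendsto (fun k => eLpNorm (fun z => |yc z| ^ ((2 - b) / 2) •
      (Φ k z / v z - u z / v z)) 2 (volume.restrict (B n r))) atTop (𝓝 0) := by
    refine tendsto_eLpNorm_of_bound c⁻¹ t1 fun k => ?_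
    filter_upwards [hbound1] with z hz
    rw [← sub_div]
    exact hz _
  have c2 : Tendsto (fun k => eLpNorm (fun z => |yc z| ^ ((2 - b) / 2) •
      ((v z)⁻¹ • (gradient (Φ k) z - (Φ k z / v z) • Dv z) -
        (v z)⁻¹ • (g z - (u z / v z) • Dv z))) 2 (volume.restrict (B n r))) atTop (𝓝 0) := by
    refine tendsto_eLpNorm_of_bound_add (C := c⁻¹) (C' := c⁻¹ * C) (by positivity) (by positivity)
      (fun k => (hs _).smul ((hgΦm k).sub hgm)) (fun k => m34 ((hΦm k).sub hum)) t2 t34 fun k => ?_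
    filter_upwards [hbound2] with z hz
    have e : (v z)⁻¹ • (gradient (Φ k) z - (Φ k z / v z) • Dv z) -
        (v z)⁻¹ • (g z - (u z / v z) • Dv z) =
        (v z)⁻¹ • ((gradient (Φ k) z - g z) - ((Φ k z - u z) / v z) • Dv z) := by
      rw [sub_div]; module
    rw [e]
    exact hz _ _
  choose W hW w1 w2 using fun k => exists_quotient_approx hv hv0 hw hD (hΦ k) ((2 - b) / 2)
  have hδ : ∀ k : ℕ, (0 : ℝ≥0∞) < ((k : ℝ≥0∞) + 1)⁻¹ := fun k =>
    ENNReal.inv_pos.2 (by finiteness)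
  choose m hm using fun k => ((ENNReal.tendsto_nhds_zero.1 (w1 k) _ (hδ k)).and
    (ENNReal.tendsto_nhds_zero.1 (w2 k) _ (hδ k))).exists
  have hδ0 : Tendsto (fun k : ℕ => ((k : ℝ≥0∞) + 1)⁻¹) atTop (𝓝 0) := by
    have := (tendsto_add_atTop_iff_nat 1).2 ENNReal.tendsto_inv_nat_nhds_zero
    simpa using this
  have hle : volume.restrict (B n r) ≤ (volume.restrict (B n 1) : Measure (Space n)) :=
    Measure.restrict_mono (Metric.ball_subset_ball hr1) le_rfl
  have combine : ∀ {E : Type} [NormedAddCommGroup E] [NormedSpace ℝ E] {F f : ℕ → Space n → E}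
      {h : Space n → E}, (∀ k, AEStronglyMeasurable (F k) (volume.restrict (B n r))) →
      (∀ k, AEStronglyMeasurable (f k) (volume.restrict (B n r))) →
      AEStronglyMeasurable h (volume.restrict (B n r)) →
      (∀ k, eLpNorm (fun z => |yc z| ^ ((2 - b) / 2) • (F k z - f k z)) 2
        (volume.restrict (B n 1)) ≤ ((k : ℝ≥0∞) + 1)⁻¹) →
      Tendsto (fun k => eLpNorm (fun z => |yc z| ^ ((2 - b) / 2) • (f k z - h z)) 2
        (volume.restrict (B n r))) atTop (𝓝 0) →
      Tendsto (fun k => eLpNorm (fun z => |yc z| ^ ((2 - b) / 2) • (F k z - h z)) 2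
        (volume.restrict (B n r))) atTop (𝓝 0) := fun {E _ _ F f h} hF hf hh h1 h2 => by
    refine tendsto_of_tendsto_of_tendsto_of_le_of_le tendsto_const_nhds
      (by simpa using hδ0.add h2) (fun _ => zero_le) fun k => ?_
    have e : (fun z => |yc z| ^ ((2 - b) / 2) • (F k z - h z)) =
        (fun z => |yc z| ^ ((2 - b) / 2) • (F k z - f k z)) +
          fun z => |yc z| ^ ((2 - b) / 2) • (f k z - h z) := by
      funext z
      simp only [Pi.add_apply, ← smul_add]
      congr 1; abel
    rw [e]
    refine (eLpNorm_add_le ((hs _).smul ((hF k).sub (hf k))) ((hs _).smul ((hf k).sub hh))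
      (by norm_num)).trans (add_le_add ((eLpNorm_mono_measure _ hle).trans (h1 k)) le_rfl)
  have hwm : AEStronglyMeasurable (fun z => u z / v z) (volume.restrict (B n r)) :=
    hum.mul hvm.inv₀
  refine ⟨(hcqr.memLp_iff hq).2 ?_, (hcqr.memLp_iff hq).2 ?_, fun k => W k (m k),
    fun k => ContDiff.smoothUpTo (hW k (m k)), (hcqr.tendsto_iff hq).2 ?_,
    (hcqr.tendsto_iff hq).2 ?_⟩
  · refine hu2.of_le_mul (c := c⁻¹) ((hs _).smul hwm) ?_
    filter_upwards [hbound1] with z hz using hz _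
  · have h1 := (hg2.norm.const_mul c⁻¹).add ((huG.norm.add hy.norm).const_mul (c⁻¹ * C))
    refine h1.mono ((hs _).smul (hqm hum hgm)) ?_
    filter_upwards [hbound2] with z hz
    refine (hz _ _).trans (le_trans (le_of_eq ?_) (Real.le_norm_self _))
    simp only [Pi.add_apply]
    rw [Real.norm_of_nonneg (by positivity : 0 ≤ ‖|yc z| ^ (b / 2) * u z * ‖G z‖‖ +
      ‖|yc z| ^ (b / 2 - 1) * u z‖)]
  · exact combine (fun k => (hW k (m k)).continuous.aestronglyMeasurable)
      (fun k => (hΦm k).mul hvm.inv₀) hwm (fun k => (hm k).1) c1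
  · exact combine (fun k => (continuous_gradient (hW k (m k))).aestronglyMeasurable)
      (fun k => hqm (hΦm k) (hgΦm k)) (hqm hum hgm) (fun k => (hm k).2) c2

/-! ### Weighted products and removal of the cutoff -/

/-- Cauchy–Schwarz after splitting the weight evenly, |y|^β = |y|^(β/2) |y|^(β/2). -/
lemma integrableOn_weighted_mul {E F E' : Type*} [NormedAddCommGroup E] [NormedSpace ℝ E]
    [NormedAddCommGroup F] [NormedSpace ℝ F] [NormedAddCommGroup E'] [NormedSpace ℝ E'] {p : Space n → ℝ} {r β : ℝ}
    (hp : AEStronglyMeasurable p (volume.restrict (B n r))) (hc : Comparable p (B n r) β)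
    {f : Space n → E} {h : Space n → F}
    (hf : MemLp (fun z => |yc z| ^ (β / 2) • f z) 2 (volume.restrict (B n r)))
    (hh : MemLp (fun z => |yc z| ^ (β / 2) • h z) 2 (volume.restrict (B n r))) {k : Space n → E'}
    (hkm : AEStronglyMeasurable k (volume.restrict (B n r))) {M : ℝ}
    (hk : ∀ᵐ z ∂(volume.restrict (B n r)), ‖k z‖ ≤ M * (‖f z‖ * ‖h z‖)) :
    IntegrableOn (fun z => p z • k z) (B n r) := by
  have hpos := hc
  obtain ⟨c, C, -, hC, hb⟩ := hc
  refine ((hf.norm.integrable_mul hh.norm).const_mul (C * M)).mono' (hp.smul hkm) ?_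
  filter_upwards [ae_restrict_ball, hk] with z hz hkz
  have hy : 0 < |yc z| := abs_pos.2 hz.2
  have hpz := hpos.pos hz.1 hz.2
  have e : |yc z| ^ β = |yc z| ^ (β / 2) * |yc z| ^ (β / 2) := by
    rw [← Real.rpow_add hy]; congr 1; ring
  rw [norm_smul, Real.norm_of_nonneg hpz.le]
  simp only [Pi.mul_apply, norm_smul, Real.norm_of_nonneg (Real.rpow_nonneg hy.le (β / 2))]
  calc p z * ‖k z‖ ≤ (C * |yc z| ^ β) * (M * (‖f z‖ * ‖h z‖)) :=
        mul_le_mul (hb z hz.1 hz.2).2 hkz (norm_nonneg _) (by positivity)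
    _ = _ := by rw [e]; ring

/-- The identity is tested with φη_j. Since |∇(φη_j)| is at most a multiple of 1/|y| uniformly in j,
integrability of the flux divided by |y| gives a dominating function, and the terms with ∇η_j
disappear in the limit. -/
lemma integral_eq_zero_of_cutoff {r : ℝ} (hr1 : r ≤ 1) {α : Space n → Space n} {β : Space n → ℝ}
    (hα : IntegrableOn (fun z => |yc z|⁻¹ • α z) (B n r)) (hβ : IntegrableOn β (B n r))
    (h0 : ∀ Φ : Space n → ℝ, IsTest (B n r \ charSet n) Φ →
      ∫ z in B n r, (inner ℝ (α z) (gradient Φ z) + β z * Φ z) = 0)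
    {φ : Space n → ℝ} (hφ : IsTest (B n r) φ) :
    ∫ z in B n r, (inner ℝ (α z) (gradient φ z) + β z * φ z) = 0 := by
  obtain ⟨M, hM, hb⟩ := hφ.exists_bound
  obtain ⟨C, hC, hη⟩ := exists_gradient_cutoff_le (n := n)
  have hαm : AEStronglyMeasurable α (volume.restrict (B n r)) := by
    refine (continuous_yc.abs.aestronglyMeasurable.smul hα.1).congr ?_
    filter_upwards [ae_yc_ne (B n r)] with z hz
    rw [Pi.smul_apply', smul_smul, mul_inv_cancel₀ (abs_ne_zero.2 hz), one_smul]
  have hg : ∀ j z, gradient (fun z => φ z * cutoff j z) z =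
      φ z • gradient (cutoff j) z + cutoff j z • gradient φ z := fun j z =>
    gradient_mul (hφ.1.differentiable (by simp) z) ((contDiff_cutoff j).differentiable (by simp) z)
  have hlim : Tendsto (fun j => ∫ z in B n r, (inner ℝ (α z)
      (gradient (fun z => φ z * cutoff j z) z) + β z * (φ z * cutoff j z))) atTop
      (𝓝 (∫ z in B n r, (inner ℝ (α z) (gradient φ z) + β z * φ z))) := by
    refine tendsto_integral_of_dominated_convergence
      (fun z => (M * C + M) * ‖|yc z|⁻¹ • α z‖ + M * ‖β z‖) (fun j => ?_)
      ((hα.norm.const_mul _).add (hβ.norm.const_mul _)) (fun j => ?_) ?_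
    · have h1 := hφ.mul_cutoff j
      exact (hαm.inner (continuous_gradient h1.1).aestronglyMeasurable).add
        (hβ.1.mul h1.1.continuous.aestronglyMeasurable)
    · filter_upwards [ae_restrict_ball] with z hz
      have hy : 0 < |yc z| := abs_pos.2 hz.2
      have hy1 : |yc z| ≤ 1 := (abs_yc_lt hz.1).le.trans hr1
      have hyi : 1 ≤ |yc z|⁻¹ := (one_le_inv₀ hy).2 hy1
      have h1 : ‖gradient (fun z => φ z * cutoff j z) z‖ ≤ (M * C + M) * |yc z|⁻¹ := by
        rw [hg]
        refine (norm_add_le _ _).trans ?_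
        rw [norm_smul, norm_smul, add_mul]
        refine add_le_add ?_ ?_
        · rw [mul_assoc]
          refine mul_le_mul (hb z).1 ?_ (norm_nonneg _) hM.le
          rw [← div_eq_mul_inv, le_div_iff₀ hy]
          exact hη j z
        · calc ‖cutoff j z‖ * ‖gradient φ z‖ ≤ 1 * M :=
                mul_le_mul (abs_cutoff_le j z) (hb z).2 (norm_nonneg _) zero_le_one
            _ = M * 1 := by ring
            _ ≤ _ := mul_le_mul_of_nonneg_left hyi hM.le
      refine (norm_add_le _ _).trans (add_le_add ?_ ?_)
      · refine (norm_inner_le_norm _ _).trans ?_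
        rw [norm_smul, norm_inv, norm_abs_eq_norm, Real.norm_eq_abs]
        calc ‖α z‖ * _ ≤ ‖α z‖ * ((M * C + M) * |yc z|⁻¹) :=
              mul_le_mul_of_nonneg_left h1 (norm_nonneg _)
          _ = _ := by ring
      · rw [norm_mul, norm_mul, mul_comm M]
        refine mul_le_mul_of_nonneg_left ?_ (norm_nonneg _)
        calc ‖φ z‖ * ‖cutoff j z‖ ≤ M * 1 :=
              mul_le_mul (hb z).1 (abs_cutoff_le j z) (norm_nonneg _) hM.le
          _ = M := mul_one M
    · filter_upwards [ae_restrict_ball] with z hz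
      refine tendsto_const_nhds.congr' ?_
      filter_upwards [eventually_cutoff_eq_one hz.2, eventually_gradient_cutoff_eq_zero hz.2]
        with j h1 h2
      rw [hg, h1, h2, smul_zero, zero_add, one_smul, mul_one]
  refine tendsto_nhds_unique hlim ?_
  simp only [h0 _ (hφ.mul_cutoff _)]
  exact tendsto_const_nhds

/-! ### The equation of the quotient off the characteristic manifold -/

section Equation

variable {A : Space n → Matrix (Fin (n + 1)) (Fin (n + 1)) ℝ}

/-- The field `z ↦ A(z) ξ(z)`. -/
noncomputable def applyMatrix (A : Space n → Matrix (Fin (n + 1)) (Fin (n + 1)) ℝ)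
    (ξ : Space n → Space n) (z : Space n) : Space n :=
  WithLp.toLp 2 (A z *ᵥ (ξ z).ofLp)

lemma inner_applyMatrix (ξ : Space n → Space n) (z w : Space n) :
    inner ℝ (applyMatrix A ξ z) w = (A z *ᵥ (ξ z).ofLp) ⬝ᵥ w.ofLp := by
  rw [real_inner_comm, ← dotProduct_eq_inner]; rfl

lemma aestronglyMeasurable_applyMatrix (hA : MatrixAssumption A) {r : ℝ} (hr : r ≤ 1)
    {ξ : Space n → Space n} (hξ : AEStronglyMeasurable ξ (volume.restrict (B n r))) :
    AEStronglyMeasurable (applyMatrix A ξ) (volume.restrict (B n r)) := by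
  have hAm : AEStronglyMeasurable (β := Fin (n + 1) → Fin (n + 1) → ℝ) A
      (volume.restrict (B n r)) :=
    ContinuousOn.aestronglyMeasurable (β := Fin (n + 1) → Fin (n + 1) → ℝ)
      (hA.cont.mono (Metric.ball_subset_ball hr)) Metric.isOpen_ball.measurableSet
  have hc : Continuous fun q : (Fin (n + 1) → Fin (n + 1) → ℝ) × Space n =>
      (WithLp.toLp 2 (Matrix.mulVec q.1 q.2.ofLp) : Space n) :=
    (PiLp.continuous_toLp 2 _).comp (Continuous.matrix_mulVec (A := fun q => q.1) continuous_fst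
      ((PiLp.continuous_ofLp 2 _).comp continuous_snd))
  exact hc.comp_aestronglyMeasurable (hAm.prodMk hξ)

lemma exists_norm_applyMatrix_le (hA : MatrixAssumption A) : ∃ L : ℝ, 0 < L ∧
    ∀ z ∈ B n 1, ∀ ξ : Space n → Space n, ‖applyMatrix A ξ z‖ ≤ L * ‖ξ z‖ := by
  obtain ⟨L, hL, h⟩ := hA.exists_dotProduct_le
  refine ⟨L, hL, fun z hz ξ => ?_⟩
  have h1 := h z hz (ξ z) (applyMatrix A ξ z)
  rw [← inner_applyMatrix, real_inner_self_eq_norm_sq, abs_of_nonneg (sq_nonneg _), pow_two] at h1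
  rcases (norm_nonneg (applyMatrix A ξ z)).eq_or_lt with h0 | h0
  · rw [← h0]; positivity
  · exact le_of_mul_le_mul_right h1 h0

/-- Here x = Φ and X = ∇Φ at the point. Substituting ∇u = v∇w + w∇v and A∇v = vG + ((1-a)/ρ)e_y, the
G-terms become the lower order terms of the equation of w. In the remaining ones ρ cancels and they
assemble, by the symmetry of A, into (1-a)(u∂_yΦ + Φ∂_yu). -/
lemma flux_identity (hA : MatrixAssumption A) {ε a : ℝ} (hε : 0 ≤ ε) (ha : a < 1)
    {Dv F g : Space n → Space n} {f u : Space n → ℝ} {z : Space n} (hz : z ∈ B n 1)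
    (hy : yc z ≠ 0) (hD : yc (Dv z) = (1 - a) * (rho ε (-a) (yc z) * (mu A z)⁻¹))
    (x : ℝ) (X : Space n) :
    inner ℝ (rho ε a (yc z) • (applyMatrix A g z + F z)) (vChar ε a A z • X + x • Dv z) -
        rho ε a (yc z) * f z * (x * vChar ε a A z) =
      (inner ℝ ((rho ε a (yc z) * vChar ε a A z ^ 2) • (applyMatrix A (fun z =>
          (vChar ε a A z)⁻¹ • (g z - (u z / vChar ε a A z) • Dv z)) z + auxField ε a A F z +
          (u z / vChar ε a A z) • fieldG ε a A Dv z)) X -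
        (rho ε a (yc z) * vChar ε a A z ^ 2) * (auxForcing ε a A f F Dv z +
          auxPotential ε a A Dv z * (u z / vChar ε a A z) +
          inner ℝ (-fieldG ε a A Dv z)
            ((vChar ε a A z)⁻¹ • (g z - (u z / vChar ε a A z) • Dv z))) * x) +
        (1 - a) * (u z * yc X + x * yc (g z)) := by
  have hv := vChar_ne_zero hA hε ha hz hy
  have hρ := (rho_pos hε a hy).ne'
  set v := vChar ε a A z with hvdef
  set ρ := rho ε a (yc z) with hρdef
  -- The gradient of w is kept opaque, so that every term can be expressed through it and the
  -- identity becomes polynomial after clearing ρ and v.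
  obtain ⟨gw, hgw⟩ : ∃ gw : Space n, gw = v⁻¹ • (g z - (u z / v) • Dv z) := ⟨_, rfl⟩
  have hg : g z = v • gw + (u z / v) • Dv z := by
    rw [hgw, smul_smul, mul_inv_cancel₀ hv, one_smul, sub_add_cancel]
  have hF : F z = v • auxField ε a A F z := by
    rw [auxField, ← hvdef, smul_smul, mul_inv_cancel₀ hv, one_smul]
  have hdot := dotProduct_gradient_vChar hA hε ha hz hy hD
  rw [← hvdef, ← hρdef] at hdot
  have hAg : ∀ Y : Space n, inner ℝ (applyMatrix A g z) Y =
      v * ((A z *ᵥ gw.ofLp) ⬝ᵥ Y.ofLp) +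
        u z / v * (v * inner ℝ (fieldG ε a A Dv z) Y + (1 - a) / ρ * yc Y) := fun Y => by
    rw [inner_applyMatrix, ← hdot, hg, WithLp.ofLp_add, WithLp.ofLp_smul, WithLp.ofLp_smul,
      Matrix.mulVec_add, Matrix.mulVec_smul, Matrix.mulVec_smul, add_dotProduct, smul_dotProduct,
      smul_dotProduct, smul_eq_mul, smul_eq_mul]
  have hsym : (A z *ᵥ gw.ofLp) ⬝ᵥ (Dv z).ofLp =
      v * inner ℝ (fieldG ε a A Dv z) gw + (1 - a) / ρ * yc gw := by
    rw [hA.dotProduct_comm hz, hdot]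
  have hyg : yc (g z) = v * yc gw + u z / v * yc (Dv z) := by
    rw [hg, yc_add, yc_smul, yc_smul]
  have e1 : ∀ Y, inner ℝ (F z) Y = v * inner ℝ (auxField ε a A F z) Y := fun Y => by
    rw [hF, inner_smul_left]; rfl
  have e2 : auxForcing ε a A f F Dv z = f z / v - inner ℝ (auxField ε a A F z) (Dv z) / v := rfl
  have e3 : auxPotential ε a A Dv z = -(inner ℝ (fieldG ε a A Dv z) (Dv z) / v) := rfl
  have e4 : ∀ Y, inner ℝ (applyMatrix A (fun z =>
      (vChar ε a A z)⁻¹ • (g z - (u z / vChar ε a A z) • Dv z)) z) Y =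
      (A z *ᵥ gw.ofLp) ⬝ᵥ Y.ofLp := fun Y => by
    rw [inner_applyMatrix, hgw]
  rw [← hgw]
  simp only [inner_add_right, inner_smul_right, real_inner_smul_left, inner_add_left, hAg, hsym,
    e1, e2, e3, e4, hyg, inner_neg_left]
  field_simp
  ring

/-- On compact sets off Σ the functions ρ and v are continuous, so F = vF̄ is recovered from the
hypothesis on F̄ and the weight of the flux is bounded. -/
lemma memLp_flux (hA : MatrixAssumption A) {ε a : ℝ} (hε : 0 ≤ ε) (ha : a < 1)
    {F g : Space n → Space n} {β γ : ℝ}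
    (hg : MemLp (fun z => |yc z| ^ β • g z) 2 (volume.restrict (B n 1)))
    (hgm : AEStronglyMeasurable g (volume.restrict (B n 1)))
    (hF : MemLp (fun z => |yc z| ^ γ • auxField ε a A F z) 2 (volume.restrict (B n 1)))
    {K : Set (Space n)} (hKO : K ⊆ B n 1 \ charSet n) (hK : IsCompact K) :
    MemLp (fun z => rho ε a (yc z) • (applyMatrix A g z + F z)) 2 (volume.restrict K) := by
  have hKm := hK.measurableSet
  have hK1 : K ⊆ B n 1 := hKO.trans sdiff_subset
  have hle := Measure.restrict_mono hK1 (le_refl (volume : Measure (Space n)))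
  obtain ⟨L, hL, hAL⟩ := exists_norm_applyMatrix_le hA
  have hvc := (continuousOn_vChar hA hε ha).mono hKO
  obtain ⟨Mv, hMv⟩ := hK.exists_bound_of_continuousOn hvc
  have hρc : ContinuousOn (fun z : Space n => rho ε a (yc z)) K := fun z hz =>
    (ContinuousAt.comp (g := rho ε a) (continuousAt_rho hε a (Or.inr (hKO hz).2))
      continuous_yc.continuousAt).continuousWithinAt
  obtain ⟨Mρ, hMρ⟩ := hK.exists_bound_of_continuousOn hρc
  have h1 : MemLp (applyMatrix A g) 2 (volume.restrict K) := by
    refine (memLp_compact_of_weighted hK hKO hg).of_le_mul (c := L)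
      ((aestronglyMeasurable_applyMatrix hA le_rfl hgm).mono_measure hle) ?_
    filter_upwards [ae_restrict_mem hKm] with z hz using hAL z (hK1 hz) g
  have h2 : MemLp F 2 (volume.restrict K) := by
    have h3 := memLp_compact_of_weighted hK hKO hF
    have e : ∀ z ∈ K, vChar ε a A z • auxField ε a A F z = F z := fun z hz => by
      rw [auxField, smul_smul, mul_inv_cancel₀ (vChar_ne_zero hA hε ha (hK1 hz) (hKO hz).2),
        one_smul]
    refine h3.of_le_mul (c := Mv) ?_ ?_
    · refine ((hvc.aestronglyMeasurable hKm).smul h3.1).congr ?_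
      filter_upwards [ae_restrict_mem hKm] with z hz using e z hz
    · filter_upwards [ae_restrict_mem hKm] with z hz
      conv_lhs => rw [← e z hz, norm_smul]
      exact mul_le_mul_of_nonneg_right (hMv z hz) (norm_nonneg _)
  refine (h1.add h2).of_le_mul (c := Mρ)
    ((hρc.aestronglyMeasurable hKm).smul (h1.1.add h2.1)) ?_
  filter_upwards [ae_restrict_mem hKm] with z hz
  rw [norm_smul]
  exact mul_le_mul_of_nonneg_right (hMρ z hz) (norm_nonneg _)

/-- The source is only known to be integrable against test functions; a bump equal to one near each
point gives local integrability. -/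
lemma integrableOn_compact_of_test {h : Space n → ℝ} {O : Set (Space n)} (hO : IsOpen O)
    (hh : ∀ φ : Space n → ℝ, IsTest O φ → IntegrableOn (fun z => h z * φ z) O)
    {K : Set (Space n)} (hKO : K ⊆ O) (hK : IsCompact K) : IntegrableOn h K := by
  refine LocallyIntegrableOn.integrableOn_compact_subset (s := O) (fun z hz => ?_) hKO hK
  obtain ⟨δ, hδ, hδO⟩ := Metric.isOpen_iff.1 hO z hz
  let ζ : ContDiffBump z := ⟨δ / 4, δ / 2, by positivity, by linarith⟩
  have hζ : IsTest O ζ := ⟨ζ.contDiff, ζ.hasCompactSupport, by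
    rw [ζ.tsupport_eq]
    exact (Metric.closedBall_subset_ball (show δ / 2 < δ by linarith)).trans hδO⟩
  have hs : Metric.ball z (δ / 4) ⊆ O := (Metric.ball_subset_ball (by linarith)).trans hδO
  refine ⟨Metric.ball z (δ / 4), mem_nhdsWithin_of_mem_nhds (Metric.ball_mem_nhds z (by positivity)),
    ((hh _ hζ).mono_set hs).congr_fun (fun w hw => ?_) Metric.isOpen_ball.measurableSet⟩
  have : ζ w = 1 := ζ.one_of_mem_closedBall (Metric.ball_subset_closedBall hw)
  simp [this]

end Equation

/-! ### Weak equation of the quotient off Σ and passage across Σ. -/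

section Ratio

variable {A : Space n → Matrix (Fin (n + 1)) (Fin (n + 1)) ℝ}

lemma ae_gradient_vChar (hA : MatrixAssumption A) {ε a : ℝ} (hε : 0 ≤ ε) (ha : a < 1)
    {Dv : Space n → Space n}
    (hDv : IsWeakGradient (B n 1 \ charSet n) (vChar ε a A) Dv) :
    ∀ᵐ z ∂(volume.restrict (B n 1)), z ∈ B n 1 ∧ yc z ≠ 0 ∧
      yc (Dv z) = (1 - a) * (rho ε (-a) (yc z) * (mu A z)⁻¹) := by
  have hd : ContinuousOn (fun z : Space n => (1 - a) * (rho ε (-a) (yc z) * (mu A z)⁻¹))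
      (B n 1 \ charSet n) := fun z hz => by
    refine ContinuousWithinAt.mul continuousWithinAt_const (ContinuousWithinAt.mul
      (ContinuousAt.comp (g := rho ε (-a)) (continuousAt_rho hε (-a) (Or.inr hz.2))
        continuous_yc.continuousAt).continuousWithinAt ?_)
    exact ((hA.continuousOn_mu.mono sdiff_subset) z hz).inv₀ (hA.mu_pos hz.1).ne'
  have h := ae_yc_weakGradient isOpen_ball_diff (continuousOn_vChar hA hε ha) hd
    (fun z hz => hasLineDerivAt_vChar hA hε ha hz) hDv.2.1 hDv.2.2
  filter_upwards [ae_restrict_ball, ae_restrict_of_ae h] with z hz h'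
  exact ⟨hz.1, hz.2, h' ⟨hz.1, hz.2⟩⟩

/-- The equation of `w = u / v`, tested away from the characteristic manifold. -/
lemma ratio_weakForm (hA : MatrixAssumption A) {ε a : ℝ} (hε : 0 ≤ ε) (ha : a < 1)
    {Dv F g : Space n → Space n} {f u : Space n → ℝ} {ψ : ℕ → Space n → ℝ} {β γ : ℝ}
    (hDv : IsWeakGradient (B n 1 \ charSet n) (vChar ε a A) Dv)
    (hD : ∀ K ⊆ B n 1 \ charSet n, IsCompact K → MemLp Dv 2 (volume.restrict K))
    (hψ : ∀ k, ContDiffOn ℝ ∞ (ψ k) (B n 1))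
    (hgm : AEStronglyMeasurable g (volume.restrict (B n 1)))
    (hu2 : MemLp (fun z => |yc z| ^ β • u z) 2 (volume.restrict (B n 1)))
    (hg2 : MemLp (fun z => |yc z| ^ β • g z) 2 (volume.restrict (B n 1)))
    (hu : Tendsto (fun k => eLpNorm (fun z => |yc z| ^ β • (ψ k z - u z)) 2
      (volume.restrict (B n 1))) atTop (𝓝 0))
    (hg : Tendsto (fun k => eLpNorm (fun z => |yc z| ^ β • (gradient (ψ k) z - g z)) 2
      (volume.restrict (B n 1))) atTop (𝓝 0))
    (hF : MemLp (fun z => |yc z| ^ γ • auxField ε a A F z) 2 (volume.restrict (B n 1)))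
    (heq : ∀ φ : Space n → ℝ, IsTest (B n 1 \ charSet n) φ →
      IntegrableOn (fun z => rho ε a (yc z) * f z * φ z) (B n 1) ∧
      ∫ z in B n 1, inner ℝ (rho ε a (yc z) • (applyMatrix A g z + F z)) (gradient φ z) =
        ∫ z in B n 1, rho ε a (yc z) * f z * φ z)
    {r : ℝ} (hr1 : r ≤ 1) {Φ : Space n → ℝ} (hΦ : IsTest (B n r \ charSet n) Φ) :
    ∫ z in B n r, (inner ℝ ((rho ε a (yc z) * vChar ε a A z ^ 2) • (applyMatrix A (fun z =>
          (vChar ε a A z)⁻¹ • (g z - (u z / vChar ε a A z) • Dv z)) z + auxField ε a A F z +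
          (u z / vChar ε a A z) • fieldG ε a A Dv z)) (gradient Φ z) +
        -((rho ε a (yc z) * vChar ε a A z ^ 2) * (auxForcing ε a A f F Dv z +
          auxPotential ε a A Dv z * (u z / vChar ε a A z) +
          inner ℝ (-fieldG ε a A Dv z)
            ((vChar ε a A z)⁻¹ • (g z - (u z / vChar ε a A z) • Dv z)))) * Φ z) = 0 := by
  have hΦ1 : IsTest (B n 1 \ charSet n) Φ :=
    hΦ.mono (sdiff_subset_sdiff_left (Metric.ball_subset_ball hr1))
  have hh : ∀ K ⊆ B n 1 \ charSet n, IsCompact K →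
      IntegrableOn (fun z => rho ε a (yc z) * f z) K := fun K hKO hK =>
    integrableOn_compact_of_test isOpen_ball_diff
      (fun φ hφ => (heq φ hφ).1.mono_set sdiff_subset) hKO hK
  obtain ⟨i1, i2, e1⟩ := weakForm_mul (continuousOn_vChar hA hε ha) hDv.2.2 hD
    (fun K hKO hK => memLp_flux hA hε ha hg2 hgm hF hKO hK) hh (fun φ hφ => (heq φ hφ).2) hΦ1
  obtain ⟨i3, e3⟩ := integral_mul_yc_gradient_add hψ hu2 hg2 hu hg hΦ1
  -- The tested equation of u minus the vanishing integral of (1-a)∂_y(uΦ); by the flux identity the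
  -- difference is the tested equation of w.
  have e4 : ∫ z in B n 1, (inner ℝ (rho ε a (yc z) • (applyMatrix A g z + F z))
      (vChar ε a A z • gradient Φ z + Φ z • Dv z) -
        rho ε a (yc z) * f z * (Φ z * vChar ε a A z) -
        (1 - a) * (u z * yc (gradient Φ z) + Φ z * yc (g z))) = 0 := by
    have s1 := integral_sub i1 i2
    have s2 := integral_sub (i1.sub i2) (i3.const_mul (1 - a))
    simp only [Pi.sub_apply] at s2
    rw [s2, s1, integral_const_mul, e3, e1]
    simp
  rw [setIntegral_eq_of_subset_of_forall_sdiff_eq_zero Metric.isOpen_ball.measurableSet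
    (Metric.ball_subset_ball hr1) fun z hz => ?_] at e4
  · rw [← e4]
    refine setIntegral_congr_ae Metric.isOpen_ball.measurableSet ?_
    have := ae_gradient_vChar hA hε ha hDv
    rw [ae_restrict_iff' Metric.isOpen_ball.measurableSet] at this
    filter_upwards [this] with z hz hzr
    obtain ⟨hz1, hy, hyD⟩ := hz (Metric.ball_subset_ball hr1 hzr)
    rw [flux_identity hA hε ha (u := u) hz1 hy hyD]
    ring
  · have h1 : z ∉ tsupport Φ := fun h => hz.2 (hΦ.2.2 h).1
    simp [image_eq_zero_of_notMem_tsupport h1, gradient_eq_zero_of_notMem h1, yc]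

/-- The square is |y|^(-b), integrable because b < 1. Thus 1/|y| is in L²(ω), and by Cauchy–Schwarz
an L²(ω) flux stays integrable after division by |y|. -/
lemma memLp_rpow_mul_inv_abs {b r : ℝ} (hb : b < 1) (hr1 : r ≤ 1) :
    MemLp (fun z : Space n => |yc z| ^ ((2 - b) / 2) • |yc z|⁻¹) 2 (volume.restrict (B n r)) := by
  refine (memLp_two_iff_integrable_sq ?_).2 ?_
  · exact ((measurable_pow_yc _).mul (continuous_yc.abs.measurable.inv)).aestronglyMeasurable
  · refine ((integrableOn_rpow_abs_yc (n := n) (β := -b) (by linarith)).mono_set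
      (Metric.ball_subset_ball hr1)).congr ?_
    filter_upwards [ae_restrict_ball] with z hz
    have hy : 0 < |yc z| := abs_pos.2 hz.2
    rw [smul_eq_mul, ← Real.rpow_neg_one, ← Real.rpow_add hy, ← Real.rpow_natCast,
      ← Real.rpow_mul hy.le]
    congr 1; push_cast; ring

/-- Absolute convergence and cutoff removal for a weighted equation. -/
lemma energy_identity_of_offChar (hA : MatrixAssumption A) {b r : ℝ} (hb : b < 1) (hr1 : r ≤ 1)
    {p q : Space n → ℝ} (hp : AEStronglyMeasurable p (volume.restrict (B n r)))
    (hc : Comparable p (B n r) (2 - b)) (hq : Measurable q) (hcq : Comparable q (B n r) (2 - b))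
    {w f V : Space n → ℝ} {gw F G : Space n → Space n}
    (hf : MemLp f 1 (wMeasure q (B n r)))
    (hF : MemLp (fun z => |yc z| ^ ((2 - b) / 2) • F z) 2 (volume.restrict (B n r)))
    (hG : MemLp (fun z => |yc z| ^ ((2 - b) / 2) • G z) 2 (volume.restrict (B n r)))
    (hV : MemLp (fun z => |yc z| ^ ((2 - b) / 2) • V z) 2 (volume.restrict (B n r)))
    (hw : MemLp (fun z => |yc z| ^ ((2 - b) / 2) • w z) 2 (volume.restrict (B n r)))
    (hwy : MemLp (fun z => |yc z| ^ ((2 - b) / 2) • (|yc z|⁻¹ * w z)) 2 (volume.restrict (B n r)))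
    (hgw : MemLp (fun z => |yc z| ^ ((2 - b) / 2) • gw z) 2 (volume.restrict (B n r)))
    (hwm : AEStronglyMeasurable w (volume.restrict (B n r)))
    (hfm : AEStronglyMeasurable f (volume.restrict (B n r)))
    (hVm : AEStronglyMeasurable V (volume.restrict (B n r)))
    (hFm : AEStronglyMeasurable F (volume.restrict (B n r)))
    (hGm : AEStronglyMeasurable G (volume.restrict (B n r)))
    (hgwm : AEStronglyMeasurable gw (volume.restrict (B n r)))
    (h0 : ∀ Φ : Space n → ℝ, IsTest (B n r \ charSet n) Φ → ∫ z in B n r,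
      (inner ℝ (p z • (applyMatrix A gw z + F z + w z • G z)) (gradient Φ z) +
        -(p z * (f z + V z * w z + inner ℝ (-G z) (gw z))) * Φ z) = 0)
    {φ : Space n → ℝ} (hφ : IsTest (B n r) φ) :
    IntegrableOn (fun z => p z * ((A z *ᵥ (gw z).ofLp) ⬝ᵥ (gradient φ z).ofLp)) (B n r) ∧
      IntegrableOn (fun z => p z * f z * φ z) (B n r) ∧
      IntegrableOn (fun z => p z * inner ℝ (F z) (gradient φ z)) (B n r) ∧
      IntegrableOn (fun z => p z * w z * inner ℝ (G z) (gradient φ z)) (B n r) ∧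
      IntegrableOn (fun z => p z * V z * w z * φ z) (B n r) ∧
      IntegrableOn (fun z => p z * inner ℝ (-G z) (gw z) * φ z) (B n r) ∧
      ∫ z in B n r, p z * ((A z *ᵥ (gw z).ofLp) ⬝ᵥ (gradient φ z).ofLp) =
        (∫ z in B n r, p z * f z * φ z)
          - (∫ z in B n r, p z * inner ℝ (F z) (gradient φ z))
          - (∫ z in B n r, p z * w z * inner ℝ (G z) (gradient φ z))
          + (∫ z in B n r, p z * V z * w z * φ z)
          + (∫ z in B n r, p z * inner ℝ (-G z) (gw z) * φ z) := by
  obtain ⟨M, hM, hφb⟩ := hφ.exists_bound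
  obtain ⟨L, hL, hAL⟩ := exists_norm_applyMatrix_le hA
  have hiy := memLp_rpow_mul_inv_abs (n := n) hb hr1
  have hiym : AEStronglyMeasurable (fun z : Space n => |yc z|⁻¹) (volume.restrict (B n r)) :=
    continuous_yc.abs.measurable.inv.aestronglyMeasurable
  have hAm := aestronglyMeasurable_applyMatrix hA hr1 hgwm
  -- the three parts of the flux, divided by `|y|`
  have j1 : IntegrableOn (fun z => p z • |yc z|⁻¹ • applyMatrix A gw z) (B n r) := by
    refine integrableOn_weighted_mul hp hc hgw hiy (hiym.smul hAm) (M := L) ?_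
    filter_upwards [ae_restrict_ball] with z hz
    rw [norm_smul]
    calc ‖|yc z|⁻¹‖ * ‖applyMatrix A gw z‖ ≤ ‖|yc z|⁻¹‖ * (L * ‖gw z‖) :=
          mul_le_mul_of_nonneg_left (hAL z (Metric.ball_subset_ball hr1 hz.1) gw) (norm_nonneg _)
      _ = _ := by ring
  have j2 : IntegrableOn (fun z => p z • |yc z|⁻¹ • F z) (B n r) :=
    integrableOn_weighted_mul hp hc hF hiy (hiym.smul hFm) (M := 1)
      (ae_of_all _ fun z => by rw [norm_smul, one_mul, mul_comm])
  have j3 : IntegrableOn (fun z => p z • |yc z|⁻¹ • w z • G z) (B n r) :=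
    integrableOn_weighted_mul hp hc hwy hG (hiym.smul (hwm.smul hGm)) (M := 1)
      (ae_of_all _ fun z => by rw [norm_smul, norm_smul, one_mul, norm_mul, mul_assoc])
  -- the zero order terms
  have j4 : IntegrableOn (fun z => p z * f z) (B n r) := by
    obtain ⟨c, C, hc0, hC, hb'⟩ := hcq
    obtain ⟨c', C', hc0', hC', hb''⟩ := hc
    have h1 := hf.2
    rw [eLpNorm_one_eq_lintegral_enorm, lintegral_wMeasure hq] at h1
    refine ⟨hp.mul hfm, lt_of_le_of_lt ?_ (ENNReal.mul_lt_top
      (ENNReal.ofReal_lt_top (r := C' * c⁻¹)) h1)⟩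
    rw [← lintegral_const_mul' _ _ ENNReal.ofReal_ne_top]
    refine lintegral_mono_ae ?_
    filter_upwards [ae_restrict_ball] with z hz
    have hy : 0 < |yc z| := abs_pos.2 hz.2
    have hpp : 0 ≤ p z := (by positivity : 0 ≤ c' * |yc z| ^ (2 - b)).trans (hb'' z hz.1 hz.2).1
    rw [enorm_mul, ← mul_assoc, ← ENNReal.ofReal_mul (by positivity), Real.enorm_of_nonneg hpp]
    refine mul_le_mul_left (ENNReal.ofReal_le_ofReal ?_) _
    calc p z ≤ C' * |yc z| ^ (2 - b) := (hb'' z hz.1 hz.2).2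
      _ = C' * c⁻¹ * (c * |yc z| ^ (2 - b)) := by field_simp
      _ ≤ _ := mul_le_mul_of_nonneg_left (hb' z hz.1 hz.2).1 (by positivity)
  have j5 : IntegrableOn (fun z => p z * (V z * w z)) (B n r) :=
    integrableOn_weighted_mul hp hc hV hw (hVm.mul hwm) (M := 1)
      (ae_of_all _ fun z => by rw [norm_mul, one_mul])
  have j6 : IntegrableOn (fun z => p z * inner ℝ (-G z) (gw z)) (B n r) :=
    integrableOn_weighted_mul hp hc hG hgw (hGm.neg.inner hgwm) (M := 1)
      (ae_of_all _ fun z => by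
        rw [one_mul, ← norm_neg (G z)]; exact norm_inner_le_norm _ _)
  have hgφ : Continuous (gradient φ) := continuous_gradient hφ.1
  have hflux : ∀ {X : Space n → Space n}, AEStronglyMeasurable X (volume.restrict (B n r)) →
      IntegrableOn (fun z => p z • |yc z|⁻¹ • X z) (B n r) →
      IntegrableOn (fun z => p z * inner ℝ (X z) (gradient φ z)) (B n r) := fun {X} hXm hX => by
    refine (hX.norm.mul_const M).mono' (hp.mul (hXm.inner hgφ.aestronglyMeasurable)) ?_
    filter_upwards [ae_restrict_ball] with z hz
    have hy : 0 < |yc z| := abs_pos.2 hz.2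
    have hyi : 1 ≤ |yc z|⁻¹ := (one_le_inv₀ hy).2 ((abs_yc_lt hz.1).le.trans hr1)
    rw [norm_mul, norm_smul, norm_smul, mul_assoc]
    refine mul_le_mul_of_nonneg_left ((norm_inner_le_norm _ _).trans ?_) (norm_nonneg _)
    refine mul_le_mul ?_ (hφb z).2 (norm_nonneg _) (by positivity)
    rw [Real.norm_of_nonneg (by positivity)]
    exact le_mul_of_one_le_left (norm_nonneg _) hyi
  have hzero : ∀ {k : Space n → ℝ}, IntegrableOn k (B n r) →
      IntegrableOn (fun z => k z * φ z) (B n r) := fun {k} hk => by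
    refine (hk.norm.mul_const M).mono' (hk.1.mul hφ.1.continuous.aestronglyMeasurable)
      (ae_of_all _ fun z => ?_)
    rw [norm_mul]
    exact mul_le_mul_of_nonneg_left (hφb z).1 (norm_nonneg _)
  have k1 := hflux hAm j1
  have k2 := hflux hFm j2
  have k3 := hflux (hwm.smul hGm) j3
  have k4 := hzero j4
  have k5 := hzero j5
  have k6 := hzero j6
  have hα : IntegrableOn (fun z => |yc z|⁻¹ • p z • (applyMatrix A gw z + F z + w z • G z))
      (B n r) := by
    refine ((j1.add j2).add j3).congr (ae_of_all _ fun z => ?_)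
    simp only [Pi.add_apply]
    module
  have hβ : IntegrableOn (fun z => -(p z * (f z + V z * w z + inner ℝ (-G z) (gw z)))) (B n r) := by
    refine ((j4.add j5).add j6).neg.congr (ae_of_all _ fun z => ?_)
    simp only [Pi.add_apply, Pi.neg_apply]
    ring
  have key := integral_eq_zero_of_cutoff hr1 hα hβ h0 hφ
  simp only [inner_applyMatrix] at k1
  have k3' : IntegrableOn (fun z => p z * w z * inner ℝ (G z) (gradient φ z)) (B n r) :=
    k3.congr (ae_of_all _ fun z => by
      simp only [Pi.smul_apply', real_inner_smul_left]; ring)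
  have k5' : IntegrableOn (fun z => p z * V z * w z * φ z) (B n r) :=
    k5.congr (ae_of_all _ fun z => by ring)
  refine ⟨k1, k4, k2, k3', k5', k6, ?_⟩
  have e : ∀ z, inner ℝ (p z • (applyMatrix A gw z + F z + w z • G z)) (gradient φ z) +
      -(p z * (f z + V z * w z + inner ℝ (-G z) (gw z))) * φ z =
      p z * ((A z *ᵥ (gw z).ofLp) ⬝ᵥ (gradient φ z).ofLp) - (p z * f z * φ z -
        p z * inner ℝ (F z) (gradient φ z) - p z * w z * inner ℝ (G z) (gradient φ z) +
        p z * V z * w z * φ z + p z * inner ℝ (-G z) (gw z) * φ z) := fun z => by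
    simp only [real_inner_smul_left, inner_add_left, inner_applyMatrix]
    ring
  simp only [e] at key
  have s1 := integral_sub k1 ((((k4.sub k2).sub k3').add k5').add k6)
  have s2 := integral_add (((k4.sub k2).sub k3').add k5') k6
  have s3 := integral_add ((k4.sub k2).sub k3') k5'
  have s4 := integral_sub (k4.sub k2) k3'
  have s5 := integral_sub k4 k2
  simp only [Pi.sub_apply, Pi.add_apply] at s1 s2 s3 s4
  linarith

end Ratio

/-! ### The equation of the ratio -/

section MainEquation

variable {A : Space n → Matrix (Fin (n + 1)) (Fin (n + 1)) ℝ}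

lemma wMeasure_mono (q : Space n → ℝ) {Ω Ω' : Set (Space n)} (h : Ω ⊆ Ω') :
    wMeasure q Ω ≤ wMeasure q Ω' := by
  refine Measure.le_iff.2 fun s hs => ?_
  rw [wMeasure, wMeasure, withDensity_apply _ hs, withDensity_apply _ hs]
  exact lintegral_mono' (Measure.restrict_mono le_rfl (Measure.restrict_mono h le_rfl)) le_rfl

lemma evenInY_ratio (hA : MatrixAssumption A) (ε a : ℝ) {u : Space n → ℝ}
    (hodd : OddInY (B n 1) u) {r : ℝ} (hr1 : r ≤ 1) :
    EvenInY (B n r) (fun z => u z / vChar ε a A z) := by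
  have h := ae_mono (Measure.restrict_mono (Metric.ball_subset_ball hr1) le_rfl) hodd
  filter_upwards [h, ae_restrict_mem Metric.isOpen_ball.measurableSet] with z hz hzr
  rw [hz, vChar_reflect hA ε a (Metric.ball_subset_ball hr1 hzr), neg_div_neg_eq]

theorem isEnergySolution_ratio (hn : 1 ≤ n) {ε a : ℝ} (ha : a < 1) (hε : 0 ≤ ε)
    (hA : MatrixAssumption A) {f u : Space n → ℝ} {F Dv : Space n → Space n}
    (hDv : IsWeakGradient (B n 1 \ charSet n) (vChar ε a A) Dv)
    (hsol : IsEnergySolution (fun z => rho ε a (yc z)) (fun z => rho ε a (yc z)) A f F 0 0 0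
      (B n 1) u)
    (hodd : OddInY (B n 1) u)
    (hI : AuxIntegrability a (fun z => omega ε a (yc z)) (auxForcing ε a A f F Dv)
      (auxField ε a A F) (fieldG ε a A Dv) (auxPotential ε a A Dv)
      (fun z => -fieldG ε a A Dv z)) {r : ℝ} (hr : 0 < r) (hr1 : r < 1) :
    IsEnergySolution (fun z => rho ε a (yc z) * vChar ε a A z ^ 2)
      (fun z => omega ε a (yc z)) A (auxForcing ε a A f F Dv) (auxField ε a A F)
      (fieldG ε a A Dv) (auxPotential ε a A Dv) (fun z => -fieldG ε a A Dv z)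
      (B n r) (fun z => u z / vChar ε a A z) := by
  obtain ⟨g, ⟨hu2, hg2, ψ, hψ, hψu, hψg⟩, heq⟩ := hsol
  set b := wExp ε a with hbdef
  have hb : b < 1 := wExp_lt_one ha ε
  have hbr : Metric.ball (0 : Space n) r ⊆ Metric.ball 0 1 := Metric.ball_subset_ball hr1.le
  have hle : volume.restrict (B n r) ≤ (volume.restrict (B n 1) : Measure (Space n)) :=
    Measure.restrict_mono hbr le_rfl
  -- the weights
  have hρm : Measurable (fun z : Space n => rho ε a (yc z)) :=
    (measurable_rho ε a).comp measurable_yc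
  have hcρ := comparable_rho (n := n) hε a
  have hωm : Measurable (fun z : Space n => omega ε a (yc z)) :=
    (measurable_omega hε ha).comp measurable_yc
  have hcω := comparable_omega (n := n) hε ha
  have hcv := comparable_vChar hA hε ha
  rw [← hbdef] at hcρ hcω hcv
  have hfin := isFiniteMeasure_wMeasure hωm (by linarith) hcω
  have hacρ := absolutelyContinuous_wMeasure hρm hcρ.ae_pos
  have hacω := absolutelyContinuous_wMeasure hωm hcω.ae_pos
  have hum := hu2.1.mono_ac hacρ
  have hgm := hg2.1.mono_ac hacρ
  rw [hcρ.memLp_iff hρm] at hu2 hg2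
  rw [hcρ.tendsto_iff hρm] at hψu hψg
  have hψ' : ∀ k, ContDiffOn ℝ ∞ (ψ k) (B n 1) := fun k => (hψ k).1
  have hy := memLp_div_yc_of_odd hb hψ' hu2 hg2 hψu hψg hodd
  -- the coefficients
  have hmax : 0 ≤ max (-a) 0 := le_max_right _ _
  have hn' : (1 : ℝ) ≤ n := by exact_mod_cast hn
  have hd4 : 4 ≤ effDim n a := by rw [effDim]; linarith
  have hdn : (n : ℝ) + 1 ≤ effDim n a := by rw [effDim]; linarith
  -- The effective dimension exceeds n + 1 by 2 + (-a)⁺, which is at least the exponent 2 - b of ω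
  -- in both cases ε = 0 and ε > 0. Hence |y|^(d-n-1)|G|^d is integrable.
  have hdb : 2 - b ≤ effDim n a - (n + 1) := by
    rw [effDim, hbdef, wExp]
    split_ifs <;> linarith [le_max_left (-a) 0]
  obtain ⟨p₁, hp₁, hf⟩ := hI.forcing
  obtain ⟨p₂, hp₂, hF⟩ := hI.field
  obtain ⟨p₃, hp₃, hG⟩ := hI.fieldw
  obtain ⟨p₄, hp₄, hV⟩ := hI.potential
  have two_le : ∀ {x : ℝ}, 2 ≤ x → (2 : ℝ≥0∞) ≤ ENNReal.ofReal x := fun {x} hx => by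
    rw [← ENNReal.ofReal_ofNat 2]; exact ENNReal.ofReal_le_ofReal hx
  -- Only integrability of the forcing is used, since test functions are bounded; 2d/(d+2) ≥ 1 as d
  -- ≥ 2.
  have hf1 := hf.mono_exponent (p := 1) (le_trans (by
    rw [← ENNReal.ofReal_one]
    refine ENNReal.ofReal_le_ofReal ?_
    rw [le_div_iff₀ (by linarith)]
    linarith) hp₁)
  have hF2 := hF.mono_exponent hp₂
  have hGint := lintegral_rpow_abs_yc_mul_ne_top hωm (by linarith) hcω (by linarith) hdb hp₃ hG
  have hG2 := hG.mono_exponent ((two_le (by linarith)).trans hp₃)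
  -- As d ≥ 4, the exponent d/2 is at least 2, so the potential pairs with w in L²(ω).
  have hV2 := hV.mono_exponent ((two_le (by linarith)).trans hp₄)
  have hfm := hf1.1.mono_ac hacω
  have hFm := hF2.1.mono_ac hacω
  have hGm := hG2.1.mono_ac hacω
  have hVm := hV2.1.mono_ac hacω
  rw [hcω.memLp_iff hωm] at hF2 hG2 hV2
  have hGint' : ∫⁻ z in B n 1, ENNReal.ofReal (|yc z|) ^ (effDim n a - (n + 1)) *
      ‖fieldG ε a A Dv z‖ₑ ^ effDim n a ≠ (⊤ : ℝ≥0∞) := by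
    simpa only [ENNReal.ofReal_rpow_of_nonneg (abs_nonneg _)
      (by linarith : 0 ≤ effDim n a - (n + 1))] using hGint
  -- the characteristic function
  have hvc := continuousOn_vChar hA hε ha
  obtain ⟨C, hC, hDb⟩ := exists_norm_gradient_vChar_le hA hε ha Dv
  have hDb' : ∀ᵐ z ∂(volume.restrict (B n 1)),
      ‖Dv z‖ ≤ C * |vChar ε a A z| * (‖fieldG ε a A Dv z‖ + |yc z|⁻¹) := by
    filter_upwards [ae_gradient_vChar hA hε ha hDv] with z hz using hDb z hz.1 hz.2.1 hz.2.2
  have hD : ∀ K ⊆ B n 1 \ charSet n, IsCompact K → MemLp Dv 2 (volume.restrict K) :=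
    fun K hKO hK => memLp_compact_of_norm_le hK hKO hvc hDv.2.1 hC hDb' hG2
  have hvm := aestronglyMeasurable_of_continuousOn hr1.le hvc
  have hDm := aestronglyMeasurable_of_locallyIntegrableOn hr1.le hDv.2.1
  -- the ratio belongs to the weighted space
  obtain ⟨Φ, hΦ, t1, t2, t3, t4, huG⟩ := exists_test_approx_mul hn hd4 hdn hGm hGint' hψ' hum hgm
    hu2 hg2 hψu hψg hy hr hr1
  have hw := memH1_quotient hr1.le hvc hcv hDv.2.2 hDv.2.1 hD hC hDb' (hGm.mono_measure hle)
    (hu2.mono_measure hle) (hum.mono_measure hle) (hgm.mono_measure hle) (hg2.mono_measure hle)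
    (hy.mono_measure hle) huG hΦ t1 t2 t3 t4 hωm hcω
  have hcωr := hcω.mono hbr
  have hwm := ((hum.mono_measure hle).aemeasurable.div hvm.aemeasurable).aestronglyMeasurable
  have hgwm := hvm.aemeasurable.inv.aestronglyMeasurable.smul ((hgm.mono_measure hle).sub (hwm.smul hDm))
  have hw2 := (hcωr.memLp_iff hωm).1 hw.1
  have hgw2 := (hcωr.memLp_iff hωm).1 hw.2.1
  -- Hardy's bound on u/y, divided by v: w/|y| is in L²(ω). It makes the flux wG integrable after
  -- division by |y|, as cutoff removal requires.
  have hwy : MemLp (fun z => |yc z| ^ ((2 - b) / 2) • (|yc z|⁻¹ * (u z / vChar ε a A z))) 2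
      (volume.restrict (B n r)) := by
    obtain ⟨c, C', hc, -, hcv⟩ := hcv
    refine (hy.mono_measure hle).of_le_mul (c := c⁻¹) ?_ ?_
    · exact (measurable_pow_yc _).aestronglyMeasurable.smul
        (measurable_yc.abs.inv.aestronglyMeasurable.mul hwm)
    · filter_upwards [ae_restrict_ball] with z hz
      have hy0 : 0 < |yc z| := abs_pos.2 hz.2
      have h := rpow_mul_inv_le hc hz.2 (hcv z (hbr hz.1) hz.2).1
      rw [norm_smul, norm_mul, norm_div, norm_inv, norm_mul, Real.norm_of_nonneg (by positivity),
        Real.norm_of_nonneg (by positivity : 0 ≤ |yc z| ^ (b / 2 - 1)),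
        Real.norm_of_nonneg hy0.le, Real.rpow_sub_one hy0.ne', div_eq_mul_inv,
        Real.norm_eq_abs (vChar ε a A z)]
      calc _ = |yc z| ^ ((2 - b) / 2) * |vChar ε a A z|⁻¹ * (|yc z|⁻¹ * ‖u z‖) := by ring_nf
        _ ≤ c⁻¹ * |yc z| ^ (b / 2) * (|yc z|⁻¹ * ‖u z‖) :=
          mul_le_mul_of_nonneg_right h (by positivity)
        _ = _ := by ring
  -- the equation
  have hoff : ∀ φ : Space n → ℝ, IsTest (B n 1 \ charSet n) φ →
      IntegrableOn (fun z => rho ε a (yc z) * f z * φ z) (B n 1) ∧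
      ∫ z in B n 1, inner ℝ (rho ε a (yc z) • (applyMatrix A g z + F z)) (gradient φ z) =
        ∫ z in B n 1, rho ε a (yc z) * f z * φ z := fun φ hφ => by
    obtain ⟨k1, k2, k3, -, -, -, e⟩ := heq φ (hφ.mono sdiff_subset) (memH1_of_isTest hρm hcρ hφ)
    refine ⟨k2, ?_⟩
    have s := integral_add k1 k3
    simp only [Pi.zero_apply, inner_zero_left, mul_zero, zero_mul, integral_zero, sub_zero,
      add_zero] at e
    simp only [real_inner_smul_left, inner_add_left, mul_add, inner_applyMatrix]
    linarith
  have hcp := (comparable_mul_sq hε hcv).mono hbr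
  have hpm : AEStronglyMeasurable (fun z => rho ε a (yc z) * vChar ε a A z ^ 2)
      (volume.restrict (B n r)) := hρm.aestronglyMeasurable.mul (hvm.pow 2)
  exact ⟨_, hw, fun φ hφ _ => energy_identity_of_offChar hA hb hr1.le hpm hcp hωm hcωr
    (hf1.mono_measure (wMeasure_mono _ hbr)) (hF2.mono_measure hle) (hG2.mono_measure hle)
    (hV2.mono_measure hle) hw2 hwy hgw2 hwm (hfm.mono_measure hle) (hVm.mono_measure hle)
    (hFm.mono_measure hle) (hGm.mono_measure hle) hgwm
    (fun _ hΦ => ratio_weakForm hA hε ha hDv hD hψ' hgm hu2 hg2 hψu hψg hF2 hoff hr1.le hΦ) hφ⟩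

end MainEquation

/-! ### The model case -/

section Model

lemma integral_gradient_eq_zero {Ω : Set (Space n)} {χ : Space n → ℝ} (hχ : IsTest Ω χ) :
    ∫ z, gradient χ z = 0 := by
  have hi : Integrable (gradient χ) := (continuous_gradient hχ.1).integrable_of_hasCompactSupport
    (hχ.2.1.mono' ((subset_tsupport _).trans (tsupport_gradient_subset χ)))
  refine ext_inner_left ℝ fun w => ?_
  rw [inner_zero_right, ← integral_inner hi]
  refine integral_lineDeriv_eq_zero (f := χ) (v := w)
    (hχ.1.continuous.integrable_of_hasCompactSupport hχ.2.1) (hi.const_inner w) fun z => ?_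
  rw [real_inner_comm, inner_gradient_left]
  exact ((hχ.1.differentiable (by simp)) z).hasFDerivAt.hasLineDerivAt _

/-- The product φf is a test function, so its gradient has zero integral, and the product rule gives
the claim. -/
lemma isWeakGradient_of_contDiffOn {O : Set (Space n)} (hO : IsOpen O) {f : Space n → ℝ}
    (hf : ContDiffOn ℝ ∞ f O) : IsWeakGradient O f (gradient f) := by
  have hfl := hf.continuousOn.locallyIntegrableOn (μ := volume) hO.measurableSet
  have hgl := (continuousOn_gradient hO hf).locallyIntegrableOn (μ := volume) hO.measurableSet
  refine ⟨hfl, hgl, fun φ hφ => ?_⟩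
  have hz0 : ∀ z, z ∉ tsupport φ → φ z = 0 := fun z hz => image_eq_zero_of_notMem_tsupport hz
  have i1 : Integrable (fun z => φ z • gradient f z) :=
    integrable_smul_of_support_subset hφ.1.continuous hφ.2.1 hz0
      (hgl.integrableOn_compact_subset hφ.2.2 hφ.2.1)
  have i2 : Integrable (fun z => f z • gradient φ z) := by
    have := (hfl.integrableOn_compact_subset hφ.2.2 hφ.2.1).smul_continuousOn
      (continuous_gradient hφ.1).continuousOn hφ.2.1
    refine (integrableOn_iff_integrable_of_support_subset fun z hz => ?_).1 this
    by_contra h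
    exact hz (by simp [gradient_eq_zero_of_notMem h])
  rw [setIntegral_eq_integral_of_forall_compl_eq_zero
      (fun z hz => by rw [gradient_eq_zero_of_notMem (fun h => hz (hφ.2.2 h)), smul_zero]),
    setIntegral_eq_integral_of_forall_compl_eq_zero
      (fun z hz => by rw [hz0 z (fun h => hz (hφ.2.2 h)), zero_smul]), eq_neg_iff_add_eq_zero,
    ← integral_add i2 i1, ← integral_gradient_eq_zero (hφ.mul_contDiffOn hO hf)]
  refine integral_congr_ae (ae_of_all _ fun z => ?_)
  by_cases hz : z ∈ tsupport φ
  · have hzO := hφ.2.2 hz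
    beta_reduce
    rw [gradient_mul ((hφ.1.differentiable (by simp)) z)
      ((hf.differentiableOn (by simp)).differentiableAt (hO.mem_nhds hzO)), add_comm]
  · have h : z ∉ tsupport fun z => φ z * f z := fun h => hz (tsupport_mul_subset_left h)
    beta_reduce
    rw [gradient_eq_zero_of_notMem hz, gradient_eq_zero_of_notMem h, hz0 z hz]
    simp

lemma matrixAssumption_one : MatrixAssumption (n := n) (fun _ => 1) where
  symm _ _ := Matrix.isSymm_one
  reflection _ _ := by
    rw [mul_one, matJ, Matrix.diagonal_mul_diagonal, ← Matrix.diagonal_one]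
    congr 1
    ext i
    split_ifs <;> norm_num
  cont := continuousOn_const
  elliptic := ⟨1, 1, one_pos, le_rfl, fun _ _ ξ => by simp⟩
  invariant _ _ := by rw [Matrix.one_mulVec]; simp [mu]

lemma hasDerivAt_mul_rpow_abs (a : ℝ) {y : ℝ} (hy : y ≠ 0) :
    HasDerivAt (fun y : ℝ => y * |y| ^ (-a)) ((1 - a) * |y| ^ (-a)) y := by
  have hy' : 0 < |y| := abs_pos.2 hy
  have h := (hasDerivAt_id y).mul ((hasDerivAt_abs hy).rpow_const (p := -a) (Or.inl hy'.ne'))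
  refine h.congr_deriv ?_
  rw [Real.rpow_sub_one hy'.ne', id]
  rcases lt_or_gt_of_ne hy with h0 | h0
  · rw [sign_neg h0, abs_of_neg h0, SignType.coe_neg_one]
    field_simp
    ring
  · rw [sign_pos h0, abs_of_pos h0, SignType.coe_one]
    field_simp
    ring

lemma integral_rpow_abs {a : ℝ} (ha : a < 1) (y : ℝ) :
    (1 - a) * ∫ s in (0 : ℝ)..y, |s| ^ (-a) = y * |y| ^ (-a) := by
  have ha' : 1 - a ≠ 0 := by linarith
  have key : ∀ y : ℝ, 0 < y → (1 - a) * ∫ s in (0 : ℝ)..y, |s| ^ (-a) = y * |y| ^ (-a) :=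
      fun y hy => by
    rw [intervalIntegral.integral_congr (g := fun s : ℝ => s ^ (-a)) fun s hs => by
      rw [uIcc_of_le hy.le] at hs; simp only [abs_of_nonneg hs.1]]
    rw [integral_rpow (Or.inl (by linarith)), Real.zero_rpow (by linarith), abs_of_pos hy,
      Real.rpow_add_one hy.ne', sub_zero, neg_add_eq_sub, mul_div_cancel₀ _ ha', mul_comm]
  rcases lt_trichotomy y 0 with h | rfl | h
  · have h1 := intervalIntegral.integral_comp_neg (a := (0 : ℝ)) (b := y) (fun s => |s| ^ (-a))
    have h2 := key (-y) (by linarith)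
    simp only [abs_neg, neg_zero] at h1 h2
    rw [h1, intervalIntegral.integral_symm]
    linarith
  · simp
  · exact key y h

lemma vChar_one {a : ℝ} (ha : a < 1) (z : Space n) :
    vChar 0 a (fun _ => 1) z = yc z * |yc z| ^ (-a) := by
  rw [← integral_rpow_abs ha]
  simp [vChar, rho, mu]

lemma isWeakGradient_vChar_one {a : ℝ} (ha : a < 1) :
    IsWeakGradient (B n 1 \ charSet n) (vChar 0 a (fun _ => 1))
      (fun z => ((1 - a) * |yc z| ^ (-a)) • ey n) := by
  have hv : vChar 0 a (fun _ => 1) = fun z : Space n => yc z * |yc z| ^ (-a) :=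
    funext fun z => vChar_one ha z
  have hs : ContDiffOn ℝ ∞ (fun z : Space n => yc z * |yc z| ^ (-a)) (B n 1 \ charSet n) :=
    fun z hz => by
    refine ContDiffAt.contDiffWithinAt (contDiff_yc.contDiffAt.mul ?_)
    exact ContDiffAt.rpow_const_of_ne
      ((contDiffAt_abs hz.2).comp z contDiff_yc.contDiffAt) (abs_ne_zero.2 hz.2)
  have hg : ∀ z ∈ B n 1 \ charSet n, gradient (fun z : Space n => yc z * |yc z| ^ (-a)) z =
      ((1 - a) * |yc z| ^ (-a)) • ey n := fun z hz => by
    have hd := hasDerivAt_mul_rpow_abs a (y := yc z) hz.2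
    have := gradient_comp (h := fun y : ℝ => y * |y| ^ (-a)) (f := yc) (z := z)
      hd.differentiableAt (contDiff_yc (m := 1)).differentiable_one.differentiableAt
    rw [gradient_yc, hd.deriv] at this
    exact this
  obtain ⟨h1, h2, h3⟩ := isWeakGradient_of_contDiffOn isOpen_ball_diff hs
  rw [hv]
  refine ⟨h1, ?_, fun φ hφ => ?_⟩
  · refine ContinuousOn.locallyIntegrableOn ?_ isOpen_ball_diff.measurableSet
    exact (continuousOn_gradient isOpen_ball_diff hs).congr fun z hz => (hg z hz).symm
  · rw [h3 φ hφ]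
    congr 1
    refine setIntegral_congr_fun isOpen_ball_diff.measurableSet fun z hz => ?_
    beta_reduce
    rw [hg z hz]

/-- The gradient is vertical and T = 0, so every component of G contains a vanishing factor: v is an
exact solution in the model case. -/
lemma fieldG_one {a : ℝ} (k : Space n → ℝ) :
    fieldG 0 a (fun _ => 1) (fun z => k z • ey n) = 0 := by
  have hT : fieldT (n := n) (fun _ => 1) = 0 := by
    ext z i
    simp [fieldT, Fin.castSucc_ne_last]
  have hx : ∀ z, xPart (k z • ey n) = 0 := fun z => by
    ext i
    simp [xPart, ey, Fin.castSucc_ne_last]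
  ext z i
  simp only [fieldG, bField, barT, hT, hx]
  refine Fin.lastCases ?_ (fun i => ?_) i <;> simp [mkVec]

lemma abs_rpow_mul_sq (a y : ℝ) (ha : a < 1) :
    |y| ^ a * (y * |y| ^ (-a)) ^ 2 = |y| ^ (2 - a) := by
  rcases eq_or_ne y 0 with rfl | hy
  · have : 2 - a ≠ 0 := by linarith
    simp [Real.zero_rpow this]
  · have hy' : 0 < |y| := abs_pos.2 hy
    have hp : |y| ^ a ≠ 0 := (Real.rpow_pos_of_pos hy' _).ne'
    rw [Real.rpow_neg hy'.le, Real.rpow_sub hy', Real.rpow_two, sq_abs]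
    field_simp

/-- The general result with ε = 0, A = 𝕀, F = 0, where v is the explicit function y|y|^(-a), smooth
off Σ. There ω and ρv² both equal |y|^(2-a), and the drift and potential vanish with G. -/
theorem ratio_model (hn : 1 ≤ n) {a : ℝ} (ha : a < 1) {f u : Space n → ℝ}
    (hsol : IsEnergySolution (fun z => |yc z| ^ a) (fun z => |yc z| ^ a) (fun _ => 1) f 0 0 0 0
      (B n 1) u)
    (hodd : OddInY (B n 1) u)
    (hI : AuxIntegrability a (fun z => |yc z| ^ (2 - a))
      (fun z => f z / (yc z * |yc z| ^ (-a))) 0 0 0 0) {r : ℝ} (hr : 0 < r) (hr1 : r < 1) :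
    EvenInY (B n r) (fun z => u z / (yc z * |yc z| ^ (-a))) ∧
      IsEnergySolution (fun z => |yc z| ^ (2 - a)) (fun z => |yc z| ^ (2 - a))
        (fun _ => 1) (fun z => f z / (yc z * |yc z| ^ (-a))) 0 0 0 0
        (B n r) (fun z => u z / (yc z * |yc z| ^ (-a))) := by
  have hA := matrixAssumption_one (n := n)
  have hρ : (fun z : Space n => rho 0 a (yc z)) = fun z => |yc z| ^ a := by simp [rho]
  have hω : (fun z : Space n => omega 0 a (yc z)) = fun z => |yc z| ^ (2 - a) := by
    ext z
    have : chi 0 a (yc z) = ∫ s in (0 : ℝ)..yc z, |s| ^ (-a) := by simp [chi, rho]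
    rw [omega, this, mul_assoc, ← mul_pow, integral_rpow_abs ha, ← abs_rpow_mul_sq a _ ha]
    simp [rho]
  have hp : (fun z : Space n => rho 0 a (yc z) * vChar 0 a (fun _ => 1) z ^ 2) =
      fun z => |yc z| ^ (2 - a) := by
    ext z
    rw [vChar_one ha, ← abs_rpow_mul_sq a _ ha]
    simp [rho]
  have hG := fieldG_one (n := n) (a := a) fun z => (1 - a) * |yc z| ^ (-a)
  have hb : (fun z : Space n => -fieldG 0 a (fun _ => 1)
      (fun z => ((1 - a) * |yc z| ^ (-a)) • ey n) z) = 0 := by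
    rw [hG]; ext; simp
  have hV : auxPotential (n := n) 0 a (fun _ => 1)
      (fun z => ((1 - a) * |yc z| ^ (-a)) • ey n) = 0 := by
    ext z; simp [auxPotential, hG]
  have hF : auxField (n := n) 0 a (fun _ => 1) 0 = 0 := by
    ext z; simp [auxField]
  have hf : auxForcing (n := n) 0 a (fun _ => 1) f 0
      (fun z => ((1 - a) * |yc z| ^ (-a)) • ey n) = fun z => f z / (yc z * |yc z| ^ (-a)) := by
    ext z; simp [auxForcing, vChar_one ha]
  have hw : (fun z : Space n => u z / vChar 0 a (fun _ => 1) z) =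
      fun z => u z / (yc z * |yc z| ^ (-a)) := by
    ext z; rw [vChar_one ha]
  have h := isEnergySolution_ratio hn ha le_rfl hA (f := f) (u := u) (F := 0)
    (isWeakGradient_vChar_one ha) (by rwa [hρ]) hodd (by rwa [hω, hb, hf, hF, hG, hV]) hr hr1
  have he := evenInY_ratio hA 0 a hodd hr1.le
  rw [hω, hb, hf, hF, hG, hV, hp, hw] at h
  rw [hw] at he
  exact ⟨he, h⟩

end Model

end OddRatio

theorem mainTheorem6 (n : ℕ) (hn : 1 ≤ n) (a : ℝ) (ha : a < 1) :
    (∀ (ε : ℝ) (A : OddRatio.Space n → Matrix (Fin (n + 1)) (Fin (n + 1)) ℝ)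
        (f u : OddRatio.Space n → ℝ) (F Dv : OddRatio.Space n → OddRatio.Space n),
      0 ≤ ε →
      OddRatio.MatrixAssumption A →
      OddRatio.IsWeakGradient (OddRatio.B n 1 \ OddRatio.charSet n)
        (OddRatio.vChar ε a A) Dv →
      OddRatio.IsEnergySolution
        (fun z => OddRatio.rho ε a (OddRatio.yc z)) (fun z => OddRatio.rho ε a (OddRatio.yc z))
        A f F 0 0 0 (OddRatio.B n 1) u →
      OddRatio.OddInY (OddRatio.B n 1) u →
      OddRatio.AuxIntegrability a (fun z => OddRatio.omega ε a (OddRatio.yc z))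
        (OddRatio.auxForcing ε a A f F Dv) (OddRatio.auxField ε a A F)
        (OddRatio.fieldG ε a A Dv) (OddRatio.auxPotential ε a A Dv)
        (fun z => -OddRatio.fieldG ε a A Dv z) →
      ∀ r : ℝ, 0 < r → r < 1 →
        OddRatio.EvenInY (OddRatio.B n r) (fun z => u z / OddRatio.vChar ε a A z) ∧
        OddRatio.IsEnergySolution
          (fun z => OddRatio.rho ε a (OddRatio.yc z) * OddRatio.vChar ε a A z ^ 2)
          (fun z => OddRatio.omega ε a (OddRatio.yc z))
          A (OddRatio.auxForcing ε a A f F Dv) (OddRatio.auxField ε a A F)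
          (OddRatio.fieldG ε a A Dv) (OddRatio.auxPotential ε a A Dv)
          (fun z => -OddRatio.fieldG ε a A Dv z)
          (OddRatio.B n r) (fun z => u z / OddRatio.vChar ε a A z)) ∧
    (∀ f u : OddRatio.Space n → ℝ,
      OddRatio.IsEnergySolution
        (fun z => |OddRatio.yc z| ^ a) (fun z => |OddRatio.yc z| ^ a)
        (fun _ => 1) f 0 0 0 0 (OddRatio.B n 1) u →
      OddRatio.OddInY (OddRatio.B n 1) u →
      OddRatio.AuxIntegrability a (fun z => |OddRatio.yc z| ^ (2 - a))
        (fun z => f z / (OddRatio.yc z * |OddRatio.yc z| ^ (-a))) 0 0 0 0 →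
      ∀ r : ℝ, 0 < r → r < 1 →
        OddRatio.EvenInY (OddRatio.B n r)
          (fun z => u z / (OddRatio.yc z * |OddRatio.yc z| ^ (-a))) ∧
        OddRatio.IsEnergySolution
          (fun z => |OddRatio.yc z| ^ (2 - a)) (fun z => |OddRatio.yc z| ^ (2 - a))
          (fun _ => 1) (fun z => f z / (OddRatio.yc z * |OddRatio.yc z| ^ (-a))) 0 0 0 0
          (OddRatio.B n r) (fun z => u z / (OddRatio.yc z * |OddRatio.yc z| ^ (-a)))) := by
  refine ⟨fun ε A f u F Dv hε hA hDv hsol hodd hI r hr hr1 => ?_,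
    fun f u hsol hodd hI r hr hr1 => OddRatio.ratio_model hn ha hsol hodd hI hr hr1⟩
  exact ⟨OddRatio.evenInY_ratio hA ε a hodd hr1.le,
    OddRatio.isEnergySolution_ratio hn ha hε hA hDv hsol hodd hI hr hr1⟩
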